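/- For $A\subset\mathbb{N}=\{1,2,\dots\}$ let $A(t)=|A\cap[1,t]|$, let $\mathrm{d}(A)=\lim_{t\to\infty}A(t)/t$ be its asymptotic density (an equation $\mathrm{d}(A)=\delta$ includes the existence of the limit), let $\mathrm{d}_B(A)=\lim_{t\to\infty}A(t)/B(t)$ be its density inside $B\supset A$, and let $jA=\{a_1+\dots+a_j : a_1,\dots,a_j\in A\}$. For an integer $k\ge1$ and a real number $\theta>1$ let $$T_{k,\theta}=\Big\{n\ge 1 : 0<\{\theta n\}<\tfrac1{k+1}\Big\},$$ where $\{x\}$ is the fractional part of $x$. For $k\ge2$ and $c>0$ let $\xi_m$ $(m\ge1)$ be independent Boolean random variables with $\mathbb{P}(\xi_m=1)=\min(1,\,c\,m^{-1+1/k})$, and let $A=\{m\in T_{k,\theta} : \xi_m=1\}$. 1. For every integer $k\ge2$ there is a continuous, strictly decreasing function $F_k:(0,\infty)\to\mathbb{R}$, depending on $k$ only, with $\lim_{c\to0^+}F_k(c)=\frac{k}{k+1}$, $\lim_{c\to\infty}F_k(c)=0$ and image $\big(0,\frac{k}{k+1}\big)$, such that for every irrational $\theta>1$ and every $c>0$,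 almost surely (a) $\mathrm{d}(jA)=0$ for $j=1,\dots,k-1$; (b) $\mathrm{d}((k+1)A)=1$; (c) $\mathrm{d}(kA)=\frac{k}{k+1}-F_k(c)$. 2. For every integer $k\ge2$ and every $\beta\in(0,1)$ there is $c>0$, depending only on $k$ and $\beta$, such that for every irrational $\theta>1$, almost surely $\mathrm{d}_{kT_{k,\theta}}(kA)=\beta$. 3. For every integer $k\ge1$, every irrational $\theta>1$ and every $\beta\in[0,1)$ there is a (deterministic) set $A\subset T_{k,\theta}$ such that $\mathrm{d}(jA)=0$ for $1\le j<k$, $\mathrm{d}_{kT_{k,\theta}}(kA)=\beta$ and $\mathrm{d}((k+1)A)=1$. -/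

import Mathlib

open MeasureTheory ProbabilityTheory Filter Topology

universe u

noncomputable section

namespace PseudoPowers

/-- The counting function `A(t) = |A ∩ [1, t]|`. -/
def count (A : Set ℕ) (t : ℝ) : ℕ := (A ∩ Set.Icc 1 ⌊t⌋₊).ncard

/-- The asymptotic density of `A` exists and equals `δ`. -/
def HasDensity (A : Set ℕ) (δ : ℝ) : Prop :=
  Tendsto (fun t : ℝ => (count A t : ℝ) / t) atTop (𝓝 δ)

/-- The density of `A` inside `B` exists and equals `δ` (used for `A ⊆ B`). -/
def HasDensityIn (B A : Set ℕ) (δ : ℝ) : Prop :=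
  Tendsto (fun t : ℝ => (count A t : ℝ) / (count B t : ℝ)) atTop (𝓝 δ)

/-- The `j`-fold sumset `jA = {a₁ + ⋯ + aⱼ : aᵢ ∈ A}` (repetitions allowed). -/
def sumset (j : ℕ) (A : Set ℕ) : Set ℕ :=
  {n | ∃ a : Fin j → ℕ, (∀ i, a i ∈ A) ∧ ∑ i, a i = n}

/-- `T_{k,θ} = {n ≥ 1 : 0 < {θ n} < 1 / (k + 1)}`. -/
def T (k : ℕ) (θ : ℝ) : Set ℕ :=
  {n | 1 ≤ n ∧ 0 < Int.fract (θ * n) ∧ Int.fract (θ * n) < 1 / ((k : ℝ) + 1)}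

/-- `ξ_m`, `m ≥ 1`, are independent Boolean random variables with
`P(ξ_m = 1) = c m^{-1+1/k}`, read as `1` for the finitely many `m` for which this number
exceeds `1`. The variable `ξ_0` is a dummy. -/
structure IsPseudoPowerSeq (k : ℕ) (c : ℝ) {Ω : Type*} [MeasurableSpace Ω]
    (P : Measure Ω) (ξ : ℕ → Ω → Bool) : Prop where
  measurable : ∀ m, Measurable (ξ m)
  indep : iIndepFun ξ P
  prob : ∀ m : ℕ, 1 ≤ m →
    P {ω | ξ m ω = true} = ENNReal.ofReal (min 1 (c * (m : ℝ) ^ (-1 + 1 / (k : ℝ))))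

/-- The random set `A = S ∩ T_{k,θ}`, where `S = {m : ξ_m = 1}`. -/
def randomSet (k : ℕ) (θ : ℝ) {Ω : Type*} (ξ : ℕ → Ω → Bool) (ω : Ω) : Set ℕ :=
  {m | ξ m ω = true} ∩ T k θ

end PseudoPowers

end

/-! Put `a = 1/k`, `s = 1/(k+1)` and let `t` be `θ` modulo 1. The random set contains `m` with
probability `v m`, about `c * m^(a-1)` when `m • t` lies in the arc `(0, s)`, and 0 otherwise. Three
facts carry the first two claims.

Mean. The expected number of representations of `n` by `k` distinct elements is `sig v k n`, an
iterated convolution of `v` up to repeated summands. Powers `m^(a-1)` are replaced by the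
coefficients `binCoeff a` of `(1-X)^(-a)`, whose convolutions are exact; along an irrational
rotation, convolution of such weights carrying functions on the circle amounts to convolution on the
circle (`HasProfile.conv`). Hence `sig v k n` is close to `intensity` at `n • t`, a multiple of the
`k`-fold convolution power of the indicator of the arc. It is positive exactly on the arc `(0, k s)`
(`hasProfile_sig`, `arcConv_pos_iff`).

Poisson law. Two representations rarely share an element, so the event that finitely many given
integers are all missed has probability close to the exponential of minus the sum of their means,
with a power saving (`exists_avoid_err`). The same estimate for unions makes such events nearly
uncorrelated, and the variance method with Weyl equidistribution gives almost sure densities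
(`ae_tendsto_avoid`). One integer yields the density of `kA`, namely `1 - ∫ exp(-intensity)`. As the
intensity scales by `c^k` and vanishes off an arc of length `k/(k+1)`, this integral decreases
strictly and continuously from 1 to `1/(k+1)`; `F_k` is the integral minus `1/(k+1)`.

Sparsity and recurrence. Almost surely `A` has `O(N^r)` elements up to `N` for each `r > 1/k`, so
`jA` is null for `j < k`, and so are the sums with repeated summands. An integer outside `(k+1)A`
forces `n - d` outside `kA` for all `d` in `A`. The points `d • t` accumulate at every point of the
arc, the arcs `(0, s)` and `(0, k s)` add up to the circle minus a point, and so the exponents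
summed over `d` diverge almost everywhere (`ae_natDens_succ_sumset`).

Relative density needs the density `k/(k+1)` of `kT`: a Bohr set bounds it above, and random subsets
with large `c` bound it below. Deterministic sets are outcomes of the random model when `k ≥ 2` and
`β > 0`. For `β = 0`, pseudo `(k+1)`-th powers on the same arc are used: outcomes for `c = 1, 2,
...` are united after deletion of initial segments (`exists_sparse_basis`). For `k = 1`, `β > 0` a
Bohr set is added to that union. -/

noncomputable section

namespace PseudoPowers

/-! ### Binomial weights and their asymptotics. -/

/-- The coefficients of `(1 - X)^{-a}`. -/
def binCoeff (a : ℝ) (n : ℕ) : ℝ := ∏ i ∈ Finset.range n, (a + i) / (i + 1)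

@[simp] lemma binCoeff_zero_right (a : ℝ) : binCoeff a 0 = 1 := by simp [binCoeff]

lemma binCoeff_succ (a : ℝ) (n : ℕ) :
    binCoeff a (n + 1) = binCoeff a n * ((a + n) / (n + 1)) := by
  rw [binCoeff, Finset.prod_range_succ, binCoeff]

lemma succ_mul_binCoeff_succ (a : ℝ) (n : ℕ) :
    ((n : ℝ) + 1) * binCoeff a (n + 1) = (a + n) * binCoeff a n := by
  rw [binCoeff_succ]; field_simp

lemma binCoeff_pos {a : ℝ} (ha : 0 < a) (n : ℕ) : 0 < binCoeff a n :=
  Finset.prod_pos fun i _ => by positivity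

lemma binCoeff_nonneg {a : ℝ} (ha : 0 ≤ a) (n : ℕ) : 0 ≤ binCoeff a n :=
  Finset.prod_nonneg fun i _ => by positivity

@[simp] lemma binCoeff_one (n : ℕ) : binCoeff 1 n = 1 :=
  Finset.prod_eq_one fun i _ => by rw [add_comm]; exact div_self (by positivity)

lemma binCoeff_zero_left (n : ℕ) : binCoeff 0 n = if n = 0 then 1 else 0 := by
  cases n with
  | zero => simp
  | succ n => simp [binCoeff, Finset.prod_range_succ']

lemma binCoeff_antitone {a : ℝ} (ha : 0 ≤ a) (ha1 : a ≤ 1) : Antitone (binCoeff a) := by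
  refine antitone_nat_of_succ_le fun n => ?_
  rw [binCoeff_succ]
  refine mul_le_of_le_one_right (binCoeff_nonneg ha n) ?_
  rw [div_le_one (by positivity)]; linarith

lemma binCoeff_mono_left {a b : ℝ} (ha : 0 ≤ a) (hab : a ≤ b) (n : ℕ) :
    binCoeff a n ≤ binCoeff b n :=
  Finset.prod_le_prod (fun i _ => by positivity) fun i _ => by gcongr

/-- Cauchy product of sequences. -/
def conv (f g : ℕ → ℝ) (n : ℕ) : ℝ := ∑ p ∈ Finset.HasAntidiagonal.antidiagonal n, f p.1 * g p.2

lemma conv_comm (f g : ℕ → ℝ) : conv f g = conv g f := by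
  funext n
  unfold conv
  rw [← Finset.HasAntidiagonal.map_swap_antidiagonal, Finset.sum_map]
  simp [mul_comm]

/-- Vandermonde's identity for `binCoeff`. -/
lemma conv_binCoeff (a b : ℝ) : conv (binCoeff a) (binCoeff b) = binCoeff (a + b) := by
  funext n
  induction n with
  | zero => simp [conv]
  | succ n ih =>
    -- The factor `n + 1` is split as `p.1 + p.2`, so that the recurrence for `(n+1) * binCoeff a
    -- (n+1)` applies to each factor; this is the Leibniz rule for the generating series.
    have h1 : ((n : ℝ) + 1) * conv (binCoeff a) (binCoeff b) (n + 1)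
        = ∑ p ∈ Finset.HasAntidiagonal.antidiagonal (n + 1), (p.1 : ℝ) * binCoeff a p.1 * binCoeff b p.2
          + ∑ p ∈ Finset.HasAntidiagonal.antidiagonal (n + 1), binCoeff a p.1 * (p.2 * binCoeff b p.2) := by
      rw [conv, Finset.mul_sum, ← Finset.sum_add_distrib]
      refine Finset.sum_congr rfl fun p hp => ?_
      have : (p.1 : ℝ) + p.2 = n + 1 := by
        exact_mod_cast Finset.HasAntidiagonal.mem_antidiagonal.mp hp
      rw [← this]; ring
    rw [Finset.Nat.sum_antidiagonal_succ, Finset.Nat.sum_antidiagonal_succ'] at h1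
    have h2 : ((n : ℝ) + 1) * conv (binCoeff a) (binCoeff b) (n + 1)
        = (a + b + n) * conv (binCoeff a) (binCoeff b) n := by
      rw [h1, conv, Finset.mul_sum]
      push_cast
      simp only [zero_mul, mul_zero, zero_add]
      rw [← Finset.sum_add_distrib]
      refine Finset.sum_congr rfl fun p hp => ?_
      have : (p.1 : ℝ) + p.2 = n := by
        exact_mod_cast Finset.HasAntidiagonal.mem_antidiagonal.mp hp
      rw [succ_mul_binCoeff_succ, succ_mul_binCoeff_succ, ← this]; ring
    rw [ih, ← succ_mul_binCoeff_succ] at h2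
    exact mul_left_cancel₀ (by positivity) h2

/-- Summation is convolution with the constant sequence `binCoeff 1`. -/
lemma sum_range_binCoeff (a : ℝ) (n : ℕ) :
    ∑ i ∈ Finset.range (n + 1), binCoeff a i = binCoeff (a + 1) n := by
  rw [← conv_binCoeff, conv, Finset.Nat.sum_antidiagonal_eq_sum_range_succ_mk]
  simp

lemma binCoeff_sub_one (a : ℝ) (n : ℕ) :
    binCoeff (a - 1) (n + 1) = binCoeff a (n + 1) - binCoeff a n := by
  have h1 := sum_range_binCoeff (a - 1) (n + 1)
  have h2 := sum_range_binCoeff (a - 1) n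
  rw [Finset.sum_range_succ, h2] at h1
  simp only [sub_add_cancel] at h1
  linarith

lemma tendsto_rpow_div_binCoeff {a : ℝ} (ha : 0 < a) :
    Tendsto (fun n : ℕ => (n : ℝ) ^ (a - 1) / binCoeff a n) atTop (𝓝 (Real.Gamma a)) := by
  have h1 : Tendsto (fun n : ℕ => Real.BohrMollerup.logGammaSeq a n) atTop
      (𝓝 (Real.log (Real.Gamma a))) := Real.BohrMollerup.tendsto_log_gamma ha
  have h2 := (Real.continuous_exp.tendsto _).comp h1
  rw [Real.exp_log (Real.Gamma_pos_of_pos ha)] at h2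
  -- The product in Euler's limit for Gamma runs up to the factor `a + n`, one more than in
  -- `binCoeff a n`; this ratio compensates for it.
  have h3 : Tendsto (fun n : ℕ => (a + n) / (n : ℝ)) atTop (𝓝 1) := by
    have : Tendsto (fun n : ℕ => a / (n : ℝ) + 1) atTop (𝓝 (0 + 1)) :=
      (tendsto_const_div_atTop_nhds_zero_nat a).add_const 1
    rw [zero_add] at this
    refine this.congr' ?_
    filter_upwards [eventually_gt_atTop 0] with n hn
    field_simp
  have h4 := h2.mul h3
  rw [mul_one] at h4
  refine h4.congr' ?_
  filter_upwards [eventually_gt_atTop 0] with n hn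
  have hn' : (0 : ℝ) < n := by exact_mod_cast hn
  have hb : binCoeff a n = (∏ i ∈ Finset.range n, (a + i)) / n.factorial := by
    rw [binCoeff, Finset.prod_div_distrib]
    congr 1
    rw [← Finset.prod_range_add_one_eq_factorial]
    push_cast; rfl
  have hp : (0 : ℝ) < ∏ i ∈ Finset.range n, (a + i) :=
    Finset.prod_pos fun i _ => by positivity
  have hlog : ∑ m ∈ Finset.range (n + 1), Real.log (a + m)
      = Real.log ((∏ i ∈ Finset.range n, (a + i)) * (a + n)) := by
    rw [← Finset.prod_range_succ (fun i : ℕ => a + (i : ℝ)),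
      Real.log_prod (fun i _ => by positivity)]
  have hf : (0 : ℝ) < n.factorial := by exact_mod_cast n.factorial_pos
  simp only [Function.comp, Real.BohrMollerup.logGammaSeq]
  rw [hlog, Real.exp_sub, Real.exp_add, Real.exp_log hf, Real.exp_log (by positivity), hb,
    mul_comm a, ← Real.rpow_def_of_pos hn', Real.rpow_sub_one hn'.ne']
  field_simp

lemma tendsto_binCoeff_div_rpow {a : ℝ} (ha : 0 < a) :
    Tendsto (fun n : ℕ => binCoeff a n / (n : ℝ) ^ (a - 1)) atTop (𝓝 (Real.Gamma a)⁻¹) := by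
  have := (tendsto_rpow_div_binCoeff ha).inv₀ (Real.Gamma_pos_of_pos ha).ne'
  simpa using this

lemma tendsto_binCoeff_div_binCoeff {a b : ℝ} (ha : 0 < a) (hab : a < b) :
    Tendsto (fun n : ℕ => binCoeff a n / binCoeff b n) atTop (𝓝 0) := by
  have h1 := (tendsto_binCoeff_div_rpow ha).mul (tendsto_rpow_div_binCoeff (ha.trans hab))
  have h2 : Tendsto (fun n : ℕ => (n : ℝ) ^ (-(b - a))) atTop (𝓝 0) :=
    (tendsto_rpow_neg_atTop (sub_pos.2 hab)).comp tendsto_natCast_atTop_atTop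
  have h3 := h1.mul h2
  rw [mul_zero] at h3
  refine h3.congr' ?_
  filter_upwards [eventually_gt_atTop 0] with n hn
  have hn' : (0 : ℝ) < n := by exact_mod_cast hn
  have e : (n : ℝ) ^ (a - 1) = (n : ℝ) ^ (b - 1) * (n : ℝ) ^ (-(b - a)) := by
    rw [← Real.rpow_add hn']; congr 1; ring
  have := binCoeff_pos (ha.trans hab) n
  have h4 : 0 < (n : ℝ) ^ (b - 1) := by positivity
  have h5 : 0 < (n : ℝ) ^ (-(b - a)) := by positivity
  rw [e]
  field_simp

/-- A sequence with convergent ratio to a positive one is bounded by a multiple of it. -/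
lemma exists_le_mul_of_tendsto_div {f g : ℕ → ℝ} {l : ℝ} (hg : ∀ n, 0 < g n)
    (h : Tendsto (fun n => f n / g n) atTop (𝓝 l)) : ∃ C, 0 < C ∧ ∀ n, f n ≤ C * g n := by
  obtain ⟨C, hC⟩ := h.bddAbove_range
  refine ⟨max C 1, by positivity, fun n => ?_⟩
  have : f n / g n ≤ C := hC ⟨n, rfl⟩
  rw [div_le_iff₀ (hg n)] at this
  exact this.trans (mul_le_mul_of_nonneg_right (le_max_left _ _) (hg n).le)

lemma exists_binCoeff_le_rpow {a : ℝ} (ha : 0 < a) :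
    ∃ C, 0 < C ∧ ∀ n : ℕ, 1 ≤ n → binCoeff a n ≤ C * (n : ℝ) ^ (a - 1) := by
  obtain ⟨C, hC⟩ := (tendsto_binCoeff_div_rpow ha).bddAbove_range
  refine ⟨max C 1, by positivity, fun n hn => ?_⟩
  have hp : (0 : ℝ) < (n : ℝ) ^ (a - 1) := by
    have : (0 : ℝ) < n := by exact_mod_cast hn
    positivity
  have : binCoeff a n / (n : ℝ) ^ (a - 1) ≤ C := hC ⟨n, rfl⟩
  rw [div_le_iff₀ hp] at this
  exact this.trans (mul_le_mul_of_nonneg_right (le_max_left _ _) hp.le)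

lemma exists_rpow_le_binCoeff {a : ℝ} (ha : 0 < a) :
    ∃ C, 0 < C ∧ ∀ n : ℕ, (n : ℝ) ^ (a - 1) ≤ C * binCoeff a n :=
  exists_le_mul_of_tendsto_div (binCoeff_pos ha) (tendsto_rpow_div_binCoeff ha)

/-- A pointwise product behaves like `n^(a+b-2)`, that is, like the weight of exponent `a + b - 1`;
when that is not positive, any positive `s` above it serves. -/
lemma exists_binCoeff_mul_le {a b s : ℝ} (ha : 0 < a) (hb : 0 < b) (hs : 0 < s)
    (h : a + b - 1 ≤ s) :
    ∃ C, 0 < C ∧ ∀ n : ℕ, binCoeff a n * binCoeff b n ≤ C * binCoeff s n := by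
  obtain ⟨A, hA, hA'⟩ := exists_binCoeff_le_rpow ha
  obtain ⟨B, hB, hB'⟩ := exists_binCoeff_le_rpow hb
  obtain ⟨S, hS, hS'⟩ := exists_rpow_le_binCoeff hs
  refine ⟨max 1 (A * B * S), by positivity, fun n => ?_⟩
  rcases Nat.eq_zero_or_pos n with rfl | hn
  · simp
  have h1n : (1 : ℝ) ≤ n := by exact_mod_cast hn
  calc binCoeff a n * binCoeff b n
      ≤ (A * (n : ℝ) ^ (a - 1)) * (B * (n : ℝ) ^ (b - 1)) :=
        mul_le_mul (hA' n hn) (hB' n hn) (binCoeff_pos hb n).le (by positivity)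
    _ = A * B * (n : ℝ) ^ (a + b - 1 - 1) := by
        rw [show a + b - 1 - 1 = (a - 1) + (b - 1) by ring,
          Real.rpow_add (by linarith)]; ring
    _ ≤ A * B * (n : ℝ) ^ (s - 1) := by
        gcongr
    _ ≤ A * B * (S * binCoeff s n) := by gcongr; exact hS' n
    _ = A * B * S * binCoeff s n := by ring
    _ ≤ max 1 (A * B * S) * binCoeff s n := by
        gcongr
        · exact (binCoeff_pos hs n).le
        · exact le_max_right _ _

lemma tendsto_binCoeff_atTop {a : ℝ} (ha : 1 < a) : Tendsto (binCoeff a) atTop atTop := by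
  obtain ⟨C, hC, h⟩ := exists_rpow_le_binCoeff (zero_lt_one.trans ha)
  have h1 : Tendsto (fun n : ℕ => (n : ℝ) ^ (a - 1) / C) atTop atTop :=
    ((tendsto_rpow_atTop (sub_pos.2 ha)).comp tendsto_natCast_atTop_atTop).atTop_div_const hC
  refine tendsto_atTop_mono (fun n => ?_) h1
  rw [div_le_iff₀' hC]; exact h n

/-- For `0 ≤ a ≤ 1` the first differences of `binCoeff a` are 1 at the index 0 and nonpositive
afterwards. Sums of their absolute values thus stay within the reach of Vandermonde's identity. -/
lemma abs_binCoeff_sub_one {a : ℝ} (ha : 0 ≤ a) (ha1 : a ≤ 1) (n : ℕ) :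
    |binCoeff (a - 1) n| = 2 * binCoeff 0 n - binCoeff (a - 1) n := by
  cases n with
  | zero => norm_num
  | succ n =>
    have h1 : binCoeff (a - 1) (n + 1) ≤ 0 := by
      rw [binCoeff_sub_one]
      have := binCoeff_antitone ha ha1 n.le_succ
      simp only [Nat.succ_eq_add_one] at this
      linarith
    rw [abs_of_nonpos h1, binCoeff_zero_left]; simp

lemma tendsto_binCoeff_sub_one_div {a : ℝ} (ha : 0 < a) :
    Tendsto (fun n => binCoeff (a - 1) n / binCoeff a n) atTop (𝓝 0) := by
  rw [← tendsto_add_atTop_iff_nat 1]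
  have h1 : Tendsto (fun n : ℕ => (a - 1) / (a + (n : ℝ))) atTop (𝓝 0) :=
    tendsto_const_nhds.div_atTop
      (tendsto_atTop_add_const_left _ _ tendsto_natCast_atTop_atTop)
  refine h1.congr fun n => ?_
  have h2 := binCoeff_pos ha n
  have h3 : (0 : ℝ) < a + n := by positivity
  rw [binCoeff_sub_one, binCoeff_succ]
  field_simp
  ring

/-! ### Convolutions twisted by a unit complex number. -/

/-- With the generating series of exponents `a` in `zX` and `b` in `X`, use `1 - z = (1 - zX) - z(1
- X)`: each of the two factors lowers one exponent by 1. This is summation by parts in closed form.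
-/
lemma mul_sum_twisted_eq (a b : ℝ) (z : ℂ) (n : ℕ) :
    (1 - z) * ∑ p ∈ Finset.HasAntidiagonal.antidiagonal n,
        (binCoeff a p.1 * z ^ p.1) * (binCoeff b p.2 : ℂ)
      = ∑ p ∈ Finset.HasAntidiagonal.antidiagonal n,
          (binCoeff (a - 1) p.1 * z ^ p.1) * (binCoeff b p.2 : ℂ)
        - z * ∑ p ∈ Finset.HasAntidiagonal.antidiagonal n,
          (binCoeff a p.1 * z ^ p.1) * (binCoeff (b - 1) p.2 : ℂ) := by
  have key : ∀ (a : ℝ) (z : ℂ), PowerSeries.mk (fun i => (binCoeff (a - 1) i : ℂ) * z ^ i)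
      = (1 - PowerSeries.C z * PowerSeries.X)
        * PowerSeries.mk (fun i => (binCoeff a i : ℂ) * z ^ i) := by
    intro a z
    ext i
    cases i with
    | zero => simp
    | succ i =>
      rw [sub_mul, one_mul, mul_assoc]
      simp only [map_sub, PowerSeries.coeff_mk, PowerSeries.coeff_C_mul,
        PowerSeries.coeff_succ_X_mul]
      rw [binCoeff_sub_one]
      push_cast
      ring
  have hA := key a z
  have hB := key b 1
  simp only [one_pow, mul_one, map_one, one_mul] at hB
  set A := PowerSeries.mk (fun i => (binCoeff a i : ℂ) * z ^ i) with hAd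
  set B := PowerSeries.mk (fun i => (binCoeff b i : ℂ)) with hBd
  have h : PowerSeries.C (1 - z) * (A * B)
      = PowerSeries.mk (fun i => (binCoeff (a - 1) i : ℂ) * z ^ i) * B
        - PowerSeries.C z * (A * PowerSeries.mk (fun i => (binCoeff (b - 1) i : ℂ))) := by
    rw [hA, hB, map_sub, map_one]; ring
  have h2 := congrArg (PowerSeries.coeff n) h
  rw [PowerSeries.coeff_C_mul, map_sub, PowerSeries.coeff_C_mul] at h2
  simpa only [PowerSeries.coeff_mul, hAd, hBd, PowerSeries.coeff_mk] using h2

lemma sum_abs_binCoeff_sub_one {a : ℝ} (ha : 0 ≤ a) (ha1 : a ≤ 1) (b : ℝ) (n : ℕ) :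
    ∑ p ∈ Finset.HasAntidiagonal.antidiagonal n, |binCoeff (a - 1) p.1| * binCoeff b p.2
      = 2 * binCoeff b n - binCoeff (a + b - 1) n := by
  have h1 := congrFun (conv_binCoeff 0 b) n
  have h2 := congrFun (conv_binCoeff (a - 1) b) n
  rw [zero_add] at h1
  rw [show a + b - 1 = a - 1 + b by ring, ← h1, ← h2, conv, conv, Finset.mul_sum,
    ← Finset.sum_sub_distrib]
  refine Finset.sum_congr rfl fun p _ => ?_
  rw [abs_binCoeff_sub_one ha ha1]; ring

lemma norm_twisted_le {a b : ℝ} (ha : 0 ≤ a) (ha1 : a ≤ 1) (hb : 0 ≤ b) (hb1 : b ≤ 1)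
    {z : ℂ} (hz : ‖z‖ = 1) (n : ℕ) :
    ‖1 - z‖ * ‖∑ p ∈ Finset.HasAntidiagonal.antidiagonal n,
        (binCoeff a p.1 * z ^ p.1) * (binCoeff b p.2 : ℂ)‖
      ≤ 2 * binCoeff a n + 2 * binCoeff b n - 2 * binCoeff (a + b - 1) n := by
  rw [← norm_mul, mul_sum_twisted_eq]
  refine (norm_sub_le _ _).trans ?_
  rw [norm_mul, hz, one_mul]
  have e1 := sum_abs_binCoeff_sub_one ha ha1 b n
  have e2 := sum_abs_binCoeff_sub_one hb hb1 a n
  have e3 : ∑ p ∈ Finset.HasAntidiagonal.antidiagonal n, binCoeff a p.1 * |binCoeff (b - 1) p.2|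
      = ∑ p ∈ Finset.HasAntidiagonal.antidiagonal n, |binCoeff (b - 1) p.1| * binCoeff a p.2 :=
    congrFun (conv_comm (binCoeff a) fun i => |binCoeff (b - 1) i|) n
  have i1 : ‖∑ p ∈ Finset.HasAntidiagonal.antidiagonal n,
          (binCoeff (a - 1) p.1 * z ^ p.1) * (binCoeff b p.2 : ℂ)‖
      ≤ ∑ p ∈ Finset.HasAntidiagonal.antidiagonal n, |binCoeff (a - 1) p.1| * binCoeff b p.2 := by
    refine (norm_sum_le _ _).trans (Finset.sum_le_sum fun p _ => ?_)
    rw [norm_mul, norm_mul, norm_pow, hz, one_pow, mul_one, Complex.norm_real, Complex.norm_real,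
      Real.norm_eq_abs, Real.norm_eq_abs, abs_of_nonneg (binCoeff_nonneg hb _)]
  have i2 : ‖∑ p ∈ Finset.HasAntidiagonal.antidiagonal n,
          (binCoeff a p.1 * z ^ p.1) * (binCoeff (b - 1) p.2 : ℂ)‖
      ≤ ∑ p ∈ Finset.HasAntidiagonal.antidiagonal n, binCoeff a p.1 * |binCoeff (b - 1) p.2| := by
    refine (norm_sum_le _ _).trans (Finset.sum_le_sum fun p _ => ?_)
    rw [norm_mul, norm_mul, norm_pow, hz, one_pow, mul_one, Complex.norm_real, Complex.norm_real,
      Real.norm_eq_abs, Real.norm_eq_abs, abs_of_nonneg (binCoeff_nonneg ha _)]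
  rw [e3, e2] at i2
  rw [e1] at i1
  rw [show b + a - 1 = a + b - 1 by ring] at i2
  linarith

/-- The factor `1 - z` gained by summation by parts is nonzero, and the remaining terms have
exponents `a`, `b` and `a + b - 1`, all below `a + b`. -/
lemma tendsto_twisted {a b : ℝ} (ha : 0 < a) (ha1 : a ≤ 1) (hb : 0 < b) (hb1 : b ≤ 1)
    {z : ℂ} (hz : ‖z‖ = 1) (hz1 : z ≠ 1) :
    Tendsto (fun n => (∑ p ∈ Finset.HasAntidiagonal.antidiagonal n,
        (binCoeff a p.1 * z ^ p.1) * (binCoeff b p.2 : ℂ)) / (binCoeff (a + b) n : ℂ))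
      atTop (𝓝 0) := by
  have hz' : 0 < ‖1 - z‖ := norm_pos_iff.2 (sub_ne_zero.2 hz1.symm)
  have h1 := (tendsto_binCoeff_div_binCoeff ha (lt_add_of_pos_right a hb)).const_mul 2
  have h2 := (tendsto_binCoeff_div_binCoeff hb (lt_add_of_pos_left b ha)).const_mul 2
  have h3 := (tendsto_binCoeff_sub_one_div (add_pos ha hb)).const_mul 2
  have h4 := ((h1.add h2).sub h3).div_const ‖1 - z‖
  simp only [mul_zero, add_zero, sub_zero, zero_div] at h4
  refine squeeze_zero_norm (fun n => ?_) h4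
  have hp := binCoeff_pos (add_pos ha hb) n
  rw [norm_div, Complex.norm_real, Real.norm_eq_abs, abs_of_pos hp, le_div_iff₀ hz', ← mul_div_assoc,
    ← mul_div_assoc, ← mul_div_assoc, ← add_div, ← sub_div, div_mul_eq_mul_div, mul_comm]
  gcongr
  exact norm_twisted_le ha.le ha1 hb.le hb1 hz n

/-! ### Weighted convolutions along an irrational rotation, for continuous functions. -/

instance : IsProbabilityMeasure (volume : Measure UnitAddCircle) := ⟨UnitAddCircle.measure_univ⟩

instance : (volume : Measure UnitAddCircle).IsNegInvariant :=
  inferInstance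

/-- The error in the convolution asymptotics for the weights `binCoeff a * φ`, `binCoeff b * ψ`. -/
def convError (a b : ℝ) (t : UnitAddCircle) (φ ψ : C(UnitAddCircle, ℂ)) (n : ℕ) : ℂ :=
  (∑ p ∈ Finset.HasAntidiagonal.antidiagonal n,
    (binCoeff a p.1 * φ (p.1 • t)) * (binCoeff b p.2 * ψ (p.2 • t))) / (binCoeff (a + b) n : ℂ)
    - ∫ y, φ y * ψ (n • t - y)

lemma convError_comm (a b : ℝ) (t : UnitAddCircle) (φ ψ : C(UnitAddCircle, ℂ)) (n : ℕ) :
    convError a b t φ ψ n = convError b a t ψ φ n := by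
  unfold convError
  congr 1
  · rw [add_comm a b, ← Finset.HasAntidiagonal.map_swap_antidiagonal, Finset.sum_map]
    simp [mul_comm]
  · rw [← integral_sub_left_eq_self _ _ (n • t)]
    simp [mul_comm]

lemma integrable_mul_comp_sub (φ ψ : C(UnitAddCircle, ℂ)) (x : UnitAddCircle) :
    Integrable (fun y => φ y * ψ (x - y)) :=
  Continuous.integrable_of_hasCompactSupport (by fun_prop)
    (HasCompactSupport.of_compactSpace _)

lemma convError_add (a b : ℝ) (t : UnitAddCircle) (φ φ' ψ : C(UnitAddCircle, ℂ)) (n : ℕ) :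
    convError a b t (φ + φ') ψ n = convError a b t φ ψ n + convError a b t φ' ψ n := by
  unfold convError
  have : ∫ y, (φ + φ') y * ψ (n • t - y)
      = (∫ y, φ y * ψ (n • t - y)) + ∫ y, φ' y * ψ (n • t - y) := by
    rw [← integral_add (integrable_mul_comp_sub _ _ _) (integrable_mul_comp_sub _ _ _)]
    simp [add_mul]
  rw [this]
  simp only [ContinuousMap.add_apply, mul_add, add_mul, Finset.sum_add_distrib, add_div]
  ring

lemma convError_smul (a b : ℝ) (t : UnitAddCircle) (r : ℂ) (φ ψ : C(UnitAddCircle, ℂ)) (n : ℕ) :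
    convError a b t (r • φ) ψ n = r * convError a b t φ ψ n := by
  unfold convError
  rw [mul_sub, ← integral_const_mul, ← mul_div_assoc, Finset.mul_sum]
  simp only [ContinuousMap.smul_apply, smul_eq_mul]
  congr 1
  · congr 1
    exact Finset.sum_congr rfl fun p _ => by ring
  · congr 1; funext y; ring

lemma norm_convError_le {a b : ℝ} (ha : 0 < a) (hb : 0 < b) (t : UnitAddCircle)
    (φ ψ : C(UnitAddCircle, ℂ)) (n : ℕ) : ‖convError a b t φ ψ n‖ ≤ 2 * (‖φ‖ * ‖ψ‖) := by
  unfold convError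
  refine (norm_sub_le _ _).trans ?_
  rw [two_mul]
  have hp := binCoeff_pos (add_pos ha hb) n
  refine add_le_add ?_ ?_
  · rw [norm_div, Complex.norm_real, Real.norm_eq_abs, abs_of_pos hp, div_le_iff₀ hp,
      ← conv_binCoeff, conv, Finset.mul_sum]
    refine (norm_sum_le _ _).trans (Finset.sum_le_sum fun p _ => ?_)
    rw [norm_mul, norm_mul, norm_mul, Complex.norm_real, Complex.norm_real,
      Real.norm_eq_abs, Real.norm_eq_abs, abs_of_pos (binCoeff_pos ha _),
      abs_of_pos (binCoeff_pos hb _)]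
    have h1 := φ.norm_coe_le_norm (p.1 • t)
    have h2 := ψ.norm_coe_le_norm (p.2 • t)
    have h3 : ‖φ (p.1 • t)‖ * ‖ψ (p.2 • t)‖ ≤ ‖φ‖ * ‖ψ‖ := by gcongr
    have h4 := mul_pos (binCoeff_pos ha p.1) (binCoeff_pos hb p.2)
    nlinarith [mul_le_mul_of_nonneg_left h3 h4.le]
  · have := norm_integral_le_of_norm_le_const (μ := (volume : Measure UnitAddCircle))
      (f := fun y => φ y * ψ (n • t - y)) (C := ‖φ‖ * ‖ψ‖)
      (Eventually.of_forall fun y => by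
        rw [norm_mul]
        gcongr
        · exact φ.norm_coe_le_norm _
        · exact ψ.norm_coe_le_norm _)
    simpa using this

/-- The error is linear in `φ` and bounded by the sup norm uniformly in `n`, so uniform density of
trigonometric polynomials reduces the claim to characters. -/
lemma tendsto_convError_of_mem_closure {a b : ℝ} (ha : 0 < a) (hb : 0 < b) {t : UnitAddCircle}
    {ψ : C(UnitAddCircle, ℂ)}
    (h : ∀ l : ℤ, Tendsto (convError a b t (fourier l) ψ) atTop (𝓝 0))
    (φ : C(UnitAddCircle, ℂ)) : Tendsto (convError a b t φ ψ) atTop (𝓝 0) := by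
  have hspan : ∀ φ ∈ Submodule.span ℂ (Set.range (@fourier (1 : ℝ))),
      Tendsto (convError a b t φ ψ) atTop (𝓝 0) := by
    intro φ hφ
    induction hφ using Submodule.span_induction with
    | mem x hx => obtain ⟨l, rfl⟩ := hx; exact h l
    | zero =>
      have : convError a b t 0 ψ = fun _ => 0 := by
        funext n
        simp [convError]
      rw [this]; exact tendsto_const_nhds
    | add x y _ _ hx hy =>
      have := hx.add hy
      rw [add_zero] at this
      exact this.congr fun n => (convError_add a b t x y ψ n).symm
    | smul r x _ hx =>
      have := hx.const_mul r
      rw [mul_zero] at this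
      exact this.congr fun n => (convError_smul a b t r x ψ n).symm
  have hmem : φ ∈ (Submodule.span ℂ (Set.range (@fourier (1 : ℝ)))).topologicalClosure := by
    rw [span_fourier_closure_eq_top]; trivial
  rw [← SetLike.mem_coe, Submodule.topologicalClosure_coe, Metric.mem_closure_iff] at hmem
  rw [Metric.tendsto_atTop]
  intro ε hε
  obtain ⟨φ', hφ', hd⟩ := hmem (ε / (2 * (2 * (‖ψ‖ + 1)))) (by positivity)
  obtain ⟨N, hN⟩ := Metric.tendsto_atTop.1 (hspan φ' hφ') (ε / 2) (by positivity)
  refine ⟨N, fun n hn => ?_⟩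
  have h1 := hN n hn
  rw [dist_zero_right] at h1 ⊢
  have h2 : convError a b t φ ψ n = convError a b t φ' ψ n + convError a b t (φ - φ') ψ n := by
    rw [← convError_add]; congr 1; abel
  rw [h2]
  have h3 := norm_convError_le ha hb t (φ - φ') ψ n
  rw [dist_eq_norm, lt_div_iff₀ (by positivity)] at hd
  have h4 := norm_add_le (convError a b t φ' ψ n) (convError a b t (φ - φ') ψ n)
  have h5 := norm_nonneg (φ - φ')
  nlinarith [norm_nonneg ψ]

lemma integral_fourier_mul_sub (h l : ℤ) (x : UnitAddCircle) :
    ∫ y, fourier h y * fourier l (x - y) = if h = l then fourier l x else 0 := by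
  have e : ∀ y : UnitAddCircle,
      (fourier h y * fourier l (x - y) : ℂ) = fourier l x * fourier (-(l - h)) y := by
    intro y
    have : (fourier l (x - y) : ℂ) = fourier l x * fourier (-l) y := by
      rw [fourier_apply, fourier_apply, fourier_apply, zsmul_sub, sub_eq_add_neg,
        AddCircle.toCircle_add, neg_zsmul]
      simp
    rw [this, show -(l - h) = h + -l by ring, fourier_add]
    ring
  simp_rw [e]
  rw [integral_const_mul]
  have h1 : ∫ y : UnitAddCircle, (fourier (-(l - h)) y : ℂ) = fourierCoeff (@fourier (1 : ℝ) 0) (l - h) := by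
    rw [fourierCoeff, integral_congr_ae (g := fun y => fourier (-(l - h)) y)
      (Eventually.of_forall fun y => by simp), AddCircle.volume_eq_smul_haarAddCircle]
    simp
  rw [h1, fourierCoeff_fourier, Pi.single_apply]
  by_cases hl : h = l
  · simp [hl]
  · rw [if_neg hl, if_neg (by omega), mul_zero]

/-- For characters `h` and `l` the sum is `fourier l (n • t)` times a twisted convolution with `z =
fourier (h - l) t`. If `h = l`, Vandermonde makes the error vanish identically; otherwise `z ≠ 1`
because `t` has infinite order, the sum is negligible, and the integral vanishes by orthogonality.
-/
lemma tendsto_convError_fourier {a b : ℝ} (ha : 0 < a) (ha1 : a ≤ 1) (hb : 0 < b) (hb1 : b ≤ 1)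
    {t : UnitAddCircle} (ht : ¬ IsOfFinAddOrder t) (h l : ℤ) :
    Tendsto (convError a b t (fourier h) (fourier l)) atTop (𝓝 0) := by
  have hf : ∀ (m : ℤ) (i : ℕ), (fourier m (i • t) : ℂ) = (fourier m t) ^ i := by
    intro m i
    rw [fourier_apply, fourier_apply, smul_comm, AddCircle.toCircle_nsmul]
    simp
  have hs : ∀ n, ∑ p ∈ Finset.HasAntidiagonal.antidiagonal n,
      ((binCoeff a p.1 : ℂ) * fourier h (p.1 • t)) * (binCoeff b p.2 * fourier l (p.2 • t))
      = fourier l (n • t) * ∑ p ∈ Finset.HasAntidiagonal.antidiagonal n,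
        (binCoeff a p.1 * (fourier (h - l) t : ℂ) ^ p.1) * (binCoeff b p.2 : ℂ) := by
    intro n
    rw [Finset.mul_sum]
    refine Finset.sum_congr rfl fun p hp => ?_
    rw [← Finset.HasAntidiagonal.mem_antidiagonal.1 hp, hf, hf, hf, pow_add,
      show fourier h t = (fourier (h - l) t : ℂ) * fourier l t by
        rw [← fourier_add]; congr 2; ring, mul_pow]
    ring
  have hn1 : ∀ (m : ℤ) (x : UnitAddCircle), ‖(fourier m x : ℂ)‖ = 1 := by
    intro m x; rw [fourier_apply]; exact Circle.norm_coe _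
  by_cases hl : h = l
  · subst hl
    have : convError a b t (fourier h) (fourier h) = fun _ => 0 := by
      funext n
      unfold convError
      rw [hs, integral_fourier_mul_sub, if_pos rfl]
      simp only [sub_self, fourier_zero, one_pow, mul_one]
      have e := congrFun (conv_binCoeff a b) n
      have hp := (binCoeff_pos (add_pos ha hb) n).ne'
      have e' : (∑ p ∈ Finset.HasAntidiagonal.antidiagonal n,
          (binCoeff a p.1 : ℂ) * (binCoeff b p.2 : ℂ)) = (binCoeff (a + b) n : ℂ) := by
        rw [← e, conv]; push_cast; rfl
      rw [e', mul_div_assoc, div_self (by exact_mod_cast hp), mul_one, sub_self]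
    rw [this]; exact tendsto_const_nhds
  · have hz1 : (fourier (h - l) t : ℂ) ≠ 1 := by
      intro hc
      rw [fourier_apply] at hc
      have h1 : AddCircle.toCircle ((h - l) • t) = AddCircle.toCircle (0 : UnitAddCircle) := by
        rw [AddCircle.toCircle_zero]; exact Circle.ext hc
      have h2 := AddCircle.injective_toCircle one_ne_zero h1
      exact ht (isOfFinAddOrder_iff_zsmul_eq_zero.2 ⟨h - l, sub_ne_zero.2 hl, h2⟩)
    refine squeeze_zero_norm (fun n => ?_)
      (tendsto_zero_iff_norm_tendsto_zero.1 (tendsto_twisted ha ha1 hb hb1 (hn1 (h - l) t) hz1))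
    unfold convError
    rw [hs, integral_fourier_mul_sub, if_neg hl, sub_zero, mul_div_assoc, norm_mul, hn1, one_mul]

theorem tendsto_convError {a b : ℝ} (ha : 0 < a) (ha1 : a ≤ 1) (hb : 0 < b) (hb1 : b ≤ 1)
    {t : UnitAddCircle} (ht : ¬ IsOfFinAddOrder t) (φ ψ : C(UnitAddCircle, ℂ)) :
    Tendsto (convError a b t φ ψ) atTop (𝓝 0) := by
  refine tendsto_convError_of_mem_closure ha hb (fun h => ?_) φ
  have := tendsto_convError_of_mem_closure (t := t) (ψ := fourier h) hb ha
    (fun l => tendsto_convError_fourier hb hb1 ha ha1 ht l h) ψ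
  exact this.congr fun n => (convError_comm b a t ψ (fourier h) n)

/-! ### Profiles, and the passage from continuous to Riemann approximable functions. -/

/-- Convolution of functions on the circle. -/
def cconv (φ ψ : UnitAddCircle → ℝ) (x : UnitAddCircle) : ℝ := ∫ y, φ y * ψ (x - y)

/-- `f n` behaves like `binCoeff a n * Φ (n t)`. -/
def HasProfile (t : UnitAddCircle) (a : ℝ) (f : ℕ → ℝ) (Φ : UnitAddCircle → ℝ) : Prop :=
  Tendsto (fun n => f n / binCoeff a n - Φ (n • t)) atTop (𝓝 0)

/-- Bounded functions that can be approximated in the sense of Riemann by continuous ones. -/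
structure RiemannApprox (φ : UnitAddCircle → ℝ) : Prop where
  measurable : Measurable φ
  bounded : ∃ B, 0 ≤ B ∧ ∀ x, |φ x| ≤ B
  approx : ∀ ε > 0, ∃ p q : C(UnitAddCircle, ℝ), (∀ x, |φ x - p x| ≤ q x) ∧ ∫ x, q x ≤ ε

lemma abs_conv_le {f g F G : ℕ → ℝ} (hf : ∀ n, |f n| ≤ F n) (hg : ∀ n, |g n| ≤ G n) (n : ℕ) :
    |conv f g n| ≤ conv F G n := by
  refine (Finset.abs_sum_le_sum_abs _ _).trans (Finset.sum_le_sum fun p _ => ?_)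
  rw [abs_mul]
  exact mul_le_mul (hf _) (hg _) (abs_nonneg _) ((abs_nonneg _).trans (hf _))

lemma conv_le_conv {f g F G : ℕ → ℝ} (hf0 : ∀ n, 0 ≤ f n) (hg0 : ∀ n, 0 ≤ g n)
    (hf : ∀ n, f n ≤ F n) (hg : ∀ n, g n ≤ G n) (n : ℕ) : conv f g n ≤ conv F G n :=
  Finset.sum_le_sum fun _ _ =>
    mul_le_mul (hf _) (hg _) (hg0 _) ((hf0 _).trans (hf _))

lemma conv_add_left (f f' g : ℕ → ℝ) (n : ℕ) :
    conv (fun i => f i + f' i) g n = conv f g n + conv f' g n := by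
  simp [conv, add_mul, Finset.sum_add_distrib]

lemma conv_sub_left (f f' g : ℕ → ℝ) (n : ℕ) :
    conv (fun i => f i - f' i) g n = conv f g n - conv f' g n := by
  simp [conv, sub_mul, Finset.sum_sub_distrib]

lemma conv_mul_left (c : ℝ) (f g : ℕ → ℝ) (n : ℕ) :
    conv (fun i => c * f i) g n = c * conv f g n := by
  simp [conv, Finset.mul_sum, mul_assoc]

lemma conv_mul_right (c : ℝ) (f g : ℕ → ℝ) (n : ℕ) :
    conv f (fun i => c * g i) n = c * conv f g n := by
  simp only [conv, Finset.mul_sum]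
  exact Finset.sum_congr rfl fun p _ => by ring

lemma exists_abs_le_mul_of_tendsto {f g : ℕ → ℝ} {l : ℝ} (hg : ∀ n, 0 < g n)
    (h : Tendsto (fun n => f n / g n) atTop (𝓝 l)) :
    ∃ C, 0 < C ∧ ∀ n, |f n| ≤ C * g n := by
  refine exists_le_mul_of_tendsto_div (f := fun n => |f n|) (l := |l|) hg (h.abs.congr fun n => ?_)
  rw [abs_div, abs_of_pos (hg n)]

/-- A sequence that is `o(binCoeff a)` is small against `binCoeff a` up to a lower order term. -/
lemma exists_abs_le_of_tendsto_zero {a : ℝ} (ha : 0 < a) {f : ℕ → ℝ}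
    (h : Tendsto (fun n => f n / binCoeff a n) atTop (𝓝 0)) {ε : ℝ} (hε : 0 < ε) :
    ∃ C, 0 ≤ C ∧ ∀ n, |f n| ≤ ε * binCoeff a n + C * binCoeff (a / 2) n := by
  obtain ⟨N, hN⟩ := Metric.tendsto_atTop.1 h ε hε
  -- The constant absorbs the finitely many terms before `N`. The exponent `a / 2` could be any
  -- positive number below `a`.
  refine ⟨∑ i ∈ Finset.range N, |f i| / binCoeff (a / 2) i,
    Finset.sum_nonneg fun i _ => div_nonneg (abs_nonneg _) (binCoeff_nonneg (by linarith) _),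
    fun n => ?_⟩
  have h1 := binCoeff_pos ha n
  have h2 := binCoeff_pos (half_pos ha) n
  rcases le_or_gt N n with hn | hn
  · have := hN n hn
    rw [dist_zero_right, Real.norm_eq_abs, abs_div, abs_of_pos h1, div_lt_iff₀ h1] at this
    have h3 : 0 ≤ ∑ i ∈ Finset.range N, |f i| / binCoeff (a / 2) i :=
      Finset.sum_nonneg fun i _ => div_nonneg (abs_nonneg _) (binCoeff_nonneg (by linarith) _)
    nlinarith
  · have h3 : |f n| / binCoeff (a / 2) n ≤ ∑ i ∈ Finset.range N, |f i| / binCoeff (a / 2) i :=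
      Finset.single_le_sum (f := fun i => |f i| / binCoeff (a / 2) i)
        (fun i _ => div_nonneg (abs_nonneg _) (binCoeff_nonneg (by linarith) _))
        (Finset.mem_range.2 hn)
    rw [div_le_iff₀ h2] at h3
    nlinarith

lemma tendsto_conv_zero {a b : ℝ} (ha : 0 < a) (hb : 0 < b) {f g : ℕ → ℝ} {G : ℝ} (hG : 0 ≤ G)
    (h : Tendsto (fun n => f n / binCoeff a n) atTop (𝓝 0)) (hg : ∀ n, |g n| ≤ G * binCoeff b n) :
    Tendsto (fun n => conv f g n / binCoeff (a + b) n) atTop (𝓝 0) := by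
  rw [Metric.tendsto_atTop]
  intro ε hε
  obtain ⟨C, hC, hf⟩ := exists_abs_le_of_tendsto_zero ha h (ε := ε / (2 * (G + 1))) (by positivity)
  have h1 := (tendsto_binCoeff_div_binCoeff (a := a / 2 + b) (b := a + b) (by linarith)
    (by linarith)).const_mul (C * G)
  rw [mul_zero] at h1
  obtain ⟨N, hN⟩ := Metric.tendsto_atTop.1 h1 (ε / 2) (by positivity)
  refine ⟨N, fun n hn => ?_⟩
  have h2 := hN n hn
  have hp := binCoeff_pos (add_pos ha hb) n
  have h3 := binCoeff_pos (show 0 < a / 2 + b by linarith) n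
  rw [dist_zero_right, Real.norm_eq_abs] at h2 ⊢
  rw [abs_of_nonneg (by positivity), ← mul_div_assoc, div_lt_iff₀ hp] at h2
  rw [abs_div, abs_of_pos hp, div_lt_iff₀ hp]
  have h4 := abs_conv_le hf hg n
  rw [conv_mul_right, conv_add_left, conv_mul_left, conv_mul_left, conv_binCoeff,
    conv_binCoeff] at h4
  have h5 : G * (ε / (2 * (G + 1)) * binCoeff (a + b) n) ≤ ε / 2 * binCoeff (a + b) n := by
    rw [← mul_assoc]
    gcongr
    rw [← mul_div_assoc, div_le_div_iff₀ (by positivity) (by positivity)]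
    nlinarith
  nlinarith

lemma tendsto_conv_continuous {a b : ℝ} (ha : 0 < a) (ha1 : a ≤ 1) (hb : 0 < b) (hb1 : b ≤ 1)
    {t : UnitAddCircle} (ht : ¬ IsOfFinAddOrder t) (φ ψ : C(UnitAddCircle, ℝ)) :
    Tendsto (fun n => conv (fun i => binCoeff a i * φ (i • t)) (fun i => binCoeff b i * ψ (i • t)) n
      / binCoeff (a + b) n - cconv φ ψ (n • t)) atTop (𝓝 0) := by
  have h := tendsto_convError ha ha1 hb hb1 ht
    ((⟨Complex.ofReal, Complex.continuous_ofReal⟩ : C(ℝ, ℂ)).comp φ)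
    ((⟨Complex.ofReal, Complex.continuous_ofReal⟩ : C(ℝ, ℂ)).comp ψ)
  rw [tendsto_zero_iff_norm_tendsto_zero]
  rw [tendsto_zero_iff_norm_tendsto_zero] at h
  refine h.congr fun n => ?_
  rw [← Complex.norm_real]
  congr 1
  unfold convError conv cconv
  push_cast
  simp only [ContinuousMap.comp_apply, ContinuousMap.coe_mk, ← integral_complex_ofReal]
  push_cast
  rfl

lemma integrable_of_continuous {φ : UnitAddCircle → ℝ} (h : Continuous φ) : Integrable φ :=
  h.integrable_of_hasCompactSupport (HasCompactSupport.of_compactSpace _)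

lemma RiemannApprox.of_continuous {φ : UnitAddCircle → ℝ} (h : Continuous φ) :
    RiemannApprox φ where
  measurable := h.measurable
  bounded := ⟨‖(⟨φ, h⟩ : C(UnitAddCircle, ℝ))‖, norm_nonneg _, fun x =>
    (⟨φ, h⟩ : C(UnitAddCircle, ℝ)).norm_coe_le_norm x⟩
  approx ε hε := ⟨⟨φ, h⟩, 0, fun x => by simp, by simpa using hε.le⟩

lemma RiemannApprox.const_mul {φ : UnitAddCircle → ℝ} (h : RiemannApprox φ) (c : ℝ) :
    RiemannApprox fun x => c * φ x where
  measurable := h.measurable.const_mul c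
  bounded := by
    obtain ⟨B, h0, hB⟩ := h.bounded
    exact ⟨|c| * B, by positivity, fun x => by rw [abs_mul]; gcongr; exact hB x⟩
  approx ε hε := by
    obtain ⟨p, q, hpq, hq⟩ := h.approx (ε / (|c| + 1)) (by positivity)
    refine ⟨c • p, |c| • q, fun x => ?_, ?_⟩
    · simp only [ContinuousMap.smul_apply, smul_eq_mul, ← mul_sub, abs_mul]
      gcongr; exact hpq x
    · simp only [ContinuousMap.smul_apply, smul_eq_mul]
      rw [integral_const_mul]
      calc |c| * ∫ x, q x ≤ |c| * (ε / (|c| + 1)) := by gcongr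
        _ ≤ ε := by
          rw [← mul_div_assoc, div_le_iff₀ (by positivity)]; nlinarith [abs_nonneg c]

lemma abs_mul_sub_mul_le {x y p₁ p₂ q₁ q₂ B P : ℝ} (h1 : |x - p₁| ≤ q₁) (h2 : |y - p₂| ≤ q₂)
    (hy : |y| ≤ B) (hp : |p₁| ≤ P) : |x * y - p₁ * p₂| ≤ B * q₁ + P * q₂ := by
  have e : x * y - p₁ * p₂ = y * (x - p₁) + p₁ * (y - p₂) := by ring
  rw [e]
  refine (abs_add_le _ _).trans ?_
  rw [abs_mul, abs_mul]
  have := (abs_nonneg y).trans hy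
  have := (abs_nonneg p₁).trans hp
  gcongr

lemma measurable_comp_sub {φ : UnitAddCircle → ℝ} (h : Measurable φ) (x : UnitAddCircle) :
    Measurable fun y => φ (x - y) := h.comp (measurable_const.sub measurable_id)

lemma integrable_mul_comp_sub' {φ ψ : UnitAddCircle → ℝ} (h1 : RiemannApprox φ)
    (h2 : RiemannApprox ψ) (x : UnitAddCircle) : Integrable fun y => φ y * ψ (x - y) := by
  obtain ⟨B, hB0, hB⟩ := h1.bounded
  obtain ⟨B', hB0', hB'⟩ := h2.bounded
  refine Integrable.of_bound (h1.measurable.mul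
    (measurable_comp_sub h2.measurable x)).aestronglyMeasurable (B * B')
    (Eventually.of_forall fun y => ?_)
  rw [Real.norm_eq_abs, abs_mul]
  exact mul_le_mul (hB _) (hB' _) (abs_nonneg _) hB0

/-- The bound is uniform in `x`: reflecting and translating `q₂` does not change its integral. Hence
it gives both continuity of `cconv φ ψ` and control along the orbit `n • t`. -/
lemma abs_cconv_sub_le {φ ψ : UnitAddCircle → ℝ} (h1 : RiemannApprox φ) (h2 : RiemannApprox ψ)
    {p₁ q₁ p₂ q₂ : C(UnitAddCircle, ℝ)} (hq₁ : ∀ x, |φ x - p₁ x| ≤ q₁ x)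
    (hq₂ : ∀ x, |ψ x - p₂ x| ≤ q₂ x) {B P : ℝ} (hB : ∀ x, |ψ x| ≤ B) (hP : ∀ x, |p₁ x| ≤ P)
    (x : UnitAddCircle) :
    |cconv φ ψ x - cconv p₁ p₂ x| ≤ B * (∫ y, q₁ y) + P * ∫ y, q₂ y := by
  have c1 := RiemannApprox.of_continuous p₁.continuous
  have c2 := RiemannApprox.of_continuous p₂.continuous
  unfold cconv
  rw [← integral_sub (integrable_mul_comp_sub' h1 h2 x) (integrable_mul_comp_sub' c1 c2 x),
    ← integral_sub_left_eq_self (fun y => q₂ y) volume x, ← integral_const_mul,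
    ← integral_const_mul, ← integral_add]
  · refine (abs_integral_le_integral_abs).trans (integral_mono ?_ ?_ fun y => ?_)
    · exact ((integrable_mul_comp_sub' h1 h2 x).sub (integrable_mul_comp_sub' c1 c2 x)).abs
    · exact integrable_of_continuous (by fun_prop)
    · exact abs_mul_sub_mul_le (hq₁ _) (hq₂ _) (hB _) (hP _)
  · exact integrable_of_continuous (by fun_prop)
  · exact integrable_of_continuous (by fun_prop)

lemma RiemannApprox.exists_approx {φ ψ : UnitAddCircle → ℝ} (h1 : RiemannApprox φ)
    (h2 : RiemannApprox ψ) {ε : ℝ} (hε : 0 < ε) :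
    ∃ (p₁ q₁ p₂ q₂ : C(UnitAddCircle, ℝ)) (B P : ℝ), 0 ≤ B ∧ 0 ≤ P ∧
      (∀ x, |φ x - p₁ x| ≤ q₁ x) ∧ (∀ x, |ψ x - p₂ x| ≤ q₂ x) ∧ (∀ x, |ψ x| ≤ B) ∧
      (∀ x, |p₁ x| ≤ P) ∧ B * (∫ y, q₁ y) + P * (∫ y, q₂ y) ≤ ε := by
  obtain ⟨B, hB0, hB⟩ := h2.bounded
  obtain ⟨p₁, q₁, hq₁, hi₁⟩ := h1.approx (ε / (2 * (B + 1))) (by positivity)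
  obtain ⟨p₂, q₂, hq₂, hi₂⟩ := h2.approx (ε / (2 * (‖p₁‖ + 1))) (by positivity)
  refine ⟨p₁, q₁, p₂, q₂, B, ‖p₁‖, hB0, norm_nonneg _, hq₁, hq₂, hB,
    fun x => p₁.norm_coe_le_norm x, ?_⟩
  have e : ∀ c : ℝ, 0 ≤ c → c * (ε / (2 * (c + 1))) ≤ ε / 2 := by
    intro c hc
    rw [← mul_div_assoc, div_le_div_iff₀ (by positivity) (by positivity)]; nlinarith
  have e1 := e B hB0
  have e2 := e ‖p₁‖ (norm_nonneg _)
  have e3 := mul_le_mul_of_nonneg_left hi₁ hB0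
  have e4 := mul_le_mul_of_nonneg_left hi₂ (norm_nonneg p₁)
  linarith

lemma continuous_cconv_continuousMap (p₁ p₂ : C(UnitAddCircle, ℝ)) : Continuous (cconv p₁ p₂) := by
  have h := continuous_parametric_integral_of_continuous (μ := (volume : Measure UnitAddCircle))
    (f := fun x y : UnitAddCircle => p₁ y * p₂ (x - y)) (by fun_prop) isCompact_univ
  simp only [Measure.restrict_univ] at h
  exact h

lemma RiemannApprox.continuous_cconv {φ ψ : UnitAddCircle → ℝ} (h1 : RiemannApprox φ)
    (h2 : RiemannApprox ψ) : Continuous (cconv φ ψ) := by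
  refine continuous_of_uniform_approx_of_continuous fun u hu => ?_
  obtain ⟨ε, hε, hεu⟩ := Metric.mem_uniformity_dist.1 hu
  obtain ⟨p₁, q₁, p₂, q₂, B, P, -, -, hq₁, hq₂, hB, hP, hle⟩ := h1.exists_approx h2 (half_pos hε)
  refine ⟨cconv p₁ p₂, continuous_cconv_continuousMap p₁ p₂, fun x => hεu ?_⟩
  rw [Real.dist_eq]
  have := abs_cconv_sub_le h1 h2 hq₁ hq₂ hB hP x
  linarith

lemma cconv_one_right (φ : UnitAddCircle → ℝ) (x : UnitAddCircle) :
    cconv φ (fun _ => 1) x = ∫ y, φ y := by simp [cconv]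

lemma cconv_one_left (φ : UnitAddCircle → ℝ) (x : UnitAddCircle) :
    cconv (fun _ => 1) φ x = ∫ y, φ y := by
  simp only [cconv, one_mul]
  exact integral_sub_left_eq_self φ volume x

/-- Replacing `φ, ψ` by continuous `p₁, p₂` costs at most `B` times the sum for `q₁, 1` plus `P`
times the sum for `1, q₂`. The continuous case evaluates these majorants as integrals of `q₁` and
`q₂`, which are small. -/
lemma hasProfile_conv_weights {a b : ℝ} (ha : 0 < a) (ha1 : a ≤ 1) (hb : 0 < b) (hb1 : b ≤ 1)
    {t : UnitAddCircle} (ht : ¬ IsOfFinAddOrder t) {φ ψ : UnitAddCircle → ℝ}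
    (h1 : RiemannApprox φ) (h2 : RiemannApprox ψ) :
    HasProfile t (a + b) (conv (fun i => binCoeff a i * φ (i • t))
      (fun i => binCoeff b i * ψ (i • t))) (cconv φ ψ) := by
  rw [HasProfile, Metric.tendsto_atTop]
  intro ε hε
  obtain ⟨p₁, q₁, p₂, q₂, B, P, hB0, hP0, hq₁, hq₂, hB, hP, hle⟩ :=
    h1.exists_approx h2 (show 0 < ε / 4 by positivity)
  have t1 := tendsto_conv_continuous ha ha1 hb hb1 ht p₁ p₂
  have t2 := (tendsto_conv_continuous ha ha1 hb hb1 ht q₁ 1).const_mul B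
  have t3 := (tendsto_conv_continuous ha ha1 hb hb1 ht 1 q₂).const_mul P
  rw [mul_zero] at t2 t3
  obtain ⟨N, hN⟩ := eventually_atTop.1 ((Metric.tendsto_nhds.1 t1 (ε / 6) (by positivity)).and
    ((Metric.tendsto_nhds.1 t2 (ε / 6) (by positivity)).and
      (Metric.tendsto_nhds.1 t3 (ε / 6) (by positivity))))
  refine ⟨N, fun n hn => ?_⟩
  obtain ⟨e1, e2, e3⟩ := hN n hn
  have d1 := abs_cconv_sub_le h1 h2 hq₁ hq₂ hB hP (n • t)
  rw [dist_zero_right, Real.norm_eq_abs] at e1 e2 e3 ⊢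
  have o1 : cconv (⇑q₁) (⇑(1 : C(UnitAddCircle, ℝ))) (n • t) = ∫ y, q₁ y := cconv_one_right _ _
  have o2 : cconv (⇑(1 : C(UnitAddCircle, ℝ))) (⇑q₂) (n • t) = ∫ y, q₂ y := cconv_one_left _ _
  rw [o1] at e2
  rw [o2] at e3
  have hp := binCoeff_pos (add_pos ha hb) n
  have d2 : |conv (fun i => binCoeff a i * φ (i • t)) (fun i => binCoeff b i * ψ (i • t)) n
      - conv (fun i => binCoeff a i * p₁ (i • t)) (fun i => binCoeff b i * p₂ (i • t)) n|
      ≤ B * conv (fun i => binCoeff a i * q₁ (i • t))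
          (fun i => binCoeff b i * (1 : C(UnitAddCircle, ℝ)) (i • t)) n
        + P * conv (fun i => binCoeff a i * (1 : C(UnitAddCircle, ℝ)) (i • t))
          (fun i => binCoeff b i * q₂ (i • t)) n := by
    unfold conv
    rw [← Finset.sum_sub_distrib, Finset.mul_sum, Finset.mul_sum, ← Finset.sum_add_distrib]
    refine (Finset.abs_sum_le_sum_abs _ _).trans (Finset.sum_le_sum fun p _ => ?_)
    have ha' := binCoeff_pos ha p.1
    have hb' := binCoeff_pos hb p.2
    have := abs_mul_sub_mul_le (hq₁ (p.1 • t)) (hq₂ (p.2 • t)) (hB _) (hP _)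
    rw [show ∀ x y z w u v : ℝ, u * x * (v * y) - u * z * (v * w) = (u * v) * (x * y - z * w) by
      intros; ring, abs_mul, abs_of_pos (mul_pos ha' hb')]
    calc _ ≤ binCoeff a p.1 * binCoeff b p.2 * (B * q₁ (p.1 • t) + P * q₂ (p.2 • t)) := by gcongr
      _ = _ := by simp only [ContinuousMap.one_apply]; ring
  have d3 := div_le_div_of_nonneg_right d2 hp.le
  rw [← abs_of_pos hp, ← abs_div, abs_of_pos hp, sub_div, add_div, mul_div_assoc,
    mul_div_assoc] at d3
  rw [abs_lt] at e1 e2 e3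
  rw [abs_le] at d1 d3
  rw [abs_lt]
  constructor <;> nlinarith

/-- Each sequence is its model weight plus an error of smaller order, and `tendsto_conv_zero`
discards the errors one at a time. The bounds `a, b ≤ 1` are those of the twisted estimate. -/
theorem HasProfile.conv {a b : ℝ} (ha : 0 < a) (ha1 : a ≤ 1) (hb : 0 < b) (hb1 : b ≤ 1)
    {t : UnitAddCircle} (ht : ¬ IsOfFinAddOrder t) {f g : ℕ → ℝ} {φ ψ : UnitAddCircle → ℝ}
    (hf : HasProfile t a f φ) (hg : HasProfile t b g ψ)
    (h1 : RiemannApprox φ) (h2 : RiemannApprox ψ) :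
    HasProfile t (a + b) (conv f g) (cconv φ ψ) := by
  obtain ⟨B, hB0, hB⟩ := h1.bounded
  obtain ⟨B', hB0', hB'⟩ := h2.bounded
  have hdf : Tendsto (fun n => (f n - binCoeff a n * φ (n • t)) / binCoeff a n) atTop (𝓝 0) :=
    hf.congr fun n => by have := (binCoeff_pos ha n).ne'; field_simp
  have hdg : Tendsto (fun n => (g n - binCoeff b n * ψ (n • t)) / binCoeff b n) atTop (𝓝 0) :=
    hg.congr fun n => by have := (binCoeff_pos hb n).ne'; field_simp
  have bf : ∀ n, |binCoeff a n * φ (n • t)| ≤ B * binCoeff a n := fun n => by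
    rw [abs_mul, abs_of_pos (binCoeff_pos ha n), mul_comm]
    exact mul_le_mul_of_nonneg_right (hB _) (binCoeff_pos ha n).le
  obtain ⟨D, hD0, hD⟩ := exists_abs_le_mul_of_tendsto (binCoeff_pos hb) hdg
  have bg : ∀ n, |g n| ≤ (D + B') * binCoeff b n := fun n => by
    have e : |binCoeff b n * ψ (n • t)| ≤ B' * binCoeff b n := by
      rw [abs_mul, abs_of_pos (binCoeff_pos hb n), mul_comm]
      exact mul_le_mul_of_nonneg_right (hB' _) (binCoeff_pos hb n).le
    have := abs_add_le (g n - binCoeff b n * ψ (n • t)) (binCoeff b n * ψ (n • t))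
    rw [sub_add_cancel] at this
    linarith [hD n]
  have s1 := tendsto_conv_zero ha hb (by positivity) hdf bg
  have s2 := tendsto_conv_zero hb ha hB0 hdg bf
  have s3 := hasProfile_conv_weights ha ha1 hb hb1 ht h1 h2
  have := (s1.add s2).add s3
  simp only [add_zero] at this
  refine this.congr fun n => ?_
  rw [conv_comm (fun n => g n - binCoeff b n * ψ (n • t)), add_comm b a, conv_sub_left,
    conv_comm (fun i => binCoeff a i * φ (i • t)) (fun n => g n - binCoeff b n * ψ (n • t)),
    conv_sub_left, conv_comm g, conv_comm (fun i => binCoeff b i * ψ (i • t))]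
  ring

lemma HasProfile.sub_little {a : ℝ} {t : UnitAddCircle} {f g : ℕ → ℝ} {φ : UnitAddCircle → ℝ}
    (hf : HasProfile t a f φ) (hg : Tendsto (fun n => (f n - g n) / binCoeff a n) atTop (𝓝 0)) :
    HasProfile t a g φ := by
  have := Tendsto.sub hf hg
  rw [sub_zero] at this
  exact this.congr fun n => by ring

lemma HasProfile.const_mul {a : ℝ} {t : UnitAddCircle} {f : ℕ → ℝ} {φ : UnitAddCircle → ℝ}
    (hf : HasProfile t a f φ) (c : ℝ) :
    HasProfile t a (fun n => c * f n) (fun x => c * φ x) := by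
  have := Tendsto.const_mul c hf
  rw [mul_zero] at this
  exact this.congr fun n => by ring

/-- Weyl's equidistribution theorem for Riemann integrable functions. -/
theorem tendsto_average {t : UnitAddCircle} (ht : ¬ IsOfFinAddOrder t) {φ : UnitAddCircle → ℝ}
    (h : RiemannApprox φ) :
    Tendsto (fun N : ℕ => (∑ n ∈ Finset.range N, φ (n • t)) / N) atTop (𝓝 (∫ x, φ x)) := by
  rw [← tendsto_add_atTop_iff_nat 1]
  -- With `a = b = 1` the weights are constantly 1, so convolution with the function 1 is the
  -- partial sum, and `binCoeff 2 n = n + 1`.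
  have h1 := hasProfile_conv_weights one_pos le_rfl one_pos le_rfl ht h
    (RiemannApprox.of_continuous (φ := fun _ => 1) continuous_const)
  have h2 := Tendsto.add_const (∫ x, φ x) h1
  rw [zero_add] at h2
  refine h2.congr fun n => ?_
  rw [cconv_one_right, sub_add_cancel, PseudoPowers.conv,
    Finset.Nat.sum_antidiagonal_eq_sum_range_succ_mk,
    ← sum_range_binCoeff]
  simp

/-! ### Arcs and the convolution powers of their indicators. -/

/-- The open arc `(0, s)` on the circle. -/
def arc (s : ℝ) : Set UnitAddCircle := (fun x : ℝ => (x : UnitAddCircle)) '' Set.Ioo 0 s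

lemma isOpen_arc (s : ℝ) : IsOpen (arc s) :=
  QuotientAddGroup.isOpenMap_coe _ isOpen_Ioo

instance : NullSingletonClass (volume : Measure UnitAddCircle) where
  measure_singleton x := by
    rw [← Metric.closedBall_zero, AddCircle.volume_closedBall]; simp

lemma measure_frontier_arc (s : ℝ) : volume (frontier (arc s)) = 0 := by
  have hcl : IsClosed ((fun x : ℝ => (x : UnitAddCircle)) '' Set.Icc 0 s) :=
    (isCompact_Icc.image (AddCircle.continuous_mk' 1)).isClosed
  have h1 : closure (arc s) ⊆ (fun x : ℝ => (x : UnitAddCircle)) '' Set.Icc 0 s :=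
    closure_minimal (Set.image_mono Set.Ioo_subset_Icc_self) hcl
  have h2 : frontier (arc s) ⊆ {((0 : ℝ) : UnitAddCircle), (s : UnitAddCircle)} := by
    rw [(isOpen_arc s).frontier_eq]
    rintro x ⟨hx, hx'⟩
    obtain ⟨y, hy, rfl⟩ := h1 hx
    rcases eq_or_lt_of_le hy.1 with h | h
    · left; simp [← h]
    rcases eq_or_lt_of_le hy.2 with h' | h'
    · right; simp [← h']
    exact absurd ⟨y, ⟨h, h'⟩, rfl⟩ hx'
  exact measure_mono_null h2 (Set.Finite.measure_zero (Set.toFinite _) _)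

/-- Thickened indicators of `U` and of its complement decrease to the indicators of the two
closures. Their sum minus 1 dominates the approximation error and tends to the indicator of the
frontier, which is null. -/
lemma riemannApprox_indicator {U : Set UnitAddCircle} (hU : MeasurableSet U)
    (hf : volume (frontier U) = 0) : RiemannApprox (U.indicator 1) where
  measurable := measurable_one.indicator hU
  bounded := ⟨1, zero_le_one, fun x => by
    by_cases h : x ∈ U <;> simp [h]⟩
  approx ε hε := by
    have hδ : ∀ n : ℕ, (0 : ℝ) < 1 / ((n : ℝ) + 1) := fun n => Nat.one_div_pos_of_nat
    let P : ℕ → C(UnitAddCircle, ℝ) := fun n =>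
      ⟨fun x => (thickenedIndicator (hδ n) U x : ℝ), by fun_prop⟩
    let Q : ℕ → C(UnitAddCircle, ℝ) := fun n =>
      ⟨fun x => (thickenedIndicator (hδ n) Uᶜ x : ℝ), by fun_prop⟩
    have hlim : ∀ V : Set UnitAddCircle, ∀ x, Tendsto (fun n =>
        (thickenedIndicator (hδ n) V x : ℝ)) atTop (𝓝 ((closure V).indicator 1 x)) := by
      intro V x
      have h1 := thickenedIndicator_tendsto_indicator_closure hδ
        tendsto_one_div_add_atTop_nhds_zero_nat V
      have h2 := (tendsto_pi_nhds.1 h1) x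
      have h3 := (NNReal.continuous_coe.tendsto _).comp h2
      refine h3.congr' (Eventually.of_forall fun n => rfl) |>.trans_eq ?_ |> id
      congr 1
      by_cases hx : x ∈ closure V <;> simp [hx]
    have h1 : Tendsto (fun n => ∫ x, (P n x + Q n x - 1)) atTop (𝓝 (∫ _x : UnitAddCircle, (0 : ℝ))) := by
      refine tendsto_integral_of_dominated_convergence (fun _ => 1)
        (fun n => (by fun_prop : Continuous fun x => P n x + Q n x - 1).aestronglyMeasurable)
        (integrable_const _) (fun n => Eventually.of_forall fun x => ?_) ?_
      · have h1 : (thickenedIndicator (hδ n) U x : ℝ) ≤ 1 := by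
          exact_mod_cast thickenedIndicator_le_one (hδ n) U x
        have h2 : (thickenedIndicator (hδ n) Uᶜ x : ℝ) ≤ 1 := by
          exact_mod_cast thickenedIndicator_le_one (hδ n) Uᶜ x
        have h3 : (0 : ℝ) ≤ (thickenedIndicator (hδ n) U x : ℝ) := NNReal.coe_nonneg _
        have h4 : (0 : ℝ) ≤ (thickenedIndicator (hδ n) Uᶜ x : ℝ) := NNReal.coe_nonneg _
        simp only [P, Q, ContinuousMap.coe_mk, Real.norm_eq_abs, abs_le]
        constructor <;> linarith
      · have : ∀ᵐ x : UnitAddCircle, x ∉ frontier U := by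
          rw [ae_iff]; simpa using hf
        filter_upwards [this] with x hx
        have := ((hlim U x).add (hlim Uᶜ x)).sub_const 1
        refine this.trans_eq ?_ |> id
        rw [frontier_eq_closure_inter_closure, Set.mem_inter_iff, not_and_or] at hx
        congr 1
        by_cases hxU : x ∈ U
        · have := subset_closure hxU
          simp only [this, not_true_eq_false, false_or] at hx
          rw [Set.indicator_of_mem this, Set.indicator_of_notMem hx]; simp
        · have : x ∈ closure Uᶜ := subset_closure hxU
          simp only [this, not_true_eq_false, or_false] at hx
          rw [Set.indicator_of_mem this, Set.indicator_of_notMem hx]; simp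
    rw [integral_zero] at h1
    obtain ⟨n, hn⟩ := (h1.eventually_le_const hε).exists
    refine ⟨P n, P n + Q n - 1, fun x => ?_, by simpa using hn⟩
    have h1 : (thickenedIndicator (hδ n) U x : ℝ) ≤ 1 := by
      exact_mod_cast thickenedIndicator_le_one (hδ n) U x
    have h2 : (thickenedIndicator (hδ n) Uᶜ x : ℝ) ≤ 1 := by
      exact_mod_cast thickenedIndicator_le_one (hδ n) Uᶜ x
    have h3 : (0 : ℝ) ≤ (thickenedIndicator (hδ n) U x : ℝ) := NNReal.coe_nonneg _
    have h4 : (0 : ℝ) ≤ (thickenedIndicator (hδ n) Uᶜ x : ℝ) := NNReal.coe_nonneg _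
    change |U.indicator 1 x - (thickenedIndicator (hδ n) U x : ℝ)|
      ≤ (thickenedIndicator (hδ n) U x : ℝ) + (thickenedIndicator (hδ n) Uᶜ x : ℝ) - 1
    by_cases hx : x ∈ U
    · have h5 : (thickenedIndicator (hδ n) U x : ℝ) = 1 := by
        exact_mod_cast thickenedIndicator_one (hδ n) U hx
      rw [Set.indicator_of_mem hx, h5, Pi.one_apply, sub_self, abs_zero]; linarith
    · have h5 : (thickenedIndicator (hδ n) Uᶜ x : ℝ) = 1 := by
        exact_mod_cast thickenedIndicator_one (hδ n) Uᶜ hx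
      rw [Set.indicator_of_notMem hx, h5, zero_sub, abs_neg, abs_of_nonneg h3]; linarith

lemma riemannApprox_arc (s : ℝ) : RiemannApprox ((arc s).indicator 1) :=
  riemannApprox_indicator (isOpen_arc s).measurableSet (measure_frontier_arc s)

/-- The `(j + 1)`-fold convolution power of the indicator of the arc `(0, s)`. -/
def arcConv (s : ℝ) : ℕ → UnitAddCircle → ℝ
  | 0 => (arc s).indicator 1
  | j + 1 => cconv ((arc s).indicator 1) (arcConv s j)

lemma riemannApprox_arcConv (s : ℝ) (j : ℕ) : RiemannApprox (arcConv s j) := by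
  induction j with
  | zero => exact riemannApprox_arc s
  | succ j ih => exact RiemannApprox.of_continuous ((riemannApprox_arc s).continuous_cconv ih)

lemma continuous_arcConv_succ (s : ℝ) (j : ℕ) : Continuous (arcConv s (j + 1)) :=
  (riemannApprox_arc s).continuous_cconv (riemannApprox_arcConv s j)

lemma arcConv_nonneg (s : ℝ) (j : ℕ) (x : UnitAddCircle) : 0 ≤ arcConv s j x := by
  induction j generalizing x with
  | zero => exact Set.indicator_nonneg (fun _ _ => zero_le_one) x
  | succ j ih =>
    exact integral_nonneg fun y =>
      mul_nonneg (Set.indicator_nonneg (fun _ _ => zero_le_one) y) (ih _)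

lemma mem_arc_add_iff {s r : ℝ} (hs : 0 < s) (hr : 0 < r) (x : UnitAddCircle) :
    x ∈ arc (s + r) ↔ ∃ y ∈ arc s, x - y ∈ arc r := by
  constructor
  · rintro ⟨v, ⟨hv0, hv⟩, rfl⟩
    have hsr : 0 < s + r := by linarith
    -- The point is divided in the proportion `s : r`.
    refine ⟨_, ⟨v * (s / (s + r)), ⟨by positivity, ?_⟩, rfl⟩,
      ⟨v * (r / (s + r)), ⟨by positivity, ?_⟩, ?_⟩⟩
    · rw [← mul_div_assoc, div_lt_iff₀ hsr]; nlinarith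
    · rw [← mul_div_assoc, div_lt_iff₀ hsr]; nlinarith
    · dsimp only
      rw [← AddCircle.coe_sub]
      congr 1
      field_simp
      ring
  · rintro ⟨_, ⟨u, hu, rfl⟩, ⟨w, hw, h⟩⟩
    refine ⟨u + w, ⟨by linarith [hu.1, hw.1], by linarith [hu.2, hw.2]⟩, ?_⟩
    dsimp only at h ⊢
    rw [AddCircle.coe_add, h]; abel

/-- The integrand is nonnegative with open support, so the integral is positive as soon as the
support is nonempty. By `mem_arc_add_iff` this says that `x` lies in the sum of the two arcs. -/
lemma arcConv_pos_iff {s : ℝ} (hs : 0 < s) (j : ℕ) (x : UnitAddCircle) :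
    0 < arcConv s j x ↔ x ∈ arc ((j + 1) * s) := by
  induction j generalizing x with
  | zero => by_cases h : x ∈ arc s <;> simp [arcConv, h]
  | succ j ih =>
    have hR := riemannApprox_arcConv s j
    have e : arc (((j + 1 : ℕ) + 1 : ℝ) * s) = arc (s + (j + 1) * s) := by
      congr 1; push_cast; ring
    rw [e, mem_arc_add_iff hs (by positivity)]
    change 0 < ∫ y, _ ↔ _
    rw [integral_pos_iff_support_of_nonneg
      (f := fun y => (arc s).indicator 1 y * arcConv s j (x - y)) (fun y => mul_nonneg (Set.indicator_nonneg (fun _ _ => zero_le_one) y)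
        (arcConv_nonneg s j _))
      (integrable_mul_comp_sub' (riemannApprox_arc s) hR x)]
    have hsupp : Function.support (fun y => (arc s).indicator 1 y * arcConv s j (x - y))
        = arc s ∩ (fun y => x - y) ⁻¹' arc ((j + 1) * s) := by
      ext y
      rw [Function.mem_support, mul_ne_zero_iff, Set.mem_inter_iff, Set.mem_preimage, ← ih,
        (arcConv_nonneg s j (x - y)).lt_iff_ne']
      by_cases h : y ∈ arc s <;> simp [h]
    have hopen : IsOpen (arc s ∩ (fun y => x - y) ⁻¹' arc ((j + 1) * s)) :=
      (isOpen_arc s).inter ((isOpen_arc _).preimage (by fun_prop))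
    rw [hsupp, hopen.measure_pos_iff (volume : Measure UnitAddCircle)]
    rfl

lemma coe_mem_arc_iff {s : ℝ} (hs : s ≤ 1) (x : ℝ) :
    (x : UnitAddCircle) ∈ arc s ↔ 0 < Int.fract x ∧ Int.fract x < s := by
  constructor
  · rintro ⟨y, hy, h⟩
    have h' : (y : UnitAddCircle) = (x : UnitAddCircle) := h
    have h0 : ((x - y : ℝ) : UnitAddCircle) = 0 := by rw [AddCircle.coe_sub, h', sub_self]
    obtain ⟨n, hn⟩ := (AddCircle.coe_eq_zero_iff 1).1 h0
    have hx : x = y + n := by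
      have : (n : ℝ) = x - y := by simpa using hn
      linarith
    have hf : Int.fract x = y := by
      rw [hx, Int.fract_add_intCast, Int.fract_eq_self]
      exact ⟨hy.1.le, hy.2.trans_le hs⟩
    rw [hf]; exact hy
  · intro h
    refine ⟨Int.fract x, h, ?_⟩
    have : ((x - ⌊x⌋ : ℝ) : UnitAddCircle) = x := by
      rw [AddCircle.coe_sub, sub_eq_self, AddCircle.coe_eq_zero_iff]
      exact ⟨⌊x⌋, by simp⟩
    exact this

lemma measure_arc {s : ℝ} (hs : s ≤ 1) : volume (arc s) = ENNReal.ofReal s := by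
  have h := (UnitAddCircle.measurePreserving_mk 0).measure_preimage
    (isOpen_arc s).measurableSet.nullMeasurableSet
  rw [← h, Measure.restrict_apply
    (AddCircle.measurable_mk' (isOpen_arc s).measurableSet)]
  have e : (QuotientAddGroup.mk ⁻¹' arc s ∩ Set.Ioc (0 : ℝ) (0 + 1) : Set ℝ) = Set.Ioo 0 s := by
    ext x
    have hm : (QuotientAddGroup.mk x : UnitAddCircle) ∈ arc s ↔ _ := coe_mem_arc_iff hs x
    rw [Set.mem_inter_iff, Set.mem_preimage, hm, zero_add]
    constructor
    · rintro ⟨⟨h0, h1⟩, h2⟩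
      rcases eq_or_lt_of_le h2.2 with h3 | h3
      · subst h3; simp at h0
      · rw [Int.fract_eq_self.2 ⟨h2.1.le, h3⟩] at h1
        exact ⟨h2.1, h1⟩
    · intro hx
      have h3 : x < 1 := hx.2.trans_le hs
      rw [Int.fract_eq_self.2 ⟨hx.1.le, h3⟩]
      exact ⟨hx, hx.1, h3.le⟩
  rw [e, Real.volume_Ioo, sub_zero]

/-! ### Weighted counts of representations by distinct summands. -/

/-- The `j`-element sets of natural numbers with sum `n`. -/
def reps (j n : ℕ) : Finset (Finset ℕ) :=
  ((Finset.range (n + 1)).powersetCard j).filter fun S => ∑ m ∈ S, m = n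

lemma mem_reps {j n : ℕ} {S : Finset ℕ} : S ∈ reps j n ↔ S.card = j ∧ ∑ m ∈ S, m = n := by
  rw [reps, Finset.mem_filter, Finset.mem_powersetCard]
  constructor
  · rintro ⟨⟨_, h⟩, h'⟩; exact ⟨h, h'⟩
  · rintro ⟨h, h'⟩
    refine ⟨⟨fun m hm => ?_, h⟩, h'⟩
    have := Finset.single_le_sum (f := fun m : ℕ => m) (fun _ _ => Nat.zero_le _) hm
    rw [Finset.mem_range]; omega

/-- The product of the weights over a finite set. -/
def wt (v : ℕ → ℝ) (S : Finset ℕ) : ℝ := ∏ m ∈ S, v m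

/-- The total weight of the `j`-element sets with sum `n`. -/
def sig (v : ℕ → ℝ) (j n : ℕ) : ℝ := ∑ S ∈ reps j n, wt v S

lemma wt_nonneg {v : ℕ → ℝ} (hv : ∀ m, 0 ≤ v m) (S : Finset ℕ) : 0 ≤ wt v S :=
  Finset.prod_nonneg fun m _ => hv m

lemma sig_nonneg {v : ℕ → ℝ} (hv : ∀ m, 0 ≤ v m) (j n : ℕ) : 0 ≤ sig v j n :=
  Finset.sum_nonneg fun S _ => wt_nonneg hv S

lemma sig_zero (v : ℕ → ℝ) (n : ℕ) : sig v 0 n = binCoeff 0 n := by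
  rw [binCoeff_zero_left, sig]
  have : reps 0 n = if n = 0 then {∅} else ∅ := by
    ext S
    rw [mem_reps]
    split_ifs with h
    · subst h
      simp only [Finset.card_eq_zero, Finset.mem_singleton]
      constructor
      · exact fun h => h.1
      · rintro rfl; simp
    · simp only [Finset.card_eq_zero, Finset.notMem_empty, iff_false, not_and]
      rintro rfl; simpa using Ne.symm h
  rw [this]
  split_ifs <;> simp [wt]

lemma sig_one (v : ℕ → ℝ) (n : ℕ) : sig v 1 n = v n := by
  have : reps 1 n = {{n}} := by
    ext S
    rw [mem_reps, Finset.mem_singleton, Finset.card_eq_one]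
    constructor
    · rintro ⟨⟨m, rfl⟩, h⟩
      simpa using h
    · rintro rfl; simp
  rw [sig, this]; simp [wt]

/-- Double counting: each `(j+1)`-element set is counted once for each choice of a marked element,
and erasing that element leaves a `j`-element set. -/
lemma succ_mul_sig_succ (v : ℕ → ℝ) (j n : ℕ) :
    ((j : ℝ) + 1) * sig v (j + 1) n = ∑ p ∈ Finset.HasAntidiagonal.antidiagonal n,
      v p.1 * ∑ S ∈ (reps j p.2).filter (fun S => p.1 ∉ S), wt v S := by
  have h1 : ((j : ℝ) + 1) * sig v (j + 1) n
      = ∑ x ∈ (reps (j + 1) n).sigma (fun S => S), wt v x.1 := by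
    rw [Finset.sum_sigma, sig, Finset.mul_sum]
    refine Finset.sum_congr rfl fun S hS => ?_
    simp [(mem_reps.1 hS).1]
  have h2 : ∑ p ∈ Finset.HasAntidiagonal.antidiagonal n,
      v p.1 * ∑ S ∈ (reps j p.2).filter (fun S => p.1 ∉ S), wt v S
      = ∑ x ∈ (Finset.HasAntidiagonal.antidiagonal n).sigma
          (fun p => (reps j p.2).filter (fun S => p.1 ∉ S)), v x.1.1 * wt v x.2 := by
    rw [Finset.sum_sigma]
    simp_rw [Finset.mul_sum]
  rw [h1, h2]
  refine Finset.sum_nbij' (fun x => ⟨(x.2, n - x.2), x.1.erase x.2⟩)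
    (fun y => ⟨insert y.1.1 y.2, y.1.1⟩) ?_ ?_ ?_ ?_ ?_
  · rintro ⟨S, m⟩ h
    simp only [Finset.mem_sigma, mem_reps] at h
    obtain ⟨⟨hc, hs⟩, hm⟩ := h
    have h3 := Finset.add_sum_erase S (fun m : ℕ => m) hm
    simp only [Finset.mem_sigma, Finset.HasAntidiagonal.mem_antidiagonal, Finset.mem_filter,
      mem_reps, Finset.notMem_erase, not_false_eq_true, and_true, Finset.card_erase_of_mem hm, hc,
      Nat.add_sub_cancel, true_and]
    constructor <;> omega
  · rintro ⟨⟨m, q⟩, S⟩ h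
    simp only [Finset.mem_sigma, Finset.HasAntidiagonal.mem_antidiagonal, Finset.mem_filter,
      mem_reps] at h
    obtain ⟨h1, ⟨h2, h3⟩, h4⟩ := h
    simp only [Finset.mem_sigma, mem_reps, Finset.mem_insert_self, and_true,
      Finset.card_insert_of_notMem h4, Finset.sum_insert h4, h2, h3, true_and]
    exact h1
  · rintro ⟨S, m⟩ h
    simp only [Finset.mem_sigma] at h
    simp [Finset.insert_erase h.2]
  · rintro ⟨⟨m, q⟩, S⟩ h
    simp only [Finset.mem_sigma, Finset.HasAntidiagonal.mem_antidiagonal, Finset.mem_filter,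
      mem_reps] at h
    obtain ⟨h1, ⟨h2, h3⟩, h4⟩ := h
    have : n - m = q := by omega
    simp [Finset.erase_insert h4, this]
  · rintro ⟨S, m⟩ h
    simp only [Finset.mem_sigma] at h
    exact (Finset.mul_prod_erase S v h.2).symm

/-- The weight of the pairs `(m, S)` with `m ∈ S` and `m + ∑ S = n`. -/
def repeatErr (v : ℕ → ℝ) (j n : ℕ) : ℝ :=
  ∑ p ∈ Finset.HasAntidiagonal.antidiagonal n,
      v p.1 * ∑ S ∈ (reps j p.2).filter (fun S => p.1 ∈ S), wt v S

/-- The convolution ranges over pairs `(m, S)`; those with `m ∉ S` are marked `(j+1)`-sets, the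
others form the error. This recursion replaces ordered tuples and produces the factorial in the
limit. -/
lemma conv_sig (v : ℕ → ℝ) (j n : ℕ) :
    conv v (sig v j) n = ((j : ℝ) + 1) * sig v (j + 1) n + repeatErr v j n := by
  rw [succ_mul_sig_succ, repeatErr, conv, ← Finset.sum_add_distrib]
  refine Finset.sum_congr rfl fun p _ => ?_
  rw [← mul_add, add_comm, Finset.sum_filter_add_sum_filter_not, sig]

lemma repeatErr_nonneg {v : ℕ → ℝ} (hv : ∀ m, 0 ≤ v m) (j n : ℕ) : 0 ≤ repeatErr v j n :=
  Finset.sum_nonneg fun _ _ => mul_nonneg (hv _) (Finset.sum_nonneg fun S _ => wt_nonneg hv S)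

lemma sum_wt_mem_le {v : ℕ → ℝ} (hv : ∀ m, 0 ≤ v m) (j m q : ℕ) :
    ∑ S ∈ (reps (j + 1) q).filter (fun S => m ∈ S), wt v S
      ≤ if m ≤ q then v m * sig v j (q - m) else 0 := by
  split_ifs with hmq
  · rw [sig, Finset.mul_sum]
    have : ∑ S ∈ (reps (j + 1) q).filter (fun S => m ∈ S), wt v S
        = ∑ S ∈ ((reps (j + 1) q).filter (fun S => m ∈ S)).image (fun S => S.erase m),
          v m * wt v S := by
      rw [Finset.sum_image]
      · refine Finset.sum_congr rfl fun S hS => ?_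
        exact (Finset.mul_prod_erase S v (Finset.mem_filter.1 hS).2).symm
      · intro S hS S' hS' h
        have h1 := (Finset.mem_filter.1 hS).2
        have h2 := (Finset.mem_filter.1 hS').2
        rw [← Finset.insert_erase h1, ← Finset.insert_erase h2]
        exact congrArg _ h
    rw [this]
    refine Finset.sum_le_sum_of_subset_of_nonneg (fun S' hS' => ?_)
      fun S _ _ => mul_nonneg (hv _) (wt_nonneg hv S)
    obtain ⟨S, hS, rfl⟩ := Finset.mem_image.1 hS'
    obtain ⟨hS, hm⟩ := Finset.mem_filter.1 hS
    obtain ⟨hc, hs⟩ := mem_reps.1 hS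
    have h3 := Finset.add_sum_erase S (fun m : ℕ => m) hm
    rw [mem_reps, Finset.card_erase_of_mem hm, hc]
    constructor <;> omega
  · rw [Finset.filter_false_of_mem, Finset.sum_empty]
    intro S hS hm
    have := Finset.single_le_sum (f := fun m : ℕ => m) (fun _ _ => Nat.zero_le _) hm
    rw [(mem_reps.1 hS).2] at this
    exact hmq this

lemma sig_le {v : ℕ → ℝ} (hv : ∀ m, 0 ≤ v m) {a C : ℝ}
    (hC : ∀ m, v m ≤ C * binCoeff a m) (j n : ℕ) :
    sig v j n ≤ C ^ j * binCoeff (j * a) n := by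
  have hC0 : 0 ≤ C := by
    have := (hv 0).trans (hC 0)
    simpa using this
  induction j generalizing n with
  | zero => simp [sig_zero]
  | succ j ih =>
    have h1 := conv_sig v j n
    have h2 := conv_le_conv hv (sig_nonneg hv j) hC ih n
    rw [conv_mul_left, conv_mul_right, conv_binCoeff] at h2
    have h3 := repeatErr_nonneg hv j n
    have h4 := sig_nonneg hv (j + 1) n
    have h5 : (0 : ℝ) ≤ j * sig v (j + 1) n := mul_nonneg (Nat.cast_nonneg _) h4
    rw [show ((j + 1 : ℕ) : ℝ) * a = a + j * a by push_cast; ring, pow_succ]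
    linarith

lemma exists_binCoeff_le_double {s : ℝ} (hs : 0 < s) :
    ∃ C, 0 < C ∧ ∀ n : ℕ, binCoeff s n ≤ C * binCoeff s (2 * n) := by
  obtain ⟨A, hA, hA'⟩ := exists_binCoeff_le_rpow hs
  obtain ⟨B, hB, hB'⟩ := exists_rpow_le_binCoeff hs
  have h2 : (0 : ℝ) < 2 ^ (s - 1) := by positivity
  refine ⟨max 1 (A * B / 2 ^ (s - 1)), by positivity, fun n => ?_⟩
  rcases Nat.eq_zero_or_pos n with rfl | hn
  · simp
  have h1 := hA' n hn
  have h3 := hB' (2 * n)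
  push_cast at h3
  rw [Real.mul_rpow (by norm_num) (Nat.cast_nonneg _)] at h3
  have hp := binCoeff_pos hs (2 * n)
  calc binCoeff s n ≤ A * (n : ℝ) ^ (s - 1) := h1
    _ = A * ((2 : ℝ) ^ (s - 1) * (n : ℝ) ^ (s - 1)) / 2 ^ (s - 1) := by field_simp
    _ ≤ A * (B * binCoeff s (2 * n)) / 2 ^ (s - 1) := by gcongr
    _ = A * B / 2 ^ (s - 1) * binCoeff s (2 * n) := by ring
    _ ≤ _ := by gcongr; exact le_max_right _ _

/-- Squares behave like `m^(2a-2)`, of exponent `2a - 1 ≤ 0`; the exponent `a / 2` is a positive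
substitute that still saves against `2a`. -/
lemma exists_sq_le {v : ℕ → ℝ} (hv : ∀ m, 0 ≤ v m) {a C : ℝ} (ha : 0 < a) (ha1 : a ≤ 1 / 2)
    (hC : ∀ m, v m ≤ C * binCoeff a m) :
    ∃ D, 0 < D ∧ ∀ m, v m ^ 2 ≤ D * binCoeff (a / 2) m := by
  obtain ⟨D, hD, h⟩ := exists_binCoeff_mul_le ha ha (s := a / 2) (by positivity) (by linarith)
  have hC0 : 0 ≤ C := by
    have := (hv 0).trans (hC 0)
    simpa using this
  refine ⟨(C ^ 2 + 1) * D, by positivity, fun m => ?_⟩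
  have hp := binCoeff_pos (half_pos ha) m
  calc v m ^ 2 ≤ (C * binCoeff a m) ^ 2 := by
        have := hv m; have := hC m; gcongr
    _ = C ^ 2 * (binCoeff a m * binCoeff a m) := by ring
    _ ≤ C ^ 2 * (D * binCoeff (a / 2) m) := mul_le_mul_of_nonneg_left (h m) (sq_nonneg C)
    _ ≤ (C ^ 2 + 1) * D * binCoeff (a / 2) m := by nlinarith [mul_pos hD hp]

/-- A repeated element `m` contributes `2m` to the sum and a squared weight. The substitution `(m,
q) ↦ (2m, q - m)` is injective into the antidiagonal, so the error is at most a convolution of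
exponents `a/2` and `j a`, where the full count has `(j+2) a`. -/
lemma exists_repeatErr_le {v : ℕ → ℝ} (hv : ∀ m, 0 ≤ v m) {a C : ℝ} (ha : 0 < a)
    (ha1 : a ≤ 1 / 2) (hC : ∀ m, v m ≤ C * binCoeff a m) (j : ℕ) :
    ∃ D, 0 < D ∧ ∀ n, repeatErr v (j + 1) n ≤ D * binCoeff (a / 2 + j * a) n := by
  obtain ⟨D, hD, hsq⟩ := exists_sq_le hv ha ha1 hC
  obtain ⟨D', hD', hdb⟩ := exists_binCoeff_le_double (half_pos ha)
  have hC0 : 0 ≤ C := by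
    have := (hv 0).trans (hC 0)
    simpa using this
  refine ⟨D * D' * (C ^ j + 1), by positivity, fun n => ?_⟩
  set w : ℕ → ℕ → ℝ := fun i l => binCoeff (a / 2) i * binCoeff (j * a) l with hw
  have hw0 : ∀ i l, 0 ≤ w i l := fun i l =>
    mul_nonneg (binCoeff_nonneg (by positivity) _) (binCoeff_nonneg (by positivity) _)
  have h1 : repeatErr v (j + 1) n ≤ ∑ p ∈ (Finset.HasAntidiagonal.antidiagonal n).filter
      (fun p => p.1 ≤ p.2), D * D' * (C ^ j + 1) * w (2 * p.1) (p.2 - p.1) := by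
    rw [repeatErr, Finset.sum_filter]
    refine Finset.sum_le_sum fun p _ => ?_
    refine (mul_le_mul_of_nonneg_left (sum_wt_mem_le hv j p.1 p.2) (hv _)).trans ?_
    split_ifs with h
    · have e1 := hsq p.1
      have e2 := hdb p.1
      have e3 := sig_le hv hC j (p.2 - p.1)
      have e4 := sig_nonneg hv j (p.2 - p.1)
      have e5 : 0 ≤ binCoeff (j * a) (p.2 - p.1) := binCoeff_nonneg (by positivity) _
      have e6 := binCoeff_pos (half_pos ha) (2 * p.1)
      calc v p.1 * (v p.1 * sig v j (p.2 - p.1)) = v p.1 ^ 2 * sig v j (p.2 - p.1) := by ring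
        _ ≤ (D * (D' * binCoeff (a / 2) (2 * p.1))) * ((C ^ j + 1) * binCoeff (j * a) (p.2 - p.1)) := by
          refine mul_le_mul (e1.trans (by gcongr)) (e3.trans ?_) e4 (by positivity)
          gcongr; linarith
        _ = _ := by simp only [hw]; ring
    · simp
  refine h1.trans ?_
  rw [← Finset.mul_sum]
  refine mul_le_mul_of_nonneg_left ?_ (by positivity)
  have e := congrFun (conv_binCoeff (a / 2) (j * a)) n
  rw [← e, conv]
  have : ∑ p ∈ (Finset.HasAntidiagonal.antidiagonal n).filter (fun p => p.1 ≤ p.2),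
      w (2 * p.1) (p.2 - p.1)
      = ∑ p ∈ ((Finset.HasAntidiagonal.antidiagonal n).filter (fun p => p.1 ≤ p.2)).image
        (fun p => (2 * p.1, p.2 - p.1)), w p.1 p.2 := by
    rw [Finset.sum_image]
    rintro ⟨x, y⟩ hx ⟨x', y'⟩ hx' h
    simp only [Finset.coe_filter, Finset.HasAntidiagonal.mem_antidiagonal, Set.mem_ofPred_eq] at hx hx'
    simp only [Prod.mk.injEq] at h ⊢
    omega
  rw [this]
  refine Finset.sum_le_sum_of_subset_of_nonneg (fun p hp => ?_) fun _ _ _ => hw0 _ _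
  obtain ⟨q, hq, rfl⟩ := Finset.mem_image.1 hp
  simp only [Finset.mem_filter, Finset.HasAntidiagonal.mem_antidiagonal] at hq ⊢
  omega

/-- Induction by `conv_sig`: one more convolution with `v`, the repeated terms being of lower order.
The division by `j + 1` at each step builds the factorial. -/
theorem hasProfile_sig {v : ℕ → ℝ} (hv : ∀ m, 0 ≤ v m) {a C κ s : ℝ} (ha : 0 < a)
    (ha1 : a ≤ 1 / 2) (hC : ∀ m, v m ≤ C * binCoeff a m) {t : UnitAddCircle}
    (ht : ¬ IsOfFinAddOrder t)
    (hprof : HasProfile t a v (fun x => κ * (arc s).indicator 1 x)) (j : ℕ)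
    (hj : ((j : ℝ) + 1) * a ≤ 1) :
    HasProfile t ((j + 1) * a) (sig v (j + 1))
      (fun x => κ ^ (j + 1) / (j + 1).factorial * arcConv s j x) := by
  induction j with
  | zero =>
    have : sig v (0 + 1) = v := funext fun n => sig_one v n
    rw [this]
    simpa [arcConv] using hprof
  | succ j ih =>
    have hj1 : ((j : ℝ) + 1) * a ≤ 1 := by push_cast at hj; linarith
    have h1 := HasProfile.conv ha (by linarith) (by positivity) hj1 ht hprof (ih hj1)
      ((riemannApprox_arc s).const_mul κ) ((riemannApprox_arcConv s j).const_mul _)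
    obtain ⟨D, hD, hD'⟩ := exists_repeatErr_le hv ha ha1 hC j
    have hsum : a + ((j : ℝ) + 1) * a = ((j + 1 : ℕ) + 1) * a := by push_cast; ring
    rw [hsum] at h1
    have h2 := (h1.sub_little (g := fun n => ((j + 1 : ℕ) + 1 : ℝ) * sig v (j + 1 + 1) n) ?_).const_mul
      (1 / ((j + 1 : ℕ) + 1 : ℝ))
    · refine h2.congr fun n => ?_
      congr 1
      · field_simp
      · have : cconv (fun x => κ * (arc s).indicator 1 x)
            (fun x => κ ^ (j + 1) / (j + 1).factorial * arcConv s j x) (n • t)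
            = κ * (κ ^ (j + 1) / (j + 1).factorial) * arcConv s (j + 1) (n • t) := by
          rw [arcConv, cconv, cconv, ← integral_const_mul]
          congr 1; funext y; ring
        dsimp only
        rw [this, Nat.factorial_succ (j + 1)]
        have hf : ((j + 1).factorial : ℝ) ≠ 0 := by positivity
        push_cast
        field_simp
        ring
    · have hp : (0 : ℝ) < ((j + 1 : ℕ) + 1) * a := by positivity
      have h3 := (tendsto_binCoeff_div_binCoeff (a := a / 2 + j * a) (b := ((j + 1 : ℕ) + 1) * a)
        (by positivity) (by push_cast; linarith)).const_mul D
      rw [mul_zero] at h3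
      refine squeeze_zero (fun n => ?_) (fun n => ?_) h3
      · rw [conv_sig, add_sub_cancel_left]
        exact div_nonneg (repeatErr_nonneg hv _ _) (binCoeff_pos hp _).le
      · rw [conv_sig, add_sub_cancel_left, ← mul_div_assoc]
        exact div_le_div_of_nonneg_right (hD' n) (binCoeff_pos hp _).le

/-! ### Pairs of representations that share elements. -/

/-- Pairs of distinct intersecting `k`-element sets with sums `N` and `N'`. -/
def overlapPairs (k N N' : ℕ) : Finset (Finset ℕ × Finset ℕ) :=
  (reps k N ×ˢ reps k N').filter fun x => x.1 ≠ x.2 ∧ ¬ Disjoint x.1 x.2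

/-- The total weight of the unions of distinct intersecting representations of `N` and `N'`. -/
def overlap (v : ℕ → ℝ) (k N N' : ℕ) : ℝ := ∑ x ∈ overlapPairs k N N', wt v (x.1 ∪ x.2)

lemma overlap_comm (v : ℕ → ℝ) (k N N' : ℕ) : overlap v k N N' = overlap v k N' N := by
  refine Finset.sum_nbij' Prod.swap Prod.swap ?_ ?_ (fun _ _ => rfl) (fun _ _ => rfl) ?_
  · rintro ⟨S, S'⟩ h
    simp only [overlapPairs, Finset.mem_filter, Finset.mem_product, Prod.swap] at h ⊢
    exact ⟨h.1.symm, h.2.1.symm, fun hd => h.2.2 hd.symm⟩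
  · rintro ⟨S, S'⟩ h
    simp only [overlapPairs, Finset.mem_filter, Finset.mem_product, Prod.swap] at h ⊢
    exact ⟨h.1.symm, h.2.1.symm, fun hd => h.2.2 hd.symm⟩
  · rintro ⟨S, S'⟩ h
    simp [Finset.union_comm]

lemma wt_union_eq (v : ℕ → ℝ) (S S' : Finset ℕ) :
    wt v (S ∪ S') = wt v (S ∩ S') * wt v (S \ S') * wt v (S' \ S) := by
  unfold wt
  rw [← Finset.prod_union (Finset.disjoint_sdiff_inter S S').symm, Finset.union_comm (S ∩ S'),
    Finset.sdiff_union_inter, ← Finset.prod_union Finset.disjoint_sdiff, Finset.union_sdiff_self_eq_union]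

/-- A pair is determined by its intersection and its two differences. With `r` and `ρ` the size and
the sum of the intersection, each difference represents a remainder by `k - r` elements; `r < k`
because distinct sets of equal size are not nested. -/
lemma overlap_le_sum {v : ℕ → ℝ} (hv : ∀ m, 0 ≤ v m) (k N N' : ℕ) :
    overlap v k N N' ≤ ∑ r ∈ Finset.Ico 1 k, ∑ ρ ∈ Finset.range (N + 1),
      sig v r ρ * (sig v (k - r) (N - ρ) * sig v (k - r) (N' - ρ)) := by
  set Y : Finset (Σ _ : ℕ × ℕ, Finset ℕ × Finset ℕ × Finset ℕ) :=
    (Finset.Ico 1 k ×ˢ Finset.range (N + 1)).sigma fun q =>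
      reps q.1 q.2 ×ˢ (reps (k - q.1) (N - q.2) ×ˢ reps (k - q.1) (N' - q.2)) with hY
  have hR : ∑ r ∈ Finset.Ico 1 k, ∑ ρ ∈ Finset.range (N + 1),
      sig v r ρ * (sig v (k - r) (N - ρ) * sig v (k - r) (N' - ρ))
      = ∑ y ∈ Y, wt v y.2.1 * (wt v y.2.2.1 * wt v y.2.2.2) := by
    rw [hY, Finset.sum_sigma, Finset.sum_product]
    refine Finset.sum_congr rfl fun r _ => Finset.sum_congr rfl fun ρ _ => ?_
    rw [Finset.sum_product, sig, sig, sig, Finset.sum_mul]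
    refine Finset.sum_congr rfl fun S _ => ?_
    rw [Finset.sum_mul_sum, Finset.sum_product, Finset.mul_sum]
    simp_rw [Finset.mul_sum]
  let e : Finset ℕ × Finset ℕ → (Σ _ : ℕ × ℕ, Finset ℕ × Finset ℕ × Finset ℕ) := fun x =>
    ⟨((x.1 ∩ x.2).card, ∑ m ∈ x.1 ∩ x.2, m), (x.1 ∩ x.2, x.1 \ x.2, x.2 \ x.1)⟩
  have hL : overlap v k N N' = ∑ y ∈ (overlapPairs k N N').image e,
      wt v y.2.1 * (wt v y.2.2.1 * wt v y.2.2.2) := by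
    rw [Finset.sum_image]
    · refine Finset.sum_congr rfl fun x _ => ?_
      rw [wt_union_eq, mul_assoc]
    · rintro ⟨S, S'⟩ _ ⟨R, R'⟩ _ h
      simp only [e, Sigma.mk.injEq, Prod.mk.injEq, heq_eq_eq] at h
      obtain ⟨_, h1, h2, h3⟩ := h
      rw [Prod.mk.injEq]
      constructor
      · rw [← Finset.sdiff_union_inter S S', ← Finset.sdiff_union_inter R R', h1, h2]
      · rw [← Finset.sdiff_union_inter S' S, ← Finset.sdiff_union_inter R' R, h3,
          Finset.inter_comm, h1, Finset.inter_comm]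
  rw [hR, hL]
  refine Finset.sum_le_sum_of_subset_of_nonneg ?_ fun y _ _ =>
    mul_nonneg (wt_nonneg hv _) (mul_nonneg (wt_nonneg hv _) (wt_nonneg hv _))
  intro y hy
  obtain ⟨⟨S, S'⟩, hx, rfl⟩ := Finset.mem_image.1 hy
  simp only [overlapPairs, Finset.mem_filter, Finset.mem_product, mem_reps] at hx
  obtain ⟨⟨⟨hc, hs⟩, ⟨hc', hs'⟩⟩, hne, hd⟩ := hx
  have h1 := Finset.card_sdiff_add_card_inter S S'
  have h2 := Finset.card_sdiff_add_card_inter S' S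
  have h3 : ∑ m ∈ S \ S', m + ∑ m ∈ S ∩ S', m = ∑ m ∈ S, m := by
    rw [← Finset.sum_union (Finset.disjoint_sdiff_inter S S'), Finset.sdiff_union_inter]
  have h4 : ∑ m ∈ S' \ S, m + ∑ m ∈ S' ∩ S, m = ∑ m ∈ S', m := by
    rw [← Finset.sum_union (Finset.disjoint_sdiff_inter S' S), Finset.sdiff_union_inter]
  rw [Finset.inter_comm S' S] at h2 h4
  have h5 : 0 < (S ∩ S').card := by
    rw [Finset.card_pos]; exact Finset.not_disjoint_iff_nonempty_inter.1 hd
  have h6 : 0 < (S \ S').card := by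
    rw [Finset.card_pos, Finset.sdiff_nonempty]
    intro hsub
    exact hne (Finset.eq_of_subset_of_card_le hsub (by omega))
  simp only [e, hY, Finset.mem_sigma, Finset.mem_product, Finset.mem_Ico, Finset.mem_range, mem_reps,
    true_and]
  refine ⟨⟨⟨?_, ?_⟩, ?_⟩, ⟨?_, ?_⟩, ⟨?_, ?_⟩⟩ <;> omega

/-- The weight of exponent `1 - r a` is antitone, so both differences may be estimated at the
smaller remainder `N - ρ`. Its square has exponent `1 - 2ra`, at most `1 - ra - a/2` since `r ≥ 1`;
convolution with exponent `ra` yields `1 - a/2`, a saving independent of `r`. -/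
theorem exists_overlap_le {v : ℕ → ℝ} (hv : ∀ m, 0 ≤ v m) {a C : ℝ} (ha : 0 < a)
    (hC : ∀ m, v m ≤ C * binCoeff a m) {k : ℕ} (hk : k * a = 1) :
    ∃ D, 0 < D ∧ ∀ N N', N ≤ N' → overlap v k N N' ≤ D * binCoeff (1 - a / 2) N := by
  have hC0 : 0 ≤ C := by
    have := (hv 0).trans (hC 0)
    simpa using this
  have hE : ∀ r ∈ Finset.Ico 1 k, ∃ D, 0 < D ∧ ∀ n,
      binCoeff ((k - r : ℕ) * a) n * binCoeff ((k - r : ℕ) * a) n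
        ≤ D * binCoeff (1 - r * a - a / 2) n := by
    intro r hr
    obtain ⟨h1, h2⟩ := Finset.mem_Ico.1 hr
    have e1 : ((k - r : ℕ) : ℝ) * a = 1 - r * a := by
      rw [Nat.cast_sub h2.le, sub_mul, hk]
    have e2 : a ≤ ((k - r : ℕ) : ℝ) * a := by
      refine le_mul_of_one_le_left ha.le ?_
      have : 1 ≤ k - r := by omega
      exact_mod_cast this
    have e3 : a ≤ r * a := le_mul_of_one_le_left ha.le (by exact_mod_cast h1)
    rw [e1] at e2 ⊢
    exact exists_binCoeff_mul_le (by linarith) (by linarith) (by linarith) (by linarith)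
  choose! D hD hD' using hE
  refine ⟨∑ r ∈ Finset.Ico 1 k, C ^ r * (C ^ (k - r) * C ^ (k - r)) * D r + 1, ?_, ?_⟩
  · have : 0 ≤ ∑ r ∈ Finset.Ico 1 k, C ^ r * (C ^ (k - r) * C ^ (k - r)) * D r :=
      Finset.sum_nonneg fun r hr => by have := hD r hr; positivity
    linarith
  intro N N' hN
  refine (overlap_le_sum hv k N N').trans ?_
  have hle : ∀ r ∈ Finset.Ico 1 k, ∑ ρ ∈ Finset.range (N + 1),
      sig v r ρ * (sig v (k - r) (N - ρ) * sig v (k - r) (N' - ρ))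
      ≤ C ^ r * (C ^ (k - r) * C ^ (k - r)) * D r * binCoeff (1 - a / 2) N := by
    intro r hr
    obtain ⟨h1, h2⟩ := Finset.mem_Ico.1 hr
    have hDr := hD r hr
    have e1 : ((k - r : ℕ) : ℝ) * a = 1 - r * a := by
      rw [Nat.cast_sub h2.le, sub_mul, hk]
    have hr0 : (0 : ℝ) ≤ r * a := by positivity
    have hb0 : 0 ≤ ((k - r : ℕ) : ℝ) * a := by positivity
    have e := congrFun (conv_binCoeff (r * a) (1 - r * a - a / 2)) N
    rw [show r * a + (1 - r * a - a / 2) = 1 - a / 2 by ring] at e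
    rw [← e, conv, Finset.Nat.sum_antidiagonal_eq_sum_range_succ_mk, Finset.mul_sum]
    refine Finset.sum_le_sum fun ρ hρ => ?_
    have b1 := sig_le hv hC r ρ
    have b2 := sig_le hv hC (k - r) (N - ρ)
    have b3 := sig_le hv hC (k - r) (N' - ρ)
    have b4 : binCoeff ((k - r : ℕ) * a) (N' - ρ) ≤ binCoeff ((k - r : ℕ) * a) (N - ρ) :=
      binCoeff_antitone hb0 (by rw [e1]; linarith) (Nat.sub_le_sub_right hN ρ)
    have b5 := hD' r hr (N - ρ)
    have c1 := binCoeff_nonneg hr0 ρ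
    have c2 := binCoeff_nonneg hb0 (N - ρ)
    calc sig v r ρ * (sig v (k - r) (N - ρ) * sig v (k - r) (N' - ρ))
        ≤ (C ^ r * binCoeff (r * a) ρ) * ((C ^ (k - r) * binCoeff ((k - r : ℕ) * a) (N - ρ))
          * (C ^ (k - r) * binCoeff ((k - r : ℕ) * a) (N - ρ))) := by
          refine mul_le_mul b1 (mul_le_mul b2 (b3.trans (by gcongr)) (sig_nonneg hv _ _)
            (by positivity)) (mul_nonneg (sig_nonneg hv _ _) (sig_nonneg hv _ _)) (by positivity)
      _ = C ^ r * (C ^ (k - r) * C ^ (k - r)) * binCoeff (r * a) ρ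
          * (binCoeff ((k - r : ℕ) * a) (N - ρ) * binCoeff ((k - r : ℕ) * a) (N - ρ)) := by ring
      _ ≤ C ^ r * (C ^ (k - r) * C ^ (k - r)) * binCoeff (r * a) ρ
          * (D r * binCoeff (1 - r * a - a / 2) (N - ρ)) := by gcongr
      _ = _ := by ring
  refine (Finset.sum_le_sum hle).trans ?_
  rw [← Finset.sum_mul, add_mul, one_mul]
  have hk1 : a / 2 ≤ 1 := by
    have : (1 : ℝ) ≤ k := by
      rcases Nat.eq_zero_or_pos k with rfl | h
      · simp at hk
      · exact_mod_cast h
    nlinarith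
  linarith [binCoeff_nonneg (sub_nonneg.2 hk1) N]

lemma sig_sq (v : ℕ → ℝ) (k N : ℕ) : ∑ S ∈ reps k N, wt v S ^ 2 = sig (fun m => v m ^ 2) k N := by
  refine Finset.sum_congr rfl fun S _ => ?_
  rw [wt, wt, Finset.prod_pow]

theorem exists_sum_wt_sq_le {v : ℕ → ℝ} (hv : ∀ m, 0 ≤ v m) {a C : ℝ} (ha : 0 < a)
    (ha1 : a ≤ 1 / 2) (hC : ∀ m, v m ≤ C * binCoeff a m) {k : ℕ} (hk : k * a = 1) :
    ∃ D, 0 < D ∧ ∀ N, ∑ S ∈ reps k N, wt v S ^ 2 ≤ D * binCoeff (1 - a / 2) N := by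
  obtain ⟨D, hD, h⟩ := exists_sq_le hv ha ha1 hC
  refine ⟨D ^ k, by positivity, fun N => ?_⟩
  rw [sig_sq]
  refine (sig_le (fun m => sq_nonneg _) h k N).trans ?_
  gcongr
  refine binCoeff_mono_left (by positivity) ?_ N
  rw [← mul_div_assoc, hk]; linarith

/-! ### Independent random sets and Poisson approximation. -/

/-- `X` is the sequence of indicators of a random set that contains `m` with probability `v m`,
independently for different `m`. -/
structure IsRandomSet (v : ℕ → ℝ) {Ω : Type*} [MeasurableSpace Ω] (P : Measure Ω)
    (X : ℕ → Ω → Bool) : Prop where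
  measurable : ∀ m, Measurable (X m)
  indep : iIndepFun X P
  prob : ∀ m, P.real {ω | X m ω = true} = v m

/-- The indicator of the event that all elements of `S` are chosen. -/
def occ (S : Finset ℕ) (x : ℕ → Bool) : ℝ := if ∀ m ∈ S, x m = true then 1 else 0

/-- The number of sets of the family that are chosen completely. -/
def occCount {ι : Type*} (s : Finset ι) (S : ι → Finset ℕ) (x : ℕ → Bool) : ℕ :=
  (s.filter fun i => ∀ m ∈ S i, x m = true).card

lemma occ_nonneg (S : Finset ℕ) (x : ℕ → Bool) : 0 ≤ occ S x := by
  unfold occ; split_ifs <;> norm_num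

lemma occ_mul_occ (S S' : Finset ℕ) (x : ℕ → Bool) : occ S x * occ S' x = occ (S ∪ S') x := by
  unfold occ
  have e : (∀ m ∈ S ∪ S', x m = true) ↔ (∀ m ∈ S, x m = true) ∧ ∀ m ∈ S', x m = true :=
    ⟨fun H => ⟨fun m hm => H m (Finset.mem_union_left _ hm),
      fun m hm => H m (Finset.mem_union_right _ hm)⟩,
      fun H m hm => (Finset.mem_union.1 hm).elim (H.1 m) (H.2 m)⟩
  by_cases h : ∀ m ∈ S, x m = true
  · by_cases h' : ∀ m ∈ S', x m = true
    · rw [if_pos h, if_pos h', if_pos (e.2 ⟨h, h'⟩), one_mul]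
    · rw [if_neg h', if_neg (fun H => h' (e.1 H).2), mul_zero]
  · rw [if_neg h, if_neg (fun H => h (e.1 H).1), zero_mul]

lemma occCount_eq_sum {ι : Type*} (s : Finset ι) (S : ι → Finset ℕ) (x : ℕ → Bool) :
    (occCount s S x : ℝ) = ∑ i ∈ s, occ (S i) x := by
  simp [occCount, occ]

lemma dependsOn_occ (S : Finset ℕ) : DependsOn (occ S) (S : Set ℕ) := by
  intro x y h
  unfold occ
  congr 1
  exact propext ⟨fun H m hm => by rw [← h m hm]; exact H m hm,
    fun H m hm => by rw [h m hm]; exact H m hm⟩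

lemma dependsOn_occCount {ι : Type*} (s : Finset ι) (S : ι → Finset ℕ) :
    DependsOn (occCount s S) (s.biUnion S : Set ℕ) := by
  intro x y h
  unfold occCount
  congr 1
  refine Finset.filter_congr fun i hi => ?_
  have h' : ∀ m ∈ S i, x m = y m := fun m hm => h m (by
    rw [Finset.mem_coe, Finset.mem_biUnion]; exact ⟨i, hi, hm⟩)
  exact ⟨fun H m hm => by rw [← h' m hm]; exact H m hm,
    fun H m hm => by rw [h' m hm]; exact H m hm⟩

/-- A function of finitely many coordinates factors through a finite type. Measurability and
boundedness are then automatic, and independence of blocks of coordinates applies. -/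
lemma DependsOn.eq_comp_extend {β : Type*} {f : (ℕ → Bool) → β} {W : Finset ℕ}
    (hf : DependsOn f (W : Set ℕ)) (x : ℕ → Bool) :
    f x = f (fun m => if h : m ∈ W then (fun i : W => x i) ⟨m, h⟩ else false) :=
  hf fun m hm => by rw [dif_pos (show m ∈ W from hm)]

section

variable {Ω : Type*} [MeasurableSpace Ω] {P : Measure Ω}
  {X : ℕ → Ω → Bool} {v : ℕ → ℝ}

lemma IsRandomSet.measurable_comp (hX : IsRandomSet v P X) {β : Type*} [MeasurableSpace β]
    {f : (ℕ → Bool) → β} {W : Finset ℕ} (hf : DependsOn f (W : Set ℕ)) :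
    Measurable fun ω => f (fun m => X m ω) := by
  have e : (fun ω => f (fun m => X m ω)) =
      (fun z : W → Bool => f (fun m => if h : m ∈ W then z ⟨m, h⟩ else false)) ∘
        (fun ω => fun i : W => X i ω) := by
    funext ω
    exact DependsOn.eq_comp_extend hf _
  rw [e]
  exact (measurable_of_finite _).comp (measurable_pi_lambda _ fun i => hX.measurable i)

lemma IsRandomSet.integral_mul (hX : IsRandomSet v P X) {f g : (ℕ → Bool) → ℝ} {V W : Finset ℕ}
    (hf : DependsOn f (V : Set ℕ)) (hg : DependsOn g (W : Set ℕ)) (hVW : Disjoint V W) :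
    ∫ ω, f (fun m => X m ω) * g (fun m => X m ω) ∂P
      = (∫ ω, f (fun m => X m ω) ∂P) * ∫ ω, g (fun m => X m ω) ∂P := by
  refine IndepFun.integral_fun_mul_eq_mul_integral ?_
    (hX.measurable_comp hf).aestronglyMeasurable (hX.measurable_comp hg).aestronglyMeasurable
  have h := (hX.indep.indepFun_finset V W hVW hX.measurable).comp
    (φ := fun z : V → Bool => f (fun m => if h : m ∈ V then z ⟨m, h⟩ else false))
    (ψ := fun z : W → Bool => g (fun m => if h : m ∈ W then z ⟨m, h⟩ else false))
    (measurable_of_finite _) (measurable_of_finite _)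
  have e1 : (fun ω => f (fun m => X m ω))
      = (fun z : V → Bool => f (fun m => if h : m ∈ V then z ⟨m, h⟩ else false)) ∘
        (fun ω => fun i : V => X i ω) := funext fun ω => DependsOn.eq_comp_extend hf _
  have e2 : (fun ω => g (fun m => X m ω))
      = (fun z : W → Bool => g (fun m => if h : m ∈ W then z ⟨m, h⟩ else false)) ∘
        (fun ω => fun i : W => X i ω) := funext fun ω => DependsOn.eq_comp_extend hg _
  rw [e1, e2]
  exact h

lemma IsRandomSet.integrable [IsProbabilityMeasure P] (hX : IsRandomSet v P X) {f : (ℕ → Bool) → ℝ} {W : Finset ℕ}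
    (hf : DependsOn f (W : Set ℕ)) : Integrable (fun ω => f (fun m => X m ω)) P := by
  have hfin : (Set.range fun ω => f (fun m => X m ω)).Finite := by
    refine (Set.finite_range (fun z : W → Bool =>
      f (fun m => if h : m ∈ W then z ⟨m, h⟩ else false))).subset ?_
    rintro _ ⟨ω, rfl⟩
    exact ⟨fun i => X i ω, (DependsOn.eq_comp_extend hf (fun m => X m ω)).symm⟩
  obtain ⟨B, hB⟩ := hfin.isBounded.exists_norm_le
  exact Integrable.of_bound (hX.measurable_comp hf).aestronglyMeasurable B
    (Eventually.of_forall fun ω => hB _ ⟨ω, rfl⟩)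

lemma IsRandomSet.integral_occ (hX : IsRandomSet v P X) (S : Finset ℕ) :
    ∫ ω, occ S (fun m => X m ω) ∂P = wt v S := by
  have hset : {ω | ∀ m ∈ S, X m ω = true} = ⋂ m ∈ S, X m ⁻¹' {true} := by ext; simp
  have hms : MeasurableSet {ω | ∀ m ∈ S, X m ω = true} := by
    rw [hset]
    exact Finset.measurableSet_biInter _ fun m _ => hX.measurable m (measurableSet_singleton _)
  have h1 : (fun ω => occ S (fun m => X m ω)) = {ω | ∀ m ∈ S, X m ω = true}.indicator 1 := by
    funext ω
    simp [occ, Set.indicator_apply]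
  rw [h1, integral_indicator_one hms, hset, measureReal_def,
    hX.indep.measure_inter_preimage_eq_mul S (fun _ _ => measurableSet_singleton _),
    ENNReal.toReal_prod, wt]
  exact Finset.prod_congr rfl fun m _ => hX.prob m

lemma DependsOn.comp_left {β γ : Type*} {f : (ℕ → Bool) → β} {W : Set ℕ} (hf : DependsOn f W)
    (g : β → γ) : DependsOn (fun x => g (f x)) W := fun _ _ h => congrArg g (hf h)

lemma DependsOn.mono' {β : Type*} {f : (ℕ → Bool) → β} {V W : Set ℕ} (hf : DependsOn f V)
    (h : V ⊆ W) : DependsOn f W := fun _ _ H => hf fun m hm => H m (h hm)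

lemma abs_pow_add_sub_pow_le {u : ℝ} (h0 : 0 ≤ u) (h1 : u ≤ 1) (y z : ℕ) :
    |u ^ (y + z) - u ^ y| ≤ z := by
  rcases Nat.eq_zero_or_pos z with rfl | hz
  · simp
  have e1 : u ^ (y + z) ≤ 1 := pow_le_one₀ h0 h1
  have e2 : u ^ y ≤ 1 := pow_le_one₀ h0 h1
  have e3 : (1 : ℝ) ≤ z := by exact_mod_cast hz
  have e4 : 0 ≤ u ^ (y + z) := by positivity
  have e5 : 0 ≤ u ^ y := by positivity
  rw [abs_le]; constructor <;> linarith

/-- The error term in the Poisson approximation for the number of chosen sets of a family. -/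
def poissonErr {ι : Type*} [DecidableEq ι] (v : ℕ → ℝ) (s : Finset ι) (S : ι → Finset ℕ) : ℝ :=
  ∑ i ∈ s, ((∑ j ∈ (s.filter fun j => ¬ Disjoint (S i) (S j)).erase i, wt v (S i ∪ S j))
    + wt v (S i) * ∑ j ∈ s.filter (fun j => ¬ Disjoint (S i) (S j)), wt v (S j))

lemma hasDerivAt_integral_pow [IsProbabilityMeasure P] {c : Ω → ℕ} (hc : Measurable c) {M : ℕ} (hM : ∀ ω, c ω ≤ M)
    {u : ℝ} (hu0 : 0 ≤ u) (hu1 : u ≤ 1) :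
    HasDerivAt (fun u : ℝ => ∫ ω, u ^ c ω ∂P) (∫ ω, (c ω : ℝ) * u ^ (c ω - 1) ∂P) u := by
  have hmeas : ∀ u : ℝ, Measurable fun ω => u ^ c ω := fun u =>
    (measurable_from_nat (f := fun n => u ^ n)).comp hc
  have hmeas' : Measurable fun ω => (c ω : ℝ) * u ^ (c ω - 1) :=
    (measurable_from_nat (f := fun n : ℕ => (n : ℝ) * u ^ (n - 1))).comp hc
  refine (hasDerivAt_integral_of_dominated_loc_of_deriv_le (s := Metric.ball u 1)
    (F' := fun u ω => (c ω : ℝ) * u ^ (c ω - 1)) (bound := fun _ => (M : ℝ) * 2 ^ M)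
    (Metric.ball_mem_nhds u one_pos) (Eventually.of_forall fun u => (hmeas u).aestronglyMeasurable)
    ?_ hmeas'.aestronglyMeasurable ?_ (integrable_const _) ?_).2
  · refine Integrable.of_bound (hmeas u).aestronglyMeasurable 1 (Eventually.of_forall fun ω => ?_)
    rw [Real.norm_eq_abs, abs_of_nonneg (by positivity)]
    exact pow_le_one₀ hu0 hu1
  · refine Eventually.of_forall fun ω x hx => ?_
    rw [Metric.mem_ball, Real.dist_eq, abs_lt] at hx
    have h2 : |x| ≤ 2 := by rw [abs_le]; constructor <;> linarith
    rw [Real.norm_eq_abs, abs_mul, abs_pow, Nat.abs_cast]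
    have h3 : (c ω : ℝ) ≤ M := by exact_mod_cast hM ω
    have h4 : |x| ^ (c ω - 1) ≤ 2 ^ (c ω - 1) := by gcongr
    have h5 : (2 : ℝ) ^ (c ω - 1) ≤ 2 ^ M :=
      pow_le_pow_right₀ (by norm_num) ((Nat.sub_le _ _).trans (hM ω))
    exact mul_le_mul h3 (h4.trans h5) (by positivity) (by positivity)
  · exact Eventually.of_forall fun ω x _ => hasDerivAt_pow (c ω) x

/-- For the number `W` of chosen sets and `h u = E u^W`, this says `h'` is nearly `μ h`. In each
term `E 1_i u^(W-1)`, the exponent is replaced by the number of chosen sets disjoint from `S i`,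
which is independent of `1_i`; after factoring, that number is changed back to `W`. The two
replacements cost the two parts of `poissonErr`. -/
lemma abs_deriv_sub_le [IsProbabilityMeasure P] (hX : IsRandomSet v P X) {ι : Type*} [DecidableEq ι]
    (s : Finset ι) (S : ι → Finset ℕ) (hS : ∀ i ∈ s, (S i).Nonempty) {u : ℝ} (hu0 : 0 ≤ u)
    (hu1 : u ≤ 1) :
    |(∫ ω, (occCount s S (fun m => X m ω) : ℝ) * u ^ (occCount s S (fun m => X m ω) - 1) ∂P)
      - (∑ i ∈ s, wt v (S i)) * ∫ ω, u ^ occCount s S (fun m => X m ω) ∂P| ≤ poissonErr v s S := by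
  set x : Ω → ℕ → Bool := fun ω m => X m ω with hx
  let N : ι → Finset ι := fun i => s.filter fun j => ¬ Disjoint (S i) (S j)
  let Y : ι → Finset ι := fun i => s.filter fun j => Disjoint (S i) (S j)
  have hsplit : ∀ i y, occCount s S y = occCount (Y i) S y + occCount (N i) S y := by
    intro i y
    have h := occCount_eq_sum s S y
    rw [← Finset.sum_filter_add_sum_filter_not s (fun j => Disjoint (S i) (S j)),
      ← occCount_eq_sum, ← occCount_eq_sum] at h
    exact_mod_cast h
  have hiN : ∀ i ∈ s, i ∈ N i := fun i hi => by
    rw [Finset.mem_filter, disjoint_self]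
    exact ⟨hi, (hS i hi).ne_empty⟩
  have dW : ∀ r : Finset ι, r ⊆ s → DependsOn (occCount r S) (s.biUnion S : Set ℕ) := fun r hr =>
    DependsOn.mono' (dependsOn_occCount r S) (by exact_mod_cast Finset.biUnion_subset_biUnion_of_subset_left S hr)
  have dO : ∀ i ∈ s, DependsOn (occ (S i)) (s.biUnion S : Set ℕ) := fun i hi =>
    DependsOn.mono' (dependsOn_occ (S i)) (by exact_mod_cast Finset.subset_biUnion_of_mem S hi)
  have hint : ∀ i ∈ s, ∀ r ⊆ s, ∀ F : ℝ → ℕ → ℝ,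
      Integrable (fun ω => F (occ (S i) (x ω)) (occCount r S (x ω))) P := by
    intro i hi r hr F
    refine hX.integrable (f := fun y => F (occ (S i) y) (occCount r S y)) (W := s.biUnion S) ?_
    intro y y' h
    simp only [dO i hi h, dW r hr h]
  have hintC : ∀ r ⊆ s, ∀ F : ℕ → ℝ, Integrable (fun ω => F (occCount r S (x ω))) P := by
    intro r hr F
    refine hX.integrable (f := fun y => F (occCount r S y)) (W := s.biUnion S) ?_
    intro y y' h
    simp only [dW r hr h]
  have hYs : ∀ i, Y i ⊆ s := fun i => Finset.filter_subset _ _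
  have hNs : ∀ i, N i ⊆ s := fun i => Finset.filter_subset _ _
  have e1 : ∫ ω, (occCount s S (x ω) : ℝ) * u ^ (occCount s S (x ω) - 1) ∂P
      = ∑ i ∈ s, ∫ ω, occ (S i) (x ω) * u ^ (occCount s S (x ω) - 1) ∂P := by
    rw [← integral_finsetSum]
    · congr 1; funext ω
      rw [occCount_eq_sum, Finset.sum_mul]
    · intro i hi
      exact hint i hi s (Finset.Subset.refl s) (fun a n => a * u ^ (n - 1))
  rw [e1, Finset.sum_mul, ← Finset.sum_sub_distrib, poissonErr]
  refine (Finset.abs_sum_le_sum_abs _ _).trans (Finset.sum_le_sum fun i hi => ?_)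
  have e2 : ∫ ω, occ (S i) (x ω) * u ^ occCount (Y i) S (x ω) ∂P
      = wt v (S i) * ∫ ω, u ^ occCount (Y i) S (x ω) ∂P := by
    rw [hX.integral_mul (f := occ (S i)) (g := fun y => u ^ occCount (Y i) S y) (V := S i)
      (W := (Y i).biUnion S) (dependsOn_occ _) (DependsOn.comp_left (dependsOn_occCount _ _) _),
      hX.integral_occ]
    rw [Finset.disjoint_biUnion_right]
    exact fun j hj => (Finset.mem_filter.1 hj).2
  have iN : ∫ ω, (occCount (N i) S (x ω) : ℝ) ∂P = ∑ j ∈ N i, wt v (S j) := by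
    simp_rw [occCount_eq_sum]
    rw [integral_finsetSum]
    · exact Finset.sum_congr rfl fun j _ => hX.integral_occ _
    · exact fun j hj => hX.integrable (dependsOn_occ (S j))
  have hw : 0 ≤ wt v (S i) := by
    rw [← hX.integral_occ]; exact integral_nonneg fun _ => occ_nonneg _ _
  -- Only outcomes that contain `S i` matter, and there the exponents differ by the number of other
  -- chosen sets meeting `S i`.
  have b1 : |∫ ω, occ (S i) (x ω) * u ^ (occCount s S (x ω) - 1) ∂P
      - ∫ ω, occ (S i) (x ω) * u ^ occCount (Y i) S (x ω) ∂P|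
      ≤ ∑ j ∈ (N i).erase i, wt v (S i ∪ S j) := by
    rw [← integral_sub (hint i hi s (Finset.Subset.refl s) fun a n => a * u ^ (n - 1))
      (hint i hi _ (hYs i) fun a n => a * u ^ n)]
    have e3 : ∑ j ∈ (N i).erase i, wt v (S i ∪ S j)
        = ∫ ω, ∑ j ∈ (N i).erase i, occ (S i) (x ω) * occ (S j) (x ω) ∂P := by
      simp_rw [occ_mul_occ]
      rw [integral_finsetSum]
      · exact Finset.sum_congr rfl fun j _ => (hX.integral_occ _).symm
      · exact fun j _ => hX.integrable (dependsOn_occ _)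
    rw [e3]
    refine abs_integral_le_integral_abs.trans (integral_mono ?_ ?_ fun ω => ?_)
    · exact ((hint i hi s (Finset.Subset.refl s) fun a n => a * u ^ (n - 1)).sub
        (hint i hi _ (hYs i) fun a n => a * u ^ n)).abs
    · simp_rw [occ_mul_occ]
      exact integrable_finsetSum _ fun j _ => hX.integrable (dependsOn_occ _)
    · dsimp only
      rw [← Finset.mul_sum, ← mul_sub, abs_mul, abs_of_nonneg (occ_nonneg _ _)]
      by_cases ho : ∀ m ∈ S i, x ω m = true
      · have ho1 : occ (S i) (x ω) = 1 := if_pos ho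
        rw [ho1, one_mul, one_mul]
        have h3 := occCount_eq_sum (N i) S (x ω)
        rw [← Finset.add_sum_erase _ _ (hiN i hi), ho1] at h3
        have h4 : ∑ j ∈ (N i).erase i, occ (S j) (x ω) = occCount ((N i).erase i) S (x ω) :=
          (occCount_eq_sum _ _ _).symm
        rw [h4] at h3 ⊢
        have h5 : occCount (N i) S (x ω) = 1 + occCount ((N i).erase i) S (x ω) := by
          exact_mod_cast h3
        rw [hsplit i, h5, show ∀ y z : ℕ, y + (1 + z) - 1 = y + z by intros; omega]
        exact abs_pow_add_sub_pow_le hu0 hu1 _ _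
      · have ho1 : occ (S i) (x ω) = 0 := if_neg ho
        rw [ho1, zero_mul, zero_mul]
  have b2 : |∫ ω, u ^ occCount s S (x ω) ∂P - ∫ ω, u ^ occCount (Y i) S (x ω) ∂P|
      ≤ ∑ j ∈ N i, wt v (S j) := by
    rw [← integral_sub (hintC s (Finset.Subset.refl s) fun n => u ^ n)
      (hintC _ (hYs i) fun n => u ^ n), ← iN]
    refine abs_integral_le_integral_abs.trans (integral_mono ?_ ?_ fun ω => ?_)
    · exact ((hintC s (Finset.Subset.refl s) fun n => u ^ n).sub
        (hintC _ (hYs i) fun n => u ^ n)).abs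
    · exact hintC _ (hNs i) fun n => (n : ℝ)
    · dsimp only
      rw [hsplit i]
      exact abs_pow_add_sub_pow_le hu0 hu1 _ _
  rw [e2] at b1
  have b3 : |wt v (S i) * ∫ ω, u ^ occCount s S (x ω) ∂P
      - wt v (S i) * ∫ ω, u ^ occCount (Y i) S (x ω) ∂P| ≤ wt v (S i) * ∑ j ∈ N i, wt v (S j) := by
    rw [← mul_sub, abs_mul, abs_of_nonneg hw]
    gcongr
  rw [abs_le] at b1 b3 ⊢
  constructor <;> linarith [b1.1, b1.2, b3.1, b3.2]

/-- Poisson approximation for the probability that no set of a family is chosen. -/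
theorem abs_integral_sub_exp_le [IsProbabilityMeasure P] (hX : IsRandomSet v P X) {ι : Type*} [DecidableEq ι]
    (s : Finset ι) (S : ι → Finset ℕ) (hS : ∀ i ∈ s, (S i).Nonempty) :
    |(∫ ω, (0 : ℝ) ^ occCount s S (fun m => X m ω) ∂P) - Real.exp (-∑ i ∈ s, wt v (S i))|
      ≤ poissonErr v s S := by
  set μ := ∑ i ∈ s, wt v (S i) with hμ
  have hμ0 : 0 ≤ μ := Finset.sum_nonneg fun i _ => by
    rw [← hX.integral_occ]; exact integral_nonneg fun _ => occ_nonneg _ _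
  let h : ℝ → ℝ := fun u => ∫ ω, u ^ occCount s S (fun m => X m ω) ∂P
  let h' : ℝ → ℝ := fun u => ∫ ω, (occCount s S (fun m => X m ω) : ℝ)
    * u ^ (occCount s S (fun m => X m ω) - 1) ∂P
  have hd : ∀ u : ℝ, 0 ≤ u → u ≤ 1 → HasDerivAt h (h' u) u := fun u h0 h1 =>
    hasDerivAt_integral_pow (hX.measurable_comp (dependsOn_occCount s S)) (M := s.card)
      (fun ω => Finset.card_filter_le _ _) h0 h1
  -- The function `h u * exp(-μ u)` joins the two quantities compared: at 0 it is the probability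
  -- that nothing is chosen, since `0^0 = 1`, and at 1 it is `exp(-μ)`. Its derivative is bounded by
  -- the previous lemma.
  have key := norm_image_sub_le_of_norm_deriv_le_segment_01'
    (f := fun u => h u * Real.exp (-(μ * u)))
    (f' := fun u => h' u * Real.exp (-(μ * u)) + h u * (Real.exp (-(μ * u)) * -(μ * 1)))
    (C := poissonErr v s S) (fun u hu => ?_) (fun u hu => ?_)
  · have h1 : h 1 = 1 := by simp [h]
    rw [h1, mul_one, one_mul, mul_zero, neg_zero, Real.exp_zero, mul_one, norm_sub_rev] at key
    exact key
  · exact ((hd u hu.1 hu.2).mul (((hasDerivAt_id u).const_mul μ).neg.exp)).hasDerivWithinAt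
  · have b := abs_deriv_sub_le hX s S hS hu.1 hu.2.le
    have e : h' u * Real.exp (-(μ * u)) + h u * (Real.exp (-(μ * u)) * -(μ * 1))
        = (h' u - μ * h u) * Real.exp (-(μ * u)) := by ring
    rw [e, Real.norm_eq_abs, abs_mul, abs_of_pos (Real.exp_pos _)]
    have h1 : Real.exp (-(μ * u)) ≤ 1 := by
      rw [Real.exp_le_one_iff]
      have := mul_nonneg hμ0 hu.1
      linarith
    exact (mul_le_of_le_one_right (abs_nonneg _) h1).trans b

end

/-! ### A strong law under a power saving in the variance. -/

lemma ae_tsum_ne_top {Ω : Type*} [MeasurableSpace Ω] {P : Measure Ω} {f : ℕ → Ω → ENNReal}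
    (hf : ∀ i, Measurable (f i)) (h : ∑' i, ∫⁻ ω, f i ω ∂P ≠ ⊤) :
    ∀ᵐ ω ∂P, ∑' i, f i ω ≠ ⊤ := by
  rw [← lintegral_tsum fun i => (hf i).aemeasurable] at h
  filter_upwards [ae_lt_top (Measurable.tsum hf) h] with ω hω
  exact hω.ne

lemma eventually_succ_pow_le (q : ℕ) {a : ℝ} (ha : 1 < a) :
    ∀ᶠ i : ℕ in atTop, (((i + 1 + 1) ^ q : ℕ) : ℝ) ≤ a * ((i + 1) ^ q : ℕ) := by
  have h1 : Tendsto (fun i : ℕ => (1 + 1 / ((i : ℝ) + 1)) ^ q) atTop (𝓝 ((1 + 0) ^ q)) :=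
    (tendsto_one_div_add_atTop_nhds_zero_nat.const_add 1).pow q
  rw [add_zero, one_pow] at h1
  filter_upwards [h1.eventually_le_const ha] with i hi
  have hp : (0 : ℝ) < (i : ℝ) + 1 := by positivity
  have e : (i : ℝ) + 1 + 1 = (1 + 1 / ((i : ℝ) + 1)) * (i + 1) := by field_simp
  push_cast
  rw [e, mul_pow]
  gcongr

/-- A strong law of large numbers for weakly correlated bounded variables. -/
theorem ae_tendsto_average {Ω : Type*} [MeasurableSpace Ω] {P : Measure Ω} [IsProbabilityMeasure P]
    {Y : ℕ → Ω → ℝ} (hm : ∀ n, Measurable (Y n)) (h0 : ∀ n ω, 0 ≤ Y n ω) (h1 : ∀ n ω, Y n ω ≤ 1)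
    {I C η : ℝ} (hη : 0 < η)
    (hI : Tendsto (fun N : ℕ => (∑ n ∈ Finset.range N, ∫ ω, Y n ω ∂P) / N) atTop (𝓝 I))
    (hcov : ∀ N : ℕ, 1 ≤ N → ∑ n ∈ Finset.range N, ∑ m ∈ Finset.range N,
      ((∫ ω, Y n ω * Y m ω ∂P) - (∫ ω, Y n ω ∂P) * ∫ ω, Y m ω ∂P) ≤ C * (N : ℝ) ^ (2 - η)) :
    ∀ᵐ ω ∂P, Tendsto (fun N : ℕ => (∑ n ∈ Finset.range N, Y n ω) / N) atTop (𝓝 I) := by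
  have hi : ∀ n, Integrable (Y n) P := fun n =>
    Integrable.of_bound (hm n).aestronglyMeasurable 1 (Eventually.of_forall fun ω => by
      rw [Real.norm_eq_abs, abs_of_nonneg (h0 n ω)]; exact h1 n ω)
  have hii : ∀ n m, Integrable (fun ω => Y n ω * Y m ω) P := fun n m =>
    Integrable.of_bound ((hm n).mul (hm m)).aestronglyMeasurable 1
      (Eventually.of_forall fun ω => by
        rw [Real.norm_eq_abs, abs_of_nonneg (mul_nonneg (h0 n ω) (h0 m ω))]
        exact mul_le_one₀ (h1 n ω) (h0 m ω) (h1 m ω))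
  set e : ℕ → ℝ := fun n => ∫ ω, Y n ω ∂P with he
  set Z : ℕ → Ω → ℝ := fun N ω => ∑ n ∈ Finset.range N, Y n ω with hZ
  set EZ : ℕ → ℝ := fun N => ∑ n ∈ Finset.range N, e n with hEZ
  have hsq : ∀ N ω, (Z N ω - EZ N) ^ 2 = ∑ n ∈ Finset.range N, ∑ m ∈ Finset.range N,
      (Y n ω - e n) * (Y m ω - e m) := by
    intro N ω
    rw [hZ, hEZ, ← Finset.sum_sub_distrib, sq, Finset.sum_mul_sum]
  have hici : ∀ n m, Integrable (fun ω => (Y n ω - e n) * (Y m ω - e m)) P := by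
    intro n m
    have : (fun ω => (Y n ω - e n) * (Y m ω - e m))
        = fun ω => Y n ω * Y m ω - e m * Y n ω - e n * Y m ω + e n * e m := by
      funext ω; ring
    rw [this]
    exact (((hii n m).sub ((hi n).const_mul _)).sub ((hi m).const_mul _)).add (integrable_const _)
  have hvar : ∀ N, 1 ≤ N → ∫ ω, (Z N ω - EZ N) ^ 2 ∂P ≤ C * (N : ℝ) ^ (2 - η) := by
    intro N hN
    refine le_trans (le_of_eq ?_) (hcov N hN)
    simp_rw [hsq]
    rw [integral_finsetSum _ fun n _ => integrable_finsetSum _ fun m _ => hici n m]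
    refine Finset.sum_congr rfl fun n _ => ?_
    rw [integral_finsetSum _ fun m _ => hici n m]
    refine Finset.sum_congr rfl fun m _ => ?_
    have : (fun ω => (Y n ω - e n) * (Y m ω - e m))
        = fun ω => Y n ω * Y m ω - e m * Y n ω - e n * Y m ω + e n * e m := by
      funext ω; ring
    have i1 : Integrable (fun ω => Y n ω * Y m ω - e m * Y n ω) P :=
      (hii n m).sub ((hi n).const_mul _)
    have i2 : Integrable (fun ω => Y n ω * Y m ω - e m * Y n ω - e n * Y m ω) P :=
      i1.sub ((hi m).const_mul _)
    rw [this, integral_add i2 (integrable_const _), integral_sub i1 ((hi m).const_mul _),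
      integral_sub (hii n m) ((hi n).const_mul _), integral_const_mul, integral_const_mul]
    simp only [integral_const, probReal_univ, smul_eq_mul, one_mul]
    change _ - e m * e n - e n * e m + e n * e m = _ - e n * e m
    ring
  -- Along the powers `(i+1)^q` with `q η > 2` the normalised variances are summable, so the
  -- normalised deviations tend to 0 almost surely.
  obtain ⟨q, hq⟩ := exists_nat_gt (2 / η)
  rw [div_lt_iff₀ hη] at hq
  have hq0 : q ≠ 0 := by
    rintro rfl; simp at hq; linarith
  set c : ℕ → ℕ := fun i => (i + 1) ^ q with hc
  have hc1 : ∀ i, 1 ≤ c i := fun i => Nat.one_le_pow _ _ (Nat.succ_pos i)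
  have hC : 0 ≤ C := by
    have := (integral_nonneg fun ω => sq_nonneg (Z 1 ω - EZ 1)).trans (hvar 1 le_rfl)
    simpa using this
  have hZm : ∀ N, Measurable (Z N) := fun N => Finset.measurable_fun_sum _ fun n _ => hm n
  have hmeas : ∀ i, Measurable fun ω => ENNReal.ofReal (((Z (c i) ω - EZ (c i)) / c i) ^ 2) :=
    fun i => ((((hZm _).sub_const _).div_const _).pow_const 2).ennreal_ofReal
  have hsqi : ∀ N, Integrable (fun ω => (Z N ω - EZ N) ^ 2) P := by
    intro N
    simp_rw [hsq]
    exact integrable_finsetSum _ fun n _ => integrable_finsetSum _ fun m _ => hici n m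
  have hbd : ∀ i, ∫⁻ ω, ENNReal.ofReal (((Z (c i) ω - EZ (c i)) / c i) ^ 2) ∂P
      ≤ ENNReal.ofReal (C * (1 / ((i + 1 : ℕ) : ℝ) ^ 2)) := by
    intro i
    have hcp : (0 : ℝ) < c i := by exact_mod_cast hc1 i
    have e1 : ∀ ω, ((Z (c i) ω - EZ (c i)) / c i) ^ 2
        = (1 / (c i : ℝ) ^ 2) * (Z (c i) ω - EZ (c i)) ^ 2 := fun ω => by rw [div_pow]; ring
    simp_rw [e1]
    rw [← ofReal_integral_eq_lintegral_ofReal ((hsqi _).const_mul _)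
      (Eventually.of_forall fun ω => by positivity), integral_const_mul]
    refine ENNReal.ofReal_le_ofReal ?_
    calc 1 / (c i : ℝ) ^ 2 * ∫ ω, (Z (c i) ω - EZ (c i)) ^ 2 ∂P
        ≤ 1 / (c i : ℝ) ^ 2 * (C * (c i : ℝ) ^ (2 - η)) := by gcongr; exact hvar _ (hc1 i)
      _ = C * (c i : ℝ) ^ (-η) := by
        rw [show 2 - η = (2 : ℕ) + (-η) by push_cast; ring, Real.rpow_add hcp, Real.rpow_natCast]
        field_simp
      _ ≤ C * (1 / ((i + 1 : ℕ) : ℝ) ^ 2) := by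
        gcongr
        have hi1 : (1 : ℝ) ≤ ((i + 1 : ℕ) : ℝ) := by exact_mod_cast Nat.succ_le_succ (Nat.zero_le i)
        have e2 : (c i : ℝ) ^ (-η) = ((i + 1 : ℕ) : ℝ) ^ (-(q * η)) := by
          rw [hc]
          push_cast
          rw [← Real.rpow_natCast, ← Real.rpow_mul (by positivity)]
          congr 1; ring
        have e3 : 1 / ((i + 1 : ℕ) : ℝ) ^ 2 = ((i + 1 : ℕ) : ℝ) ^ (-(2 : ℝ)) := by
          rw [Real.rpow_neg (by positivity), one_div]; norm_num
        rw [e2, e3]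
        exact Real.rpow_le_rpow_of_exponent_le hi1 (by linarith)
  have hsum : ∑' i, ∫⁻ ω, ENNReal.ofReal (((Z (c i) ω - EZ (c i)) / c i) ^ 2) ∂P ≠ ⊤ := by
    have hs : Summable fun i : ℕ => C * (1 / ((i + 1 : ℕ) : ℝ) ^ 2) :=
      ((summable_nat_add_iff 1).2 (Real.summable_one_div_nat_pow.2 one_lt_two)).mul_left C
    refine ne_top_of_le_ne_top ?_ (ENNReal.tsum_le_tsum hbd)
    rw [← ENNReal.ofReal_tsum_of_nonneg (fun i => by positivity) hs]
    exact ENNReal.ofReal_ne_top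
  filter_upwards [ae_tsum_ne_top hmeas hsum] with ω hω
  have hz : Tendsto (fun i => ((Z (c i) ω - EZ (c i)) / c i)) atTop (𝓝 0) := by
    have h2 := ENNReal.tendsto_atTop_zero_of_tsum_ne_top hω
    have h3 := (ENNReal.tendsto_toReal ENNReal.zero_ne_top).comp h2
    have h4 : Tendsto (fun i => ((Z (c i) ω - EZ (c i)) / c i) ^ 2) atTop (𝓝 0) := by
      refine h3.congr fun i => ?_
      exact ENNReal.toReal_ofReal (sq_nonneg _)
    have h5 := (Real.continuous_sqrt.tendsto 0).comp h4
    rw [Real.sqrt_zero] at h5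
    rw [tendsto_zero_iff_norm_tendsto_zero]
    refine h5.congr fun i => ?_
    simp only [Function.comp, Real.sqrt_sq_eq_abs, Real.norm_eq_abs]
  have hct : Tendsto c atTop atTop :=
    (tendsto_pow_atTop hq0).comp (tendsto_add_atTop_nat 1)
  -- The partial sums are monotone and consecutive sampling points have ratio tending to 1, which
  -- fills the gaps between them.
  refine tendsto_div_of_monotone_of_exists_subseq_tendsto_div (fun N => Z N ω) I ?_ fun a ha =>
    ⟨c, eventually_succ_pow_le q ha, hct, ?_⟩
  · exact monotone_nat_of_le_succ fun N => by
      simp only [hZ, Finset.sum_range_succ]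
      linarith [h0 N ω]
  · have := hz.add (hI.comp hct)
    rw [zero_add] at this
    refine this.congr fun i => ?_
    simp only [Function.comp]
    change (Z (c i) ω - EZ (c i)) / c i + EZ (c i) / c i = Z (c i) ω / c i
    ring

/-! ### Probability and density of missed patterns. -/

/-- Weights with the profile of a pseudo `k`-th power sequence restricted to an arc. -/
structure IsWeight (t : UnitAddCircle) (k : ℕ) (a κ s : ℝ) (v : ℕ → ℝ) : Prop where
  two_le : 2 ≤ k
  mul_eq_one : k * a = 1
  not_fin : ¬ IsOfFinAddOrder t
  arc_pos : 0 < s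
  coeff_pos : 0 < κ
  nonneg : ∀ m, 0 ≤ v m
  profile : HasProfile t a v (fun x => κ * (arc s).indicator 1 x)

namespace IsWeight

variable {t : UnitAddCircle} {k : ℕ} {a κ s : ℝ} {v : ℕ → ℝ}

lemma exp_pos (h : IsWeight t k a κ s v) : 0 < a := by
  have h1 := h.mul_eq_one
  have h2 : (0 : ℝ) ≤ k := Nat.cast_nonneg k
  by_contra hc
  nlinarith [not_lt.1 hc]

lemma exp_le (h : IsWeight t k a κ s v) : a ≤ 1 / 2 := by
  have h1 := h.mul_eq_one
  have h2 : (2 : ℝ) ≤ k := by exact_mod_cast h.two_le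
  nlinarith [h.exp_pos]

lemma exists_le (h : IsWeight t k a κ s v) : ∃ C, 0 < C ∧ ∀ m, v m ≤ C * binCoeff a m := by
  obtain ⟨C, hC⟩ := h.profile.bddAbove_range
  refine ⟨|C| + κ + 1, by have := h.coeff_pos; positivity, fun m => ?_⟩
  have hp := binCoeff_pos h.exp_pos m
  have h1 : v m / binCoeff a m - κ * (arc s).indicator 1 (m • t) ≤ C := hC ⟨m, rfl⟩
  have h2 : κ * (arc s).indicator 1 (m • t) ≤ κ := by
    have hk := h.coeff_pos
    by_cases hm : m • t ∈ arc s
    · simp [hm]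
    · simp [hm, hk.le]
  rw [← div_le_iff₀ hp]
  linarith [le_abs_self C]

end IsWeight

/-- All `k`-element sets with sum in `𝒩`. -/
def famSet (k : ℕ) (𝒩 : Finset ℕ) : Finset (Finset ℕ) := 𝒩.biUnion (reps k)

/-- The indicator of the event that no element of `𝒩` is a sum of `k` distinct chosen numbers. -/
def avoid (k : ℕ) (𝒩 : Finset ℕ) (x : ℕ → Bool) : ℝ := (0 : ℝ) ^ occCount (famSet k 𝒩) id x

lemma avoid_eq (k : ℕ) (𝒩 : Finset ℕ) (x : ℕ → Bool) : avoid k 𝒩 x =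
    if ∀ N ∈ 𝒩, ∀ S ∈ reps k N, ¬ ∀ m ∈ S, x m = true then 1 else 0 := by
  unfold avoid occCount famSet
  rw [zero_pow_eq]
  congr 1
  rw [Finset.card_eq_zero, Finset.filter_eq_empty_iff]
  simp only [Finset.mem_biUnion, forall_exists_index, and_imp, id]
  exact propext ⟨fun H N hN S hS => H N hN hS, fun H S N hN hS => H N hN S hS⟩

lemma avoid_nonneg (k : ℕ) (𝒩 : Finset ℕ) (x : ℕ → Bool) : 0 ≤ avoid k 𝒩 x := by
  rw [avoid_eq]; split_ifs <;> norm_num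

lemma avoid_le_one (k : ℕ) (𝒩 : Finset ℕ) (x : ℕ → Bool) : avoid k 𝒩 x ≤ 1 := by
  rw [avoid_eq]; split_ifs <;> norm_num

lemma avoid_union (k : ℕ) (𝒩 𝒩' : Finset ℕ) (x : ℕ → Bool) :
    avoid k (𝒩 ∪ 𝒩') x = avoid k 𝒩 x * avoid k 𝒩' x := by
  rw [avoid_eq, avoid_eq, avoid_eq, ite_zero_mul_ite_zero, one_mul]
  congr 1
  exact propext Finset.forall_mem_union

lemma pairwiseDisjoint_reps (k : ℕ) (𝒩 : Finset ℕ) :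
    (𝒩 : Set ℕ).PairwiseDisjoint (reps k) := by
  intro N _ N' _ h
  rw [Function.onFun, Finset.disjoint_left]
  intro S hS hS'
  exact h ((mem_reps.1 hS).2.symm.trans (mem_reps.1 hS').2)

lemma sum_famSet (k : ℕ) (𝒩 : Finset ℕ) (f : Finset ℕ → ℝ) :
    ∑ S ∈ famSet k 𝒩, f S = ∑ N ∈ 𝒩, ∑ S ∈ reps k N, f S :=
  Finset.sum_biUnion (pairwiseDisjoint_reps k 𝒩)

lemma wt_mul_wt_le {v : ℕ → ℝ} (hv : ∀ m, 0 ≤ v m) (hv1 : ∀ m, v m ≤ 1) (S S' : Finset ℕ) :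
    wt v S * wt v S' ≤ wt v (S ∪ S') := by
  have h : wt v (S ∪ S') * wt v (S ∩ S') = wt v S * wt v S' := Finset.prod_union_inter
  rw [← h]
  exact mul_le_of_le_one_right (wt_nonneg hv _) (Finset.prod_le_one (fun m _ => hv m) fun m _ => hv1 m)

/-- Since `v ≤ 1`, the product of the weights of two sets is at most the weight of their union. Both
parts of the error are thus bounded by overlaps, and the diagonal contributes the squares. -/
lemma poissonErr_le {v : ℕ → ℝ} (hv : ∀ m, 0 ≤ v m) (hv1 : ∀ m, v m ≤ 1) (k : ℕ)
    (𝒩 : Finset ℕ) :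
    poissonErr v (famSet k 𝒩) id ≤ 2 * (∑ N ∈ 𝒩, ∑ N' ∈ 𝒩, overlap v k N N')
      + ∑ N ∈ 𝒩, ∑ S ∈ reps k N, wt v S ^ 2 := by
  set g : Finset ℕ → Finset ℕ → ℝ := fun S S' =>
    if S ≠ S' ∧ ¬ Disjoint S S' then wt v (S ∪ S') else 0 with hg
  have h1 : ∀ S, ∑ S' ∈ ((famSet k 𝒩).filter fun S' => ¬ Disjoint (id S) (id S')).erase S,
      wt v (id S ∪ id S') = ∑ S' ∈ famSet k 𝒩, g S S' := by
    intro S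
    rw [hg, ← Finset.sum_filter]
    refine Finset.sum_congr ?_ fun _ _ => rfl
    ext S'
    simp only [Finset.mem_erase, Finset.mem_filter, id]
    tauto
  have h2 : ∀ S, wt v (id S) * ∑ S' ∈ (famSet k 𝒩).filter (fun S' => ¬ Disjoint (id S) (id S')),
      wt v (id S') ≤ wt v S ^ 2 + ∑ S' ∈ famSet k 𝒩, g S S' := by
    intro S
    rw [← h1]
    simp only [id]
    set F := (famSet k 𝒩).filter fun S' => ¬ Disjoint S S'
    have h3 : ∑ S' ∈ F, wt v S' ≤ ∑ S' ∈ insert S (F.erase S), wt v S' :=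
      Finset.sum_le_sum_of_subset_of_nonneg
        (fun x hx => by
          rw [Finset.mem_insert, Finset.mem_erase]
          by_cases hxS : x = S
          · exact Or.inl hxS
          · exact Or.inr ⟨hxS, hx⟩) fun _ _ _ => wt_nonneg hv _
    rw [Finset.sum_insert (Finset.notMem_erase _ _)] at h3
    have h4 : wt v S * ∑ S' ∈ F.erase S, wt v S' ≤ ∑ S' ∈ F.erase S, wt v (S ∪ S') := by
      rw [Finset.mul_sum]
      exact Finset.sum_le_sum fun S' _ => wt_mul_wt_le hv hv1 S S'
    have h5 := mul_le_mul_of_nonneg_left h3 (wt_nonneg hv S)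
    nlinarith
  have h3 : ∑ N ∈ 𝒩, ∑ N' ∈ 𝒩, overlap v k N N'
      = ∑ S ∈ famSet k 𝒩, ∑ S' ∈ famSet k 𝒩, g S S' := by
    rw [sum_famSet]
    refine Finset.sum_congr rfl fun N _ => ?_
    rw [Finset.sum_comm]
    simp_rw [sum_famSet]
    refine (Finset.sum_congr rfl fun N' _ => ?_)
    rw [overlap, overlapPairs, Finset.sum_filter, Finset.sum_product, Finset.sum_comm]
  rw [h3, ← sum_famSet k 𝒩 fun S => wt v S ^ 2, Finset.mul_sum, ← Finset.sum_add_distrib,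
    poissonErr]
  refine Finset.sum_le_sum fun S _ => ?_
  rw [h1]
  linarith [h2 S]

section

variable {Ω : Type*} [MeasurableSpace Ω] {P : Measure Ω}
  {X : ℕ → Ω → Bool} {t : UnitAddCircle} {k : ℕ} {a κ s : ℝ} {v : ℕ → ℝ}

lemma IsRandomSet.le_one [IsProbabilityMeasure P] (hX : IsRandomSet v P X) (m : ℕ) : v m ≤ 1 := by
  rw [← hX.prob]; exact measureReal_le_one

lemma dependsOn_avoid (k : ℕ) (𝒩 : Finset ℕ) :
    DependsOn (avoid k 𝒩) ((famSet k 𝒩).biUnion id : Set ℕ) :=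
  DependsOn.comp_left (dependsOn_occCount (famSet k 𝒩) id) _

/-- The weight `binCoeff (1 - a / 2) n` decays like `n^(-a/2)`. Allowing any finite set of integers
at least `n` gives joint as well as single probabilities. -/
theorem exists_avoid_err [IsProbabilityMeasure P] (hX : IsRandomSet v P X)
    (hv : IsWeight t k a κ s v) :
    ∃ D, 0 < D ∧ ∀ (𝒩 : Finset ℕ) (n : ℕ), (∀ N ∈ 𝒩, n ≤ N) →
      |(∫ ω, avoid k 𝒩 (fun m => X m ω) ∂P) - Real.exp (-∑ N ∈ 𝒩, sig v k N)|
        ≤ D * (𝒩.card : ℝ) ^ 2 * binCoeff (1 - a / 2) n := by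
  have ha := hv.exp_pos
  have ha1 := hv.exp_le
  obtain ⟨C, hC, hCv⟩ := hv.exists_le
  obtain ⟨D₁, hD₁, h₁⟩ := exists_overlap_le hv.nonneg ha hCv hv.mul_eq_one
  obtain ⟨D₂, hD₂, h₂⟩ := exists_sum_wt_sq_le hv.nonneg ha ha1 hCv hv.mul_eq_one
  refine ⟨2 * D₁ + D₂, by positivity, fun 𝒩 n hn => ?_⟩
  have hS : ∀ S ∈ famSet k 𝒩, (id S : Finset ℕ).Nonempty := by
    intro S hS
    obtain ⟨N, _, h⟩ := Finset.mem_biUnion.1 hS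
    have := (mem_reps.1 h).1
    have := hv.two_le
    rw [id, ← Finset.card_pos]; omega
  have h := abs_integral_sub_exp_le hX (famSet k 𝒩) id hS
  rw [sum_famSet k 𝒩 (fun S => wt v (id S))] at h
  refine h.trans ((poissonErr_le hv.nonneg hX.le_one k 𝒩).trans ?_)
  have hanti : ∀ N ∈ 𝒩, binCoeff (1 - a / 2) N ≤ binCoeff (1 - a / 2) n := fun N hN =>
    binCoeff_antitone (by linarith) (by linarith) (hn N hN)
  have hpos := binCoeff_nonneg (show 0 ≤ 1 - a / 2 by linarith) n
  have b1 : ∑ N ∈ 𝒩, ∑ N' ∈ 𝒩, overlap v k N N'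
      ≤ (𝒩.card : ℝ) ^ 2 * (D₁ * binCoeff (1 - a / 2) n) := by
    have : ∀ N ∈ 𝒩, ∑ N' ∈ 𝒩, overlap v k N N' ≤ 𝒩.card • (D₁ * binCoeff (1 - a / 2) n) := by
      intro N hN
      refine Finset.sum_le_card_nsmul _ _ _ fun N' hN' => ?_
      rcases le_total N N' with hle | hle
      · exact (h₁ N N' hle).trans (by have := hanti N hN; gcongr)
      · rw [overlap_comm]
        exact (h₁ N' N hle).trans (by have := hanti N' hN'; gcongr)
    refine (Finset.sum_le_card_nsmul _ _ _ this).trans (le_of_eq ?_)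
    simp only [nsmul_eq_mul]; ring
  have b2 : ∑ N ∈ 𝒩, ∑ S ∈ reps k N, wt v S ^ 2
      ≤ (𝒩.card : ℝ) ^ 2 * (D₂ * binCoeff (1 - a / 2) n) := by
    refine (Finset.sum_le_card_nsmul _ _ (D₂ * binCoeff (1 - a / 2) n) fun N hN => ?_).trans ?_
    · exact (h₂ N).trans (by have := hanti N hN; gcongr)
    · rw [nsmul_eq_mul]
      gcongr
      have : 𝒩.card ≤ 𝒩.card ^ 2 := Nat.le_self_pow two_ne_zero _
      exact_mod_cast this
  linarith

/-- The limit mean number of representations of `n` with `n t` near `x`. -/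
def intensity (k : ℕ) (κ s : ℝ) (x : UnitAddCircle) : ℝ :=
  κ ^ k / k.factorial * arcConv s (k - 1) x

lemma IsWeight.continuous_intensity (hv : IsWeight t k a κ s v) : Continuous (intensity k κ s) := by
  obtain ⟨j, hj⟩ := Nat.exists_eq_add_of_le hv.two_le
  unfold intensity
  rw [show k - 1 = j + 1 by omega]
  exact continuous_const.mul (continuous_arcConv_succ s j)

lemma intensity_nonneg (k : ℕ) {κ : ℝ} (hκ : 0 ≤ κ) (s : ℝ) (x : UnitAddCircle) :
    0 ≤ intensity k κ s x :=
  mul_nonneg (by positivity) (arcConv_nonneg _ _ _)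

lemma IsWeight.tendsto_sig (hv : IsWeight t k a κ s v) :
    Tendsto (fun n => sig v k n - intensity k κ s (n • t)) atTop (𝓝 0) := by
  obtain ⟨C, hC, hCv⟩ := hv.exists_le
  have hk := hv.two_le
  have e : ((k - 1 : ℕ) : ℝ) + 1 = k := by
    rw [Nat.cast_sub (by omega)]; ring
  have h := hasProfile_sig hv.nonneg hv.exp_pos hv.exp_le hCv hv.not_fin hv.profile (k - 1)
    (by rw [e, hv.mul_eq_one])
  rw [e, hv.mul_eq_one, show k - 1 + 1 = k by omega] at h
  refine h.congr fun n => ?_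
  rw [binCoeff_one, div_one]; rfl

lemma abs_exp_neg_sub_exp_neg_le {x y : ℝ} (hx : 0 ≤ x) (hy : 0 ≤ y) :
    |Real.exp (-x) - Real.exp (-y)| ≤ |x - y| := by
  wlog h : x ≤ y generalizing x y
  · rw [abs_sub_comm, abs_sub_comm x]; exact this hy hx (le_of_not_ge h)
  have h1 : Real.exp (-y) ≤ Real.exp (-x) := Real.exp_le_exp.2 (by linarith)
  rw [abs_of_nonneg (by linarith), abs_of_nonpos (by linarith)]
  have h2 : 1 - (y - x) ≤ Real.exp (-(y - x)) := by
    have := Real.add_one_le_exp (-(y - x)); linarith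
  have h3 : Real.exp (-y) = Real.exp (-x) * Real.exp (-(y - x)) := by
    rw [← Real.exp_add]; congr 1; ring
  have h4 : Real.exp (-x) ≤ 1 := Real.exp_le_one_iff.2 (by linarith)
  nlinarith [Real.exp_pos (-x)]

/-- The set `n + E`. -/
def shift (E : Finset ℕ) (n : ℕ) : Finset ℕ := E.image fun e => n + e

lemma card_shift (E : Finset ℕ) (n : ℕ) : (shift E n).card = E.card :=
  Finset.card_image_of_injective _ (add_right_injective n)

lemma sum_shift (E : Finset ℕ) (n : ℕ) (f : ℕ → ℝ) :
    ∑ N ∈ shift E n, f N = ∑ e ∈ E, f (n + e) :=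
  Finset.sum_image fun _ _ _ _ h => add_right_injective n h

lemma le_of_mem_shift {E : Finset ℕ} {n N : ℕ} (h : N ∈ shift E n) : n ≤ N := by
  obtain ⟨e, _, rfl⟩ := Finset.mem_image.1 h
  exact Nat.le_add_right n e

lemma tendsto_mean_avoid [IsProbabilityMeasure P] (hX : IsRandomSet v P X)
    (hv : IsWeight t k a κ s v) (E : Finset ℕ) :
    Tendsto (fun n => (∫ ω, avoid k (shift E n) (fun m => X m ω) ∂P)
      - Real.exp (-∑ e ∈ E, intensity k κ s (n • t + e • t))) atTop (𝓝 0) := by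
  obtain ⟨D, hD, h⟩ := exists_avoid_err hX hv
  have ha := hv.exp_pos
  have ha1 := hv.exp_le
  have h1 : Tendsto (fun n => D * (E.card : ℝ) ^ 2 * binCoeff (1 - a / 2) n) atTop (𝓝 0) := by
    have := (tendsto_binCoeff_div_binCoeff (a := 1 - a / 2) (b := 1) (by linarith)
      (by linarith)).const_mul (D * (E.card : ℝ) ^ 2)
    simpa using this
  have h2 : Tendsto (fun n => ∑ e ∈ E, |sig v k (n + e) - intensity k κ s ((n + e) • t)|)
      atTop (𝓝 0) := by
    rw [show (0 : ℝ) = ∑ e ∈ E, |(0 : ℝ)| by simp]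
    exact tendsto_finsetSum _ fun e _ =>
      ((tendsto_add_atTop_iff_nat e).2 hv.tendsto_sig).abs
  have h3 := h1.add h2
  rw [add_zero] at h3
  refine squeeze_zero_norm (fun n => ?_) h3
  have e1 := h (shift E n) n fun N hN => le_of_mem_shift hN
  rw [card_shift, sum_shift] at e1
  have e2 := abs_exp_neg_sub_exp_neg_le (x := ∑ e ∈ E, sig v k (n + e))
    (y := ∑ e ∈ E, intensity k κ s (n • t + e • t))
    (Finset.sum_nonneg fun e _ => sig_nonneg hv.nonneg _ _)
    (Finset.sum_nonneg fun e _ => intensity_nonneg k hv.coeff_pos.le s _)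
  rw [← Finset.sum_sub_distrib] at e2
  have e3 := Finset.abs_sum_le_sum_abs
    (fun e => sig v k (n + e) - intensity k κ s (n • t + e • t)) E
  simp_rw [add_nsmul]
  rw [Real.norm_eq_abs]
  refine (abs_sub_le _ _ _).trans (add_le_add e1 (e2.trans e3))

lemma abs_mul_sub_mul_le_add {x y p q : ℝ} (hx0 : 0 ≤ x) (hx : x ≤ 1) (hq0 : 0 ≤ q) (hq : q ≤ 1) :
    |p * q - x * y| ≤ |x - p| + |y - q| := by
  have e : p * q - x * y = -(q * (x - p) + x * (y - q)) := by ring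
  rw [e, abs_neg]
  refine (abs_add_le _ _).trans (add_le_add ?_ ?_)
  · rw [abs_mul, abs_of_nonneg hq0]; exact mul_le_of_le_one_left (abs_nonneg _) hq
  · rw [abs_mul, abs_of_nonneg hx0]; exact mul_le_of_le_one_left (abs_nonneg _) hx

lemma integral_avoid_mem [IsProbabilityMeasure P] (hX : IsRandomSet v P X) (𝒩 : Finset ℕ) :
    0 ≤ ∫ ω, avoid k 𝒩 (fun m => X m ω) ∂P ∧ ∫ ω, avoid k 𝒩 (fun m => X m ω) ∂P ≤ 1 := by
  refine ⟨integral_nonneg fun ω => avoid_nonneg _ _ _, ?_⟩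
  have := integral_mono (hX.integrable (dependsOn_avoid k 𝒩)) (integrable_const (1 : ℝ))
    fun ω => avoid_le_one k 𝒩 (fun m => X m ω)
  simpa using this

/-- If the two shifts are disjoint, missing both is missing their union, and the Poisson exponents
add; the covariance is then made of approximation errors only. Near the diagonal it is bounded
trivially by 1. -/
lemma exists_cov_le [IsProbabilityMeasure P] (hX : IsRandomSet v P X)
    (hv : IsWeight t k a κ s v) (E : Finset ℕ) :
    ∃ D, 0 < D ∧ ∀ n m : ℕ,
      (∫ ω, avoid k (shift E n) (fun m => X m ω) * avoid k (shift E m) (fun m => X m ω) ∂P)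
        - (∫ ω, avoid k (shift E n) (fun m => X m ω) ∂P)
          * ∫ ω, avoid k (shift E m) (fun m => X m ω) ∂P
      ≤ D * (binCoeff (1 - a / 2) n + binCoeff (1 - a / 2) m)
        + if n ≤ m + E.sup id ∧ m ≤ n + E.sup id then 1 else 0 := by
  obtain ⟨D, hD, h⟩ := exists_avoid_err hX hv
  have ha := hv.exp_pos
  have ha1 := hv.exp_le
  have hb := fun n => binCoeff_pos (show 0 < 1 - a / 2 by linarith) n
  -- The union has `2|E|` elements and costs `4 D |E|²`; the two separate events cost `D |E|²` each.
  refine ⟨6 * D * (E.card : ℝ) ^ 2 + 1, by positivity, fun n m => ?_⟩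
  simp_rw [← avoid_union]
  have m1 := integral_avoid_mem (k := k) hX (shift E n)
  have m2 := integral_avoid_mem (k := k) hX (shift E m)
  have m3 := integral_avoid_mem (k := k) hX (shift E n ∪ shift E m)
  split_ifs with hnm
  · have : 0 ≤ (6 * D * (E.card : ℝ) ^ 2 + 1) * (binCoeff (1 - a / 2) n + binCoeff (1 - a / 2) m) := by
      have := hb n; have := hb m; positivity
    nlinarith [mul_nonneg m1.1 m2.1]
  · have hdisj : Disjoint (shift E n) (shift E m) := by
      rw [Finset.disjoint_left]
      intro N h1 h2
      obtain ⟨e, he, rfl⟩ := Finset.mem_image.1 h1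
      obtain ⟨e', he', h3⟩ := Finset.mem_image.1 h2
      have l1 : e ≤ E.sup id := Finset.le_sup (f := id) he
      have l2 : e' ≤ E.sup id := Finset.le_sup (f := id) he'
      omega
    set b := max (binCoeff (1 - a / 2) n) (binCoeff (1 - a / 2) m) with hbdef
    have hanti := binCoeff_antitone (show 0 ≤ 1 - a / 2 by linarith) (by linarith)
    have hmin : binCoeff (1 - a / 2) (min n m) = b := hanti.map_min
    have e0 := h (shift E n ∪ shift E m) (min n m) fun N hN => by
      rcases Finset.mem_union.1 hN with hN | hN
      · exact (min_le_left _ _).trans (le_of_mem_shift hN)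
      · exact (min_le_right _ _).trans (le_of_mem_shift hN)
    have e1 := h (shift E n) n fun N hN => le_of_mem_shift hN
    have e2 := h (shift E m) m fun N hN => le_of_mem_shift hN
    rw [Finset.card_union_of_disjoint hdisj, Finset.sum_union hdisj, card_shift, card_shift,
      neg_add, Real.exp_add, hmin] at e0
    rw [card_shift] at e1 e2
    have e3 := abs_mul_sub_mul_le_add (y := ∫ ω, avoid k (shift E m) (fun m => X m ω) ∂P)
      (p := Real.exp (-∑ N ∈ shift E n, sig v k N)) m1.1 m1.2
      (Real.exp_pos (-∑ N ∈ shift E m, sig v k N)).le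
      (Real.exp_le_one_iff.2 (neg_nonpos.2 (Finset.sum_nonneg fun e _ => sig_nonneg hv.nonneg _ _)))
    have hb1 : binCoeff (1 - a / 2) n ≤ b := le_max_left _ _
    have hb2 : binCoeff (1 - a / 2) m ≤ b := le_max_right _ _
    have hb3 : b ≤ binCoeff (1 - a / 2) n + binCoeff (1 - a / 2) m :=
      max_le (by linarith [hb m]) (by linarith [hb n])
    have hK : 0 ≤ D * (E.card : ℝ) ^ 2 := by positivity
    have f1 := mul_le_mul_of_nonneg_left hb1 hK
    have f2 := mul_le_mul_of_nonneg_left hb2 hK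
    have f3 := mul_le_mul_of_nonneg_left hb3 hK
    push_cast at e0
    have e0' := (abs_le.1 e0).2
    have e3' := (abs_le.1 e3).2
    nlinarith [hb n, hb m]

/-- The means follow a continuous function along the orbit, so their averages converge by Weyl's
theorem. The covariances sum to `O(N^(2 - a/2))`, as the strong law requires. -/
theorem ae_tendsto_avoid [IsProbabilityMeasure P] (hX : IsRandomSet v P X)
    (hv : IsWeight t k a κ s v) (E : Finset ℕ) :
    ∀ᵐ ω ∂P, Tendsto (fun N : ℕ => (∑ n ∈ Finset.range N, avoid k (shift E n) (fun m => X m ω)) / N)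
      atTop (𝓝 (∫ x, Real.exp (-∑ e ∈ E, intensity k κ s (x + e • t)))) := by
  have ha := hv.exp_pos
  have ha1 := hv.exp_le
  have hcont : Continuous fun x => Real.exp (-∑ e ∈ E, intensity k κ s (x + e • t)) := by
    have := hv.continuous_intensity
    fun_prop
  obtain ⟨D, hD, hcov⟩ := exists_cov_le hX hv E
  obtain ⟨C, hC, hCb⟩ := exists_binCoeff_le_rpow (show 0 < 2 - a / 2 by linarith)
  set M := E.sup id with hM
  refine ae_tendsto_average (η := a / 2) (C := 2 * D * C + (2 * M + 1))
    (fun n => hX.measurable_comp (dependsOn_avoid k _)) (fun n ω => avoid_nonneg _ _ _)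
    (fun n ω => avoid_le_one _ _ _) (by linarith) ?_ ?_
  · have h1 := (tendsto_mean_avoid hX hv E).cesaro
    have h2 := tendsto_average hv.not_fin (RiemannApprox.of_continuous hcont)
    have h3 := h1.add h2
    rw [zero_add] at h3
    refine h3.congr fun N => ?_
    rw [inv_mul_eq_div, ← add_div, Finset.sum_sub_distrib, sub_add_cancel]
  · intro N hN
    have hN1 : (1 : ℝ) ≤ N := by exact_mod_cast hN
    have hb : ∑ n ∈ Finset.range N, binCoeff (1 - a / 2) n ≤ C * (N : ℝ) ^ (1 - a / 2) := by
      have h1 := sum_range_binCoeff (1 - a / 2) N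
      rw [Finset.sum_range_succ, show 1 - a / 2 + 1 = 2 - a / 2 by ring] at h1
      have h2 := hCb N hN
      rw [show 2 - a / 2 - 1 = 1 - a / 2 by ring] at h2
      have := binCoeff_pos (show 0 < 1 - a / 2 by linarith) N
      linarith
    have hcount : ∀ n ∈ Finset.range N, ∑ m ∈ Finset.range N,
        (if n ≤ m + M ∧ m ≤ n + M then (1 : ℝ) else 0) ≤ 2 * M + 1 := by
      intro n _
      rw [← Finset.sum_filter, Finset.sum_const, nsmul_eq_mul, mul_one]
      have : (Finset.range N).filter (fun m => n ≤ m + M ∧ m ≤ n + M) ⊆ Finset.Icc (n - M) (n + M) := by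
        intro m hm
        have := (Finset.mem_filter.1 hm).2
        rw [Finset.mem_Icc]; omega
      have h2 := Finset.card_le_card this
      rw [Nat.card_Icc] at h2
      have h3 : ((Finset.range N).filter (fun m => n ≤ m + M ∧ m ≤ n + M)).card ≤ 2 * M + 1 := by
        omega
      exact_mod_cast h3
    calc _ ≤ ∑ n ∈ Finset.range N, ∑ m ∈ Finset.range N,
          (D * (binCoeff (1 - a / 2) n + binCoeff (1 - a / 2) m)
            + if n ≤ m + M ∧ m ≤ n + M then (1 : ℝ) else 0) :=
          Finset.sum_le_sum fun n _ => Finset.sum_le_sum fun m _ => hcov n m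
      _ = 2 * D * N * (∑ n ∈ Finset.range N, binCoeff (1 - a / 2) n)
          + ∑ n ∈ Finset.range N, ∑ m ∈ Finset.range N,
            (if n ≤ m + M ∧ m ≤ n + M then (1 : ℝ) else 0) := by
          simp only [Finset.sum_add_distrib, ← Finset.mul_sum, Finset.sum_const, nsmul_eq_mul,
            Finset.card_range]
          ring
      _ ≤ 2 * D * N * (C * (N : ℝ) ^ (1 - a / 2)) + N * (2 * M + 1) := by
          gcongr
          refine (Finset.sum_le_sum hcount).trans (le_of_eq ?_)
          rw [Finset.sum_const, Finset.card_range, nsmul_eq_mul]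
      _ ≤ _ := by
          have e1 : (N : ℝ) ^ (2 - a / 2) = N * (N : ℝ) ^ (1 - a / 2) := by
            rw [show 2 - a / 2 = 1 + (1 - a / 2) by ring, Real.rpow_add (by linarith),
              Real.rpow_one]
          have e2 : (1 : ℝ) ≤ (N : ℝ) ^ (1 - a / 2) := Real.one_le_rpow hN1 (by linarith)
          rw [e1]
          have e3 : (N : ℝ) * (2 * M + 1) * 1 ≤ N * (2 * M + 1) * (N : ℝ) ^ (1 - a / 2) := by gcongr
          nlinarith

end

/-! ### Natural density and sumsets of sparse sets. -/

/-- The asymptotic density along the integers, with counting from `0`. -/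
def NatDens (A : Set ℕ) (δ : ℝ) : Prop :=
  Tendsto (fun N : ℕ => (∑ n ∈ Finset.range N, A.indicator (1 : ℕ → ℝ) n) / N) atTop (𝓝 δ)

lemma count_eq_sum (A : Set ℕ) (t : ℝ) : (count A t : ℝ)
    = (∑ n ∈ Finset.range (⌊t⌋₊ + 1), A.indicator (1 : ℕ → ℝ) n) - A.indicator 1 0 := by
  classical
  have h1 : A ∩ Set.Icc 1 ⌊t⌋₊ = ((Finset.Icc 1 ⌊t⌋₊).filter (· ∈ A) : Finset ℕ) := by
    ext n
    simp only [Set.mem_inter_iff, Set.mem_Icc, Finset.coe_filter, Finset.mem_Icc, Set.mem_ofPred_eq]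
    exact and_comm
  rw [count, h1, Set.ncard_coe_finset, Finset.sum_range_succ', add_sub_cancel_right,
    Finset.card_filter]
  push_cast
  have h2 : Finset.Icc 1 ⌊t⌋₊ = Finset.Ico (0 + 1) (⌊t⌋₊ + 1) := by
    ext n; simp only [Finset.mem_Icc, Finset.mem_Ico]; omega
  rw [h2, ← Finset.sum_Ico_add' (fun n => if n ∈ A then (1 : ℝ) else 0) 0 ⌊t⌋₊ 1,
    ← Finset.range_eq_Ico]
  simp only [Set.indicator_apply, Pi.one_apply]

lemma NatDens.hasDensity {A : Set ℕ} {δ : ℝ} (h : NatDens A δ) : HasDensity A δ := by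
  have h1 : Tendsto (fun N : ℕ => (∑ n ∈ Finset.range (N + 1), A.indicator (1 : ℕ → ℝ) n)
      / ((N + 1 : ℕ) : ℝ)) atTop (𝓝 δ) := h.comp (tendsto_add_atTop_nat 1)
  have h2 : Tendsto (fun t : ℝ => ((⌊t⌋₊ + 1 : ℕ) : ℝ) / t) atTop (𝓝 1) := by
    have := (tendsto_nat_floor_div_atTop (R := ℝ)).add (tendsto_inv_atTop_zero (𝕜 := ℝ))
    rw [add_zero] at this
    refine this.congr fun t => ?_
    push_cast
    rw [add_div, one_div]
  have h3 : Tendsto (fun t : ℝ => A.indicator (1 : ℕ → ℝ) 0 / t) atTop (𝓝 0) :=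
    tendsto_const_nhds.div_atTop tendsto_id
  have h4 := ((h1.comp tendsto_nat_floor_atTop).mul h2).sub h3
  rw [mul_one, sub_zero] at h4
  refine h4.congr fun t => ?_
  rw [count_eq_sum, sub_div]
  simp only [Function.comp]
  have : ((⌊t⌋₊ + 1 : ℕ) : ℝ) ≠ 0 := by positivity
  field_simp

lemma NatDens.compl {A : Set ℕ} {δ : ℝ} (h : NatDens A δ) : NatDens Aᶜ (1 - δ) := by
  refine (Tendsto.const_sub 1 h).congr' ?_
  filter_upwards [eventually_gt_atTop 0] with N hN
  have hN' : (N : ℝ) ≠ 0 := by positivity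
  have : ∑ n ∈ Finset.range N, Aᶜ.indicator (1 : ℕ → ℝ) n
      = N - ∑ n ∈ Finset.range N, A.indicator (1 : ℕ → ℝ) n := by
    rw [eq_sub_iff_add_eq, ← Finset.sum_add_distrib]
    have : ∀ n ∈ Finset.range N, Aᶜ.indicator (1 : ℕ → ℝ) n + A.indicator (1 : ℕ → ℝ) n = 1 := by
      intro n _
      by_cases hn : n ∈ A <;> simp [hn]
    rw [Finset.sum_congr rfl this]; simp
  rw [this, sub_div, div_self hN']

lemma NatDens.congr_zero {A B Z : Set ℕ} {δ : ℝ} (h : NatDens A δ) (hZ : NatDens Z 0)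
    (hAB : ∀ n, n ∉ Z → (n ∈ A ↔ n ∈ B)) : NatDens B δ := by
  have h1 : Tendsto (fun N : ℕ => (∑ n ∈ Finset.range N, B.indicator (1 : ℕ → ℝ) n) / N
      - (∑ n ∈ Finset.range N, A.indicator (1 : ℕ → ℝ) n) / N) atTop (𝓝 0) := by
    refine squeeze_zero_norm (fun N => ?_) hZ
    rw [← sub_div, ← Finset.sum_sub_distrib, norm_div, Real.norm_natCast]
    refine div_le_div_of_nonneg_right ?_ (Nat.cast_nonneg N)
    refine (norm_sum_le _ _).trans (Finset.sum_le_sum fun n _ => ?_)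
    by_cases hz : n ∈ Z
    · by_cases ha : n ∈ A <;> by_cases hb : n ∈ B <;> simp [ha, hb, hz]
    · by_cases ha : n ∈ A
      · simp [ha, (hAB n hz).1 ha, hz]
      · have hb : n ∉ B := fun hb => ha ((hAB n hz).2 hb)
        simp [ha, hb, hz]
  have := h1.add h
  rw [zero_add] at this
  exact this.congr fun N => by ring

lemma NatDens.zero_of_forall_le {A : Set ℕ}
    (h : ∀ ε > 0, ∀ᶠ N : ℕ in atTop, (∑ n ∈ Finset.range N, A.indicator (1 : ℕ → ℝ) n) / N ≤ ε) :
    NatDens A 0 := by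
  have h0 : ∀ N : ℕ, 0 ≤ (∑ n ∈ Finset.range N, A.indicator (1 : ℕ → ℝ) n) / N := fun N =>
    div_nonneg (Finset.sum_nonneg fun n _ => Set.indicator_nonneg (fun _ _ => zero_le_one) n)
      (Nat.cast_nonneg N)
  refine Metric.tendsto_nhds.2 fun ε hε => ?_
  filter_upwards [h (ε / 2) (by positivity)] with N hN
  rw [dist_zero_right, Real.norm_eq_abs, abs_of_nonneg (h0 N)]
  linarith

lemma NatDens.one_of_compl {A : Set ℕ} (h : NatDens Aᶜ 0) : NatDens A 1 := by
  have := h.compl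
  rwa [compl_compl, sub_zero] at this

lemma indicator_mono_set {A B : Set ℕ} (h : A ⊆ B) (n : ℕ) :
    A.indicator (1 : ℕ → ℝ) n ≤ B.indicator 1 n :=
  Set.indicator_le_indicator_of_subset h (fun _ => zero_le_one) n

lemma HasDensity.hasDensityIn {A B : Set ℕ} {α β : ℝ} (hA : HasDensity A α) (hB : HasDensity B β)
    (hβ : β ≠ 0) : HasDensityIn B A (α / β) := by
  refine (Tendsto.div hA hB hβ).congr' ?_
  filter_upwards [eventually_gt_atTop 0] with t ht
  exact div_div_div_cancel_right₀ ht.ne' _ _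

/-- The number of elements of `A` in `[0, N]`. -/
def cardUpTo (A : Set ℕ) (N : ℕ) : ℕ := (A ∩ Set.Iic N).ncard

lemma natDens_zero_of_card {Z : Set ℕ} {b : ℕ → ℝ} (hb : Tendsto (fun N => b N / N) atTop (𝓝 0))
    (h : ∀ N, ∃ F : Finset ℕ, (F.card : ℝ) ≤ b N ∧ ∀ n ∈ Z, n ≤ N → n ∈ F) : NatDens Z 0 := by
  classical
  refine squeeze_zero (fun N => div_nonneg (Finset.sum_nonneg fun n _ =>
    Set.indicator_nonneg (fun _ _ => zero_le_one) n) (Nat.cast_nonneg N)) (fun N => ?_) hb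
  obtain ⟨F, hF, hZ⟩ := h N
  refine div_le_div_of_nonneg_right (le_trans ?_ hF) (Nat.cast_nonneg N)
  have : ∑ n ∈ Finset.range N, Z.indicator (1 : ℕ → ℝ) n
      = (((Finset.range N).filter (· ∈ Z)).card : ℝ) := by
    rw [Finset.card_filter]; push_cast
    exact Finset.sum_congr rfl fun n _ => by simp [Set.indicator_apply]
  rw [this]
  exact_mod_cast Finset.card_le_card fun n hn => by
    rw [Finset.mem_filter, Finset.mem_range] at hn
    exact hZ n hn.2 hn.1.le

/-- The elements of `A` up to `N` as a finset. -/
lemma exists_finset_upTo (A : Set ℕ) (N : ℕ) :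
    ∃ F : Finset ℕ, F.card = cardUpTo A N ∧ ∀ n, n ∈ F ↔ n ∈ A ∧ n ≤ N := by
  have hf : (A ∩ Set.Iic N).Finite := (Set.finite_Iic N).inter_of_right _
  refine ⟨hf.toFinset, (Set.ncard_eq_toFinset_card _ hf).symm, fun n => ?_⟩
  simp

lemma natDens_sumset_zero {A : Set ℕ} {j : ℕ}
    (h : Tendsto (fun N : ℕ => (cardUpTo A N : ℝ) ^ j / N) atTop (𝓝 0)) :
    NatDens (sumset j A) 0 := by
  classical
  refine natDens_zero_of_card h fun N => ?_
  obtain ⟨F, hF, hmem⟩ := exists_finset_upTo A N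
  refine ⟨(Fintype.piFinset fun _ : Fin j => F).image fun a => ∑ i, a i, ?_, ?_⟩
  · have := Finset.card_image_le (s := Fintype.piFinset fun _ : Fin j => F) (f := fun a => ∑ i, a i)
    rw [Fintype.card_piFinset_const, hF] at this
    exact_mod_cast this
  · rintro n ⟨a, ha, rfl⟩ hn
    rw [Finset.mem_image]
    refine ⟨a, ?_, rfl⟩
    rw [Fintype.mem_piFinset]
    intro i
    rw [hmem]
    exact ⟨ha i, (Finset.single_le_sum (f := a) (fun _ _ => Nat.zero_le _) (Finset.mem_univ i)).trans hn⟩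

/-- The sums of `k` elements of `A` that are not pairwise distinct. -/
def repeatedSums (k : ℕ) (A : Set ℕ) : Set ℕ :=
  {n | ∃ a : Fin k → ℕ, (∀ i, a i ∈ A) ∧ ¬ Function.Injective a ∧ ∑ i, a i = n}

/-- The sums of `k` distinct elements of `A`. -/
def distinctSums (k : ℕ) (A : Set ℕ) : Set ℕ := {n | ∃ S ∈ reps k n, ∀ m ∈ S, m ∈ A}

/-- Dropping one of two equal summands leaves `j` free elements and a marked index that is counted
twice, so at most `j * A(N)^j` values occur. -/
lemma natDens_repeatedSums_zero {A : Set ℕ} {j : ℕ}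
    (h : Tendsto (fun N : ℕ => (cardUpTo A N : ℝ) ^ j / N) atTop (𝓝 0)) :
    NatDens (repeatedSums (j + 1) A) 0 := by
  classical
  have h' := h.const_mul (j : ℝ)
  rw [mul_zero] at h'
  simp_rw [← mul_div_assoc] at h'
  refine natDens_zero_of_card h' fun N => ?_
  obtain ⟨F, hF, hmem⟩ := exists_finset_upTo A N
  refine ⟨((Finset.univ : Finset (Fin j)) ×ˢ (Fintype.piFinset fun _ : Fin j => F)).image
    fun x => x.2 x.1 + ∑ i, x.2 i, ?_, ?_⟩
  · have := Finset.card_image_le (s := (Finset.univ : Finset (Fin j)) ×ˢ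
      (Fintype.piFinset fun _ : Fin j => F)) (f := fun x => x.2 x.1 + ∑ i, x.2 i)
    rw [Finset.card_product, Fintype.card_piFinset_const, hF,
      Finset.card_univ, Fintype.card_fin] at this
    exact_mod_cast this
  · rintro n ⟨a, ha, hni, rfl⟩ hn
    rw [Function.Injective] at hni
    push Not at hni
    obtain ⟨i, i', hii, hne⟩ := hni
    obtain ⟨l, hl⟩ := Fin.exists_succAbove_eq hne.symm
    rw [Finset.mem_image]
    refine ⟨(l, fun r => a (i.succAbove r)), ?_, ?_⟩
    · rw [Finset.mem_product]
      refine ⟨Finset.mem_univ _, ?_⟩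
      rw [Fintype.mem_piFinset]
      intro r
      rw [hmem]
      exact ⟨ha _, (Finset.single_le_sum (f := a) (fun _ _ => Nat.zero_le _)
        (Finset.mem_univ _)).trans hn⟩
    · dsimp only
      rw [hl, ← hii, ← Fin.sum_univ_succAbove]

lemma distinctSums_subset_sumset (k : ℕ) (A : Set ℕ) : distinctSums k A ⊆ sumset k A := by
  rintro n ⟨S, hS, hA⟩
  obtain ⟨hc, hs⟩ := mem_reps.1 hS
  refine ⟨fun i => S.orderEmbOfFin hc i, fun i => hA _ (Finset.orderEmbOfFin_mem S hc i), ?_⟩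
  rw [← hs]
  have := Finset.sum_image (s := Finset.univ) (f := fun m : ℕ => m) (g := S.orderEmbOfFin hc)
    fun x _ y _ h => (S.orderEmbOfFin hc).injective h
  rw [← this, Finset.image_orderEmbOfFin_univ]

lemma sumset_subset (k : ℕ) (A : Set ℕ) : sumset k A ⊆ distinctSums k A ∪ repeatedSums k A := by
  classical
  rintro n ⟨a, ha, hs⟩
  by_cases hi : Function.Injective a
  · left
    refine ⟨Finset.univ.image a, mem_reps.2 ⟨?_, ?_⟩, ?_⟩
    · rw [Finset.card_image_of_injective _ hi, Finset.card_univ, Fintype.card_fin]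
    · rw [Finset.sum_image fun x _ y _ h => hi h, hs]
    · intro m hm
      obtain ⟨i, _, rfl⟩ := Finset.mem_image.1 hm
      exact ha i
  · exact Or.inr ⟨a, ha, hi, hs⟩

lemma sumset_mono (k : ℕ) {A B : Set ℕ} (h : A ⊆ B) : sumset k A ⊆ sumset k B :=
  fun _ ⟨a, ha, hs⟩ => ⟨a, fun i => h (ha i), hs⟩

lemma add_mem_sumset {k : ℕ} {A : Set ℕ} {d n : ℕ} (hd : d ∈ A) (hn : n ∈ sumset k A) :
    d + n ∈ sumset (k + 1) A := by
  obtain ⟨a, ha, rfl⟩ := hn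
  refine ⟨Fin.cons d a, fun i => ?_, ?_⟩
  · refine Fin.cases ?_ (fun i => ?_) i
    · simpa using hd
    · simpa using ha i
  · rw [Fin.sum_univ_succ]; simp

lemma tendsto_cardUpTo_pow {A : Set ℕ} {C r : ℝ}
    (h : ∀ N : ℕ, (cardUpTo A N : ℝ) ≤ C * ((N : ℝ) + 1) ^ r) {j : ℕ} (hj : j * r < 1) :
    Tendsto (fun N : ℕ => (cardUpTo A N : ℝ) ^ j / N) atTop (𝓝 0) := by
  have h1 : Tendsto (fun N : ℕ => ((N : ℝ) + 1) ^ (-(1 - j * r))) atTop (𝓝 0) :=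
    (tendsto_rpow_neg_atTop (sub_pos.2 hj)).comp
      (tendsto_atTop_add_const_right _ _ tendsto_natCast_atTop_atTop)
  have h2 := h1.const_mul (2 * C ^ j)
  rw [mul_zero] at h2
  refine squeeze_zero' (Eventually.of_forall fun N => by positivity) ?_ h2
  filter_upwards [eventually_ge_atTop 1] with N hN
  have hN' : (1 : ℝ) ≤ N := by exact_mod_cast hN
  have hp : (0 : ℝ) < (N : ℝ) + 1 := by positivity
  have hC : 0 ≤ C := by
    have := (Nat.cast_nonneg (cardUpTo A 0)).trans (h 0)
    simpa using this
  rw [div_le_iff₀ (by positivity)]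
  calc (cardUpTo A N : ℝ) ^ j ≤ (C * ((N : ℝ) + 1) ^ r) ^ j := by gcongr; exact h N
    _ = C ^ j * ((N : ℝ) + 1) ^ (j * r) := by
      rw [mul_pow, ← Real.rpow_natCast (((N : ℝ) + 1) ^ r), ← Real.rpow_mul hp.le, mul_comm r]
    _ = C ^ j * (((N : ℝ) + 1) ^ (-(1 - j * r)) * ((N : ℝ) + 1)) := by
      congr 1
      rw [← Real.rpow_add_one hp.ne']; congr 1; ring
    _ ≤ C ^ j * (((N : ℝ) + 1) ^ (-(1 - j * r)) * (2 * N)) := by gcongr; linarith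
    _ = _ := by ring

/-! ### Sparsity of the random set and the density of its `k`-fold sumset. -/

/-- The set of chosen numbers. -/
def chosen {Ω : Type*} (X : ℕ → Ω → Bool) (ω : Ω) : Set ℕ := {m | X m ω = true}

section

variable {Ω : Type*} [MeasurableSpace Ω] {P : Measure Ω}
  {X : ℕ → Ω → Bool} {t : UnitAddCircle} {k : ℕ} {a κ s : ℝ} {v : ℕ → ℝ}

lemma IsRandomSet.measurableSet_true (hX : IsRandomSet v P X) (m : ℕ) :
    MeasurableSet {ω | X m ω = true} := hX.measurable m (measurableSet_singleton true)

lemma IsRandomSet.measure_true [IsProbabilityMeasure P] (hX : IsRandomSet v P X) (m : ℕ) :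
    P {ω | X m ω = true} = ENNReal.ofReal (v m) := by
  rw [← hX.prob, ofReal_measureReal]

lemma IsWeight.summable_mul_rpow (hv : IsWeight t k a κ s v) {r : ℝ} (hr : a < r) :
    Summable fun m : ℕ => v m * ((m : ℝ) + 1) ^ (-r) := by
  obtain ⟨C, hC, hCv⟩ := hv.exists_le
  obtain ⟨D, hD, hDb⟩ := exists_binCoeff_le_rpow hv.exp_pos
  rw [← summable_nat_add_iff 1]
  have h1 : Summable fun m : ℕ => C * D * ((m + 1 : ℕ) : ℝ) ^ (a - 1 - r) :=
    (((Real.summable_nat_rpow (p := a - 1 - r)).2 (by linarith)).comp_injective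
      (add_left_injective 1)).mul_left (C * D)
  refine Summable.of_nonneg_of_le (fun m => mul_nonneg (hv.nonneg _) (by positivity)) (fun m => ?_) h1
  have hp : (0 : ℝ) < ((m + 1 : ℕ) : ℝ) := by positivity
  have hr0 := hv.exp_pos
  have h2 : (((m + 1 : ℕ) : ℝ) + 1) ^ (-r) ≤ ((m + 1 : ℕ) : ℝ) ^ (-r) :=
    Real.rpow_le_rpow_of_nonpos hp (by linarith) (by linarith)
  have h3 : v (m + 1) ≤ C * D * ((m + 1 : ℕ) : ℝ) ^ (a - 1) := by
    refine (hCv _).trans ?_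
    rw [mul_assoc]
    exact mul_le_mul_of_nonneg_left (hDb _ (by omega)) hC.le
  rw [sub_eq_add_neg (a - 1), Real.rpow_add hp, ← mul_assoc]
  exact mul_le_mul h3 h2 (by positivity) (by positivity)

/-- The sum of `(m+1)^(-r)` over chosen `m` has finite expectation, so it is almost surely finite;
every chosen `m ≤ N` contributes at least `(N+1)^(-r)` to it. -/
lemma ae_exists_cardUpTo_le [IsProbabilityMeasure P] (hX : IsRandomSet v P X)
    (hv : IsWeight t k a κ s v) {r : ℝ} (hr : a < r) :
    ∀ᵐ ω ∂P, ∃ C : ℝ, ∀ N : ℕ, (cardUpTo (chosen X ω) N : ℝ) ≤ C * ((N : ℝ) + 1) ^ r := by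
  set f : ℕ → Ω → ENNReal := fun m =>
    {ω | X m ω = true}.indicator fun _ => ENNReal.ofReal (((m : ℝ) + 1) ^ (-r)) with hf
  have h1 : ∀ m, Measurable (f m) := fun m => measurable_const.indicator (hX.measurableSet_true m)
  have h2 : ∑' m, ∫⁻ ω, f m ω ∂P ≠ ⊤ := by
    have : ∀ m, ∫⁻ ω, f m ω ∂P = ENNReal.ofReal (v m * ((m : ℝ) + 1) ^ (-r)) := by
      intro m
      rw [hf, lintegral_indicator_const (hX.measurableSet_true m), hX.measure_true, mul_comm,
        ENNReal.ofReal_mul (hv.nonneg m)]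
    simp_rw [this]
    rw [← ENNReal.ofReal_tsum_of_nonneg (fun m => mul_nonneg (hv.nonneg m) (by positivity))
      (hv.summable_mul_rpow hr)]
    exact ENNReal.ofReal_ne_top
  have hr0 := hv.exp_pos
  filter_upwards [ae_tsum_ne_top h1 h2] with ω hω
  refine ⟨(∑' m, f m ω).toReal, fun N => ?_⟩
  obtain ⟨F, hF, hmem⟩ := exists_finset_upTo (chosen X ω) N
  have hp : (0 : ℝ) < (N : ℝ) + 1 := by positivity
  have h3 : (F.card : ℝ) * ((N : ℝ) + 1) ^ (-r) ≤ (∑' m, f m ω).toReal := by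
    have h4 : ENNReal.ofReal ((F.card : ℝ) * ((N : ℝ) + 1) ^ (-r)) ≤ ∑' m, f m ω := by
      refine le_trans ?_ (ENNReal.sum_le_tsum F)
      have h5 : ∀ m ∈ F, f m ω = ENNReal.ofReal (((m : ℝ) + 1) ^ (-r)) := fun m hm =>
        Set.indicator_of_mem (s := {ω | X m ω = true}) ((hmem m).1 hm).1 _
      rw [Finset.sum_congr rfl h5, ← ENNReal.ofReal_sum_of_nonneg fun m _ => by positivity]
      refine ENNReal.ofReal_le_ofReal ?_
      rw [← nsmul_eq_mul]
      refine Finset.card_nsmul_le_sum _ _ _ fun m hm => ?_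
      have : (m : ℝ) ≤ N := by exact_mod_cast ((hmem m).1 hm).2
      exact Real.rpow_le_rpow_of_nonpos (by positivity) (by linarith) (by linarith)
    have := ENNReal.toReal_mono hω h4
    rwa [ENNReal.toReal_ofReal (by positivity)] at this
  rw [hF, Real.rpow_neg hp.le, ← div_eq_mul_inv, div_le_iff₀ (by positivity)] at h3
  exact h3

lemma ae_tendsto_cardUpTo_pow [IsProbabilityMeasure P] (hX : IsRandomSet v P X)
    (hv : IsWeight t k a κ s v) :
    ∀ᵐ ω ∂P, ∀ j < k, Tendsto (fun N : ℕ => (cardUpTo (chosen X ω) N : ℝ) ^ j / N) atTop (𝓝 0) := by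
  have hk : (2 : ℝ) ≤ k := by exact_mod_cast hv.two_le
  have hka := hv.mul_eq_one
  -- The value `1 / (k - 1/2)` lies between `1/k` and `1/(k-1)`, so its product with any `j ≤ k - 1`
  -- is below 1.
  have hr : a < 2 / (2 * k - 1) := by
    rw [lt_div_iff₀ (by linarith)]
    nlinarith [hv.exp_pos]
  filter_upwards [ae_exists_cardUpTo_le hX hv hr] with ω ⟨C, hC⟩ j hj
  refine tendsto_cardUpTo_pow hC ?_
  have hj' : (j : ℝ) + 1 ≤ k := by exact_mod_cast hj
  rw [← mul_div_assoc, div_lt_one (by linarith)]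
  linarith

lemma avoid_eq_indicator (k : ℕ) (x : ℕ → Bool) (n : ℕ) :
    avoid k (shift {0} n) x = (distinctSums k {m | x m = true})ᶜ.indicator (1 : ℕ → ℝ) n := by
  classical
  rw [avoid_eq, Set.indicator_apply]
  simp only [shift, Finset.image_singleton, Finset.mem_singleton, forall_eq, add_zero,
    Set.mem_compl_iff, distinctSums, Set.mem_ofPred_eq, not_exists, not_and, Pi.one_apply]

lemma natDens_sumset_of_distinctSums {A : Set ℕ} {δ : ℝ} {k : ℕ} (h : NatDens (distinctSums k A) δ)
    (h0 : NatDens (repeatedSums k A) 0) : NatDens (sumset k A) δ :=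
  h.congr_zero h0 fun _ hn => ⟨fun h => distinctSums_subset_sumset k A h,
    fun h => (sumset_subset k A h).resolve_right hn⟩

theorem ae_natDens_sumset [IsProbabilityMeasure P] (hX : IsRandomSet v P X)
    (hv : IsWeight t k a κ s v) :
    ∀ᵐ ω ∂P, NatDens (sumset k (chosen X ω)) (1 - ∫ x, Real.exp (-intensity k κ s x)) := by
  filter_upwards [ae_tendsto_avoid hX hv {0}, ae_tendsto_cardUpTo_pow hX hv] with ω h1 h2
  have hk := hv.two_le
  refine natDens_sumset_of_distinctSums ?_ ?_
  · simp only [Finset.sum_singleton, zero_smul, add_zero, avoid_eq_indicator] at h1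
    have := NatDens.compl h1
    rwa [compl_compl] at this
  · have := natDens_repeatedSums_zero (h2 (k - 1) (by omega))
    rwa [Nat.sub_add_cancel (by omega)] at this

/-! ### Recurrence near each point of the arc, and the `(k+1)`-fold sumset. -/

/-- A bump function supported in `U ∩ arc s` minorises the indicator of `U` there. Convolution of
the damped weight with the constant 1 shows that its partial sums grow like a positive multiple of
`binCoeff (a + 1)`. -/
lemma IsWeight.not_summable_of_open (hv : IsWeight t k a κ s v) {U : Set UnitAddCircle}
    (hU : IsOpen U) (hne : (U ∩ arc s).Nonempty) :
    ¬ Summable fun m => U.indicator (1 : UnitAddCircle → ℝ) (m • t) * v m := by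
  obtain ⟨y, hy⟩ := hne
  have hW : IsOpen (U ∩ arc s) := hU.inter (isOpen_arc s)
  obtain ⟨p, hp0, hp1, hp⟩ := exists_continuous_zero_one_of_isClosed hW.isClosed_compl
    (isClosed_singleton (x := y)) (Set.disjoint_singleton_right.2 fun h => h hy)
  have hpW : ∀ x, x ∉ U ∩ arc s → p x = 0 := fun x hx => hp0 hx
  have h1 : HasProfile t a (fun m => p (m • t) * v m) (fun x => κ * p x) := by
    refine squeeze_zero_norm (fun m => ?_) (tendsto_zero_iff_norm_tendsto_zero.1 hv.profile)
    have e : p (m • t) * v m / binCoeff a m - κ * p (m • t) = p (m • t) *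
        (v m / binCoeff a m - κ * (arc s).indicator 1 (m • t)) := by
      by_cases hm : m • t ∈ arc s
      · rw [Set.indicator_of_mem hm]; simp only [Pi.one_apply]; ring
      · rw [hpW _ fun h => hm h.2]; ring
    rw [e, norm_mul]
    refine mul_le_of_le_one_left (norm_nonneg _) ?_
    rw [Real.norm_eq_abs, abs_of_nonneg (hp _).1]
    exact (hp _).2
  have ha := hv.exp_pos
  have hκp : Continuous fun x => κ * p x := continuous_const.mul p.continuous
  have h2 := HasProfile.conv ha (by linarith [hv.exp_le]) one_pos le_rfl hv.not_fin h1
    (g := fun _ => 1) (ψ := fun _ => 1) (by simp [HasProfile]) (RiemannApprox.of_continuous hκp)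
    (RiemannApprox.of_continuous continuous_const)
  have hI : 0 < ∫ x, κ * p x := by
    have hcp := hv.coeff_pos
    refine hκp.integral_pos_of_hasCompactSupport_nonneg_nonzero
      (HasCompactSupport.of_compactSpace _) (fun x => mul_nonneg hcp.le (hp x).1) (x := y) ?_
    rw [hp1 rfl]; simpa using hcp.ne'
  have h3 : Tendsto (fun n => conv (fun m => p (m • t) * v m) (fun _ => 1) n / binCoeff (a + 1) n)
      atTop (𝓝 (∫ x, κ * p x)) := by
    have := Tendsto.add_const (∫ x, κ * p x) h2
    rw [zero_add] at this
    refine this.congr fun n => ?_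
    rw [cconv_one_right]; ring
  have h4 := h3.pos_mul_atTop hI (tendsto_binCoeff_atTop (a := a + 1) (by linarith))
  have h5 : Tendsto (fun n => ∑ i ∈ Finset.range (n + 1), p (i • t) * v i) atTop atTop := by
    refine h4.congr fun n => ?_
    rw [div_mul_cancel₀ _ (binCoeff_pos (by linarith) n).ne', conv,
      Finset.Nat.sum_antidiagonal_eq_sum_range_succ_mk]
    simp
  intro hs
  have h6 : ∀ m, p (m • t) * v m ≤ U.indicator (1 : UnitAddCircle → ℝ) (m • t) * v m := by
    intro m
    refine mul_le_mul_of_nonneg_right ?_ (hv.nonneg m)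
    by_cases hm : m • t ∈ U
    · rw [Set.indicator_of_mem hm]; exact (hp _).2
    · rw [hpW _ fun h => hm h.1]
      exact Set.indicator_nonneg (fun _ _ => zero_le_one) _
  have h7 : Summable fun m => p (m • t) * v m :=
    Summable.of_nonneg_of_le (fun m => mul_nonneg (hp _).1 (hv.nonneg m)) h6 hs
  exact not_tendsto_atTop_of_tendsto_nhds
    (h7.hasSum.tendsto_sum_nat.comp (tendsto_add_atTop_nat 1)) h5

lemma ae_infinite_of_open [IsProbabilityMeasure P] (hX : IsRandomSet v P X)
    (hv : IsWeight t k a κ s v) {U : Set UnitAddCircle} (hU : IsOpen U)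
    (hne : (U ∩ arc s).Nonempty) :
    ∀ᵐ ω ∂P, {m | m ∈ chosen X ω ∧ m • t ∈ U}.Infinite := by
  classical
  -- Taking the empty set when `m • t ∉ U` keeps the events independent for all indices, as the
  -- second Borel–Cantelli lemma needs.
  set B : ℕ → Set Bool := fun m => if m • t ∈ U then {true} else ∅ with hB
  set S : ℕ → Set Ω := fun m => X m ⁻¹' B m with hS
  have hm : ∀ m, MeasurableSet (S m) := fun m => hX.measurable m (Set.toFinite _).measurableSet
  have hind : iIndepSet S P := by
    rw [iIndepSet_iff_meas_biInter hm]
    intro F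
    exact (iIndepFun_iff_measure_inter_preimage_eq_mul.1 hX.indep) F
      (fun i _ => (Set.toFinite (B i)).measurableSet)
  have hP : ∀ m, P (S m) = ENNReal.ofReal (U.indicator (1 : UnitAddCircle → ℝ) (m • t) * v m) := by
    intro m
    by_cases h : m • t ∈ U
    · have : S m = {ω | X m ω = true} := by
        ext ω; simp [hS, hB, h]
      rw [this, hX.measure_true, Set.indicator_of_mem h]; simp
    · have : S m = ∅ := by
        ext ω; simp [hS, hB, h]
      rw [this, Set.indicator_of_notMem h]; simp
  have htop : ∑' m, P (S m) = ⊤ := by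
    by_contra hc
    refine hv.not_summable_of_open hU hne ((ENNReal.summable_toReal hc).congr fun m => ?_)
    rw [hP, ENNReal.toReal_ofReal]
    exact mul_nonneg (Set.indicator_nonneg (fun _ _ => zero_le_one) _) (hv.nonneg m)
  have h1 := measure_limsup_eq_one hm hind htop
  have h2 : ∀ᵐ ω ∂P, ω ∈ limsup S atTop :=
    (prob_compl_eq_zero_iff (MeasurableSet.measurableSet_limsup hm)).2 h1
  filter_upwards [h2] with ω hω
  rw [mem_limsup_iff_frequently_mem, Nat.frequently_atTop_iff_infinite] at hω
  refine hω.mono fun m hm => ?_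
  by_cases h : m • t ∈ U
  · refine ⟨?_, h⟩
    have hm' : X m ω = true := by simpa [hS, hB, h] using hm
    exact hm'
  · simp [hS, hB, h] at hm

/-- A countable basis of the circle gives one exceptional null set for all points and
neighbourhoods. -/
lemma ae_infinite_of_nhds [IsProbabilityMeasure P] (hX : IsRandomSet v P X)
    (hv : IsWeight t k a κ s v) :
    ∀ᵐ ω ∂P, ∀ y ∈ arc s, ∀ V ∈ 𝓝 y, {m | m ∈ chosen X ω ∧ m • t ∈ V}.Infinite := by
  have h : ∀ᵐ ω ∂P, ∀ U ∈ TopologicalSpace.countableBasis UnitAddCircle,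
      (U ∩ arc s).Nonempty → {m | m ∈ chosen X ω ∧ m • t ∈ U}.Infinite := by
    rw [ae_ball_iff (TopologicalSpace.countable_countableBasis _)]
    intro U hU
    by_cases hne : (U ∩ arc s).Nonempty
    · filter_upwards [ae_infinite_of_open hX hv (TopologicalSpace.isOpen_of_mem_countableBasis hU)
        hne] with ω hω _ using hω
    · exact Eventually.of_forall fun ω h => absurd h hne
  filter_upwards [h] with ω hω y hy V hV
  obtain ⟨U, hU, hyU, hUV⟩ :=
    (TopologicalSpace.isBasis_countableBasis UnitAddCircle).mem_nhds_iff.1 hV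
  exact (hω U hU ⟨y, hyU, hy⟩).mono fun m hm => ⟨hm.1, hUV hm.2⟩

lemma intensity_pos_iff (hk : 1 ≤ k) (hκ : 0 < κ) (hs : 0 < s) (x : UnitAddCircle) :
    0 < intensity k κ s x ↔ x ∈ arc (k * s) := by
  have e : ((k - 1 : ℕ) : ℝ) + 1 = k := by rw [Nat.cast_sub hk]; ring
  rw [← e, ← arcConv_pos_iff hs, intensity]
  have : 0 < κ ^ k / k.factorial := by positivity
  exact mul_pos_iff_of_pos_left this

/-- The intensities seen from the chosen points accumulate. -/
lemma tendsto_sum_intensity (hv : IsWeight t k a κ s v) {A : Set ℕ}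
    (hA : ∀ y ∈ arc s, ∀ V ∈ 𝓝 y, {m | m ∈ A ∧ m • t ∈ V}.Infinite) {D : ℕ → Finset ℕ}
    (hD : ∀ n m, m ∈ D n ↔ m ∈ A ∧ m ≤ n) {x : UnitAddCircle} (hx : x ∈ arc ((k + 1) * s)) :
    Tendsto (fun n => ∑ d ∈ D n, intensity k κ s (x - d • t)) atTop atTop := by
  have hk := hv.two_le
  have hs := hv.arc_pos
  have hκ := hv.coeff_pos
  have hk0 : (0 : ℝ) < k := by positivity
  -- Write `x = y + (x - y)` with `y` in the arc `(0, s)` and `x - y` in the arc `(0, k s)`. Near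
  -- `y` the intensity at `x - z` exceeds a fixed `δ`, and infinitely many `d • t` fall there.
  rw [show (k + 1) * s = s + k * s by ring, mem_arc_add_iff hs (by positivity)] at hx
  obtain ⟨y, hy, hxy⟩ := hx
  have h0 := (intensity_pos_iff (by omega) hκ hs _).2 hxy
  set δ := intensity k κ s (x - y) / 2 with hδ
  have hδ0 : 0 < δ := half_pos h0
  have hcont : Continuous fun z => intensity k κ s (x - z) :=
    hv.continuous_intensity.comp (continuous_const.sub continuous_id)
  have hV : {z | δ < intensity k κ s (x - z)} ∈ 𝓝 y :=
    (isOpen_lt continuous_const hcont).mem_nhds (half_lt_self h0)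
  have hinf := hA y hy _ hV
  refine tendsto_atTop.2 fun b => ?_
  obtain ⟨F, hF, hcard⟩ := hinf.exists_subset_card_eq ⌈b / δ⌉₊
  filter_upwards [eventually_ge_atTop (F.sup id)] with n hn
  have hFD : F ⊆ D n := fun m hm =>
    (hD n m).2 ⟨(hF hm).1, (Finset.le_sup (f := id) hm).trans hn⟩
  calc b ≤ ⌈b / δ⌉₊ * δ := by
        rw [← div_le_iff₀ hδ0]; exact Nat.le_ceil _
    _ = F.card • δ := by rw [hcard, nsmul_eq_mul]
    _ ≤ ∑ d ∈ F, intensity k κ s (x - d • t) :=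
        Finset.card_nsmul_le_sum _ _ _ fun m hm => (hF hm).2.le
    _ ≤ _ := Finset.sum_le_sum_of_subset_of_nonneg hFD fun _ _ _ => intensity_nonneg k hκ.le s _

lemma tendsto_integral_exp_sum (hv : IsWeight t k a κ s v) (hs1 : (k + 1) * s = 1) {A : Set ℕ}
    (hA : ∀ y ∈ arc s, ∀ V ∈ 𝓝 y, {m | m ∈ A ∧ m • t ∈ V}.Infinite) {D : ℕ → Finset ℕ}
    (hD : ∀ n m, m ∈ D n ↔ m ∈ A ∧ m ≤ n) :
    Tendsto (fun n => ∫ x, Real.exp (-∑ d ∈ D n, intensity k κ s (x - d • t))) atTop (𝓝 0) := by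
  have hc := hv.continuous_intensity
  have hκ := hv.coeff_pos
  have h := tendsto_integral_of_dominated_convergence (μ := (volume : Measure UnitAddCircle))
    (F := fun n x => Real.exp (-∑ d ∈ D n, intensity k κ s (x - d • t))) (f := fun _ => 0)
    (fun _ => 1) (fun n => (Continuous.aestronglyMeasurable (by fun_prop)))
    (integrable_const 1) (fun n => Eventually.of_forall fun x => ?_) ?_
  · simpa using h
  · rw [Real.norm_eq_abs, Real.abs_exp, Real.exp_le_one_iff, neg_nonpos]
    exact Finset.sum_nonneg fun _ _ => intensity_nonneg k hκ.le s _
  · have h1 : ∀ᵐ x : UnitAddCircle, x ∈ arc ((k + 1) * s) := by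
      refine (prob_compl_eq_zero_iff (isOpen_arc _).measurableSet).2 ?_
      rw [hs1, measure_arc le_rfl, ENNReal.ofReal_one]
    filter_upwards [h1] with x hx
    exact Real.tendsto_exp_neg_atTop_nhds_zero.comp (tendsto_sum_intensity hv hA hD hx)

/-- If `M + n` is not in the `(k+1)`-fold sumset, no `M + n - d` with `d ∈ D` is a sum of `k`
distinct elements. Starting at `M` keeps the offsets `M - d` natural and costs at most `M` integers.
-/
lemma sum_indicator_compl_le {A : Set ℕ} {D : Finset ℕ} (hDA : ∀ d ∈ D, d ∈ A) {M : ℕ}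
    (hM : ∀ d ∈ D, d ≤ M) {x : ℕ → Bool} (hx : ∀ m, x m = true ↔ m ∈ A) (k N : ℕ) :
    ∑ n ∈ Finset.range N, (sumset (k + 1) A)ᶜ.indicator (1 : ℕ → ℝ) n
      ≤ M + ∑ n ∈ Finset.range N, avoid k (shift (D.image (M - ·)) n) x := by
  have h1 : ∀ n, (sumset (k + 1) A)ᶜ.indicator (1 : ℕ → ℝ) (M + n)
      ≤ avoid k (shift (D.image (M - ·)) n) x := by
    intro n
    by_cases hn : M + n ∈ sumset (k + 1) A
    · rw [Set.indicator_of_notMem (Set.notMem_compl_iff.2 hn)]; exact avoid_nonneg _ _ _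
    · rw [Set.indicator_of_mem hn, avoid_eq, if_pos]
      · simp
      · intro m hm S hS hall
        rw [shift, Finset.image_image, Finset.mem_image] at hm
        obtain ⟨d, hd, rfl⟩ := hm
        refine hn ?_
        have h2 : n + (M - d) ∈ sumset k A :=
          distinctSums_subset_sumset k A ⟨S, hS, fun m hm => (hx m).1 (hall m hm)⟩
        have h3 := add_mem_sumset (hDA d hd) h2
        have h4 := hM d hd
        rwa [show d + (n + (M - d)) = M + n by omega] at h3
  calc ∑ n ∈ Finset.range N, (sumset (k + 1) A)ᶜ.indicator (1 : ℕ → ℝ) n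
      ≤ ∑ n ∈ Finset.range (M + N), (sumset (k + 1) A)ᶜ.indicator (1 : ℕ → ℝ) n :=
        Finset.sum_le_sum_of_subset_of_nonneg (Finset.range_mono (by omega))
          fun _ _ _ => Set.indicator_nonneg (fun _ _ => zero_le_one) _
    _ = ∑ n ∈ Finset.range M, (sumset (k + 1) A)ᶜ.indicator (1 : ℕ → ℝ) n
        + ∑ n ∈ Finset.range N, (sumset (k + 1) A)ᶜ.indicator (1 : ℕ → ℝ) (M + n) :=
        Finset.sum_range_add _ _ _
    _ ≤ _ := by
        refine add_le_add ?_ (Finset.sum_le_sum fun n _ => h1 n)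
        calc _ ≤ ∑ n ∈ Finset.range M, (1 : ℝ) := Finset.sum_le_sum fun n _ =>
              Set.indicator_le_self' (fun _ _ => zero_le_one) n
          _ = M := by simp

/-- The pattern of offsets depends on the outcome, so the density statement is first taken for all
the countably many finite patterns at once. Growing initial segments of `A` then drive the missed
density to 0. -/
theorem ae_natDens_succ_sumset [IsProbabilityMeasure P] (hX : IsRandomSet v P X)
    (hv : IsWeight t k a κ s v) (hs1 : (k + 1) * s = 1) :
    ∀ᵐ ω ∂P, NatDens (sumset (k + 1) (chosen X ω)) 1 := by
  have h1 : ∀ᵐ ω ∂P, ∀ E : Finset ℕ, Tendsto (fun N : ℕ =>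
      (∑ n ∈ Finset.range N, avoid k (shift E n) (fun m => X m ω)) / N)
      atTop (𝓝 (∫ x, Real.exp (-∑ e ∈ E, intensity k κ s (x + e • t)))) :=
    ae_all_iff.2 fun E => ae_tendsto_avoid hX hv E
  filter_upwards [h1, ae_infinite_of_nhds hX hv] with ω hE hinf
  set A := chosen X ω
  choose D _ hD using exists_finset_upTo A
  refine NatDens.one_of_compl (NatDens.zero_of_forall_le fun ε hε => ?_)
  obtain ⟨M, hM⟩ := ((tendsto_integral_exp_sum hv hs1 hinf hD).eventually_lt_const
    (half_pos hε)).exists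
  have hDM : ∀ d ∈ D M, d ≤ M := fun d hd => ((hD M d).1 hd).2
  set E := (D M).image (M - ·) with hEdef
  -- Translation by `M • t` turns the offsets `M - d` into `-d`.
  have hint : ∫ x, Real.exp (-∑ e ∈ E, intensity k κ s (x + e • t))
      = ∫ x, Real.exp (-∑ d ∈ D M, intensity k κ s (x - d • t)) := by
    rw [← integral_add_right_eq_self (fun x => Real.exp (-∑ d ∈ D M, _)) (M • t)]
    refine integral_congr_ae (Eventually.of_forall fun x => ?_)
    simp only []
    rw [hEdef, Finset.sum_image]
    · congr 2
      refine Finset.sum_congr rfl fun d hd => ?_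
      congr 1
      have : M • t = (M - d) • t + d • t := by rw [← add_smul, Nat.sub_add_cancel (hDM d hd)]
      rw [this]; abel
    · intro d hd d' hd' h
      have h1 := hDM d hd
      have h2 := hDM d' hd'
      simp only at h
      omega
  have h2 := hE E
  rw [hint] at h2
  have h3 : Tendsto (fun N : ℕ => (M : ℝ) / N) atTop (𝓝 0) :=
    tendsto_const_nhds.div_atTop tendsto_natCast_atTop_atTop
  have h4 := h3.add h2
  rw [zero_add] at h4
  filter_upwards [h4.eventually_lt_const (hM.trans (half_lt_self hε))] with N hN
  refine le_trans ?_ hN.le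
  rw [← add_div]
  exact div_le_div_of_nonneg_right (sum_indicator_compl_le (fun d hd => ((hD M d).1 hd).1) hDM
    (fun m => Iff.rfl) k N) (Nat.cast_nonneg N)

end

/-! ### Pseudo powers on an arc as an instance of the model. -/

/-- The probabilities of a pseudo `k`-th power sequence restricted to the arc `(0, s)`. -/
def powWeight (k : ℕ) (c : ℝ) (t : UnitAddCircle) (s : ℝ) (m : ℕ) : ℝ :=
  (arc s).indicator 1 (m • t) * min 1 (c * (m : ℝ) ^ (-1 + 1 / (k : ℝ)))

/-- The asymptotics of `binCoeff (1/k)` bring in the factor `Γ(1/k)`. The truncation at 1 affects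
only finitely many `m`, as the probabilities tend to 0. -/
lemma isWeight_powWeight {k : ℕ} (hk : 2 ≤ k) {c : ℝ} (hc : 0 < c) {t : UnitAddCircle}
    (ht : ¬ IsOfFinAddOrder t) {s : ℝ} (hs : 0 < s) :
    IsWeight t k (1 / k) (c * Real.Gamma (1 / k)) s (powWeight k c t s) where
  two_le := hk
  mul_eq_one := mul_one_div_cancel (by positivity)
  not_fin := ht
  arc_pos := hs
  coeff_pos := by
    have : (0 : ℝ) < k := by positivity
    exact mul_pos hc (Real.Gamma_pos_of_pos (by positivity))
  nonneg m := mul_nonneg (Set.indicator_nonneg (fun _ _ => zero_le_one) _) (by positivity)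
  profile := by
    have hk2 : (2 : ℝ) ≤ k := by exact_mod_cast hk
    have hk1 : 1 / (k : ℝ) < 1 := by rw [div_lt_one (by linarith)]; linarith
    have h1 := (tendsto_rpow_div_binCoeff (a := 1 / (k : ℝ)) (by positivity)).const_mul c
    have h2 : Tendsto (fun m : ℕ => c * (m : ℝ) ^ (-1 + 1 / (k : ℝ))) atTop (𝓝 0) := by
      have := ((tendsto_rpow_neg_atTop (sub_pos.2 hk1)).comp
        (tendsto_natCast_atTop_atTop (R := ℝ))).const_mul c
      rw [mul_zero] at this
      refine this.congr fun m => ?_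
      simp only [Function.comp]
      congr 2; ring
    have h3 := (h1.sub_const (c * Real.Gamma (1 / k)))
    rw [sub_self] at h3
    refine squeeze_zero_norm' ?_ (tendsto_zero_iff_norm_tendsto_zero.1 h3)
    filter_upwards [h2.eventually_le_const one_pos] with m hm
    rw [powWeight, min_eq_right hm]
    by_cases hmt : m • t ∈ arc s
    · simp only [Set.indicator_of_mem hmt, Pi.one_apply, one_mul, mul_one]
      rw [show (1 : ℝ) / k - 1 = -1 + 1 / k by ring, mul_div_assoc]
    · simp only [Set.indicator_of_notMem hmt, zero_mul, mul_zero, zero_div, sub_zero, norm_zero]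
      exact norm_nonneg _

lemma zero_notMem_arc {s : ℝ} (hs : s ≤ 1) : (0 : UnitAddCircle) ∉ arc s := by
  rw [← AddCircle.coe_zero, coe_mem_arc_iff hs]
  simp

/-- The numbers whose multiple of `t` lies in the arc `(0, s)`. -/
def bohrSet (t : UnitAddCircle) (s : ℝ) : Set ℕ := {n | n • t ∈ arc s}

lemma T_eq_bohrSet (k : ℕ) (θ : ℝ) : T k θ = bohrSet (θ : UnitAddCircle) (1 / (k + 1)) := by
  have hs : 1 / ((k : ℝ) + 1) ≤ 1 := by
    rw [div_le_one (by positivity)]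
    have : (0 : ℝ) ≤ k := Nat.cast_nonneg k
    linarith
  ext n
  rw [T, bohrSet, Set.mem_ofPred_eq, Set.mem_ofPred_eq, ← AddCircle.coe_nsmul, nsmul_eq_mul,
    mul_comm (n : ℝ), coe_mem_arc_iff hs]
  refine ⟨fun h => h.2, fun h => ⟨Nat.one_le_iff_ne_zero.2 ?_, h⟩⟩
  rintro rfl
  simp at h

lemma not_isOfFinAddOrder_of_irrational {θ : ℝ} (h : Irrational θ) :
    ¬ IsOfFinAddOrder (θ : UnitAddCircle) := by
  rw [isOfFinAddOrder_iff_nsmul_eq_zero]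
  rintro ⟨n, hn, h0⟩
  rw [← AddCircle.coe_nsmul, AddCircle.coe_eq_zero_iff] at h0
  obtain ⟨z, hz⟩ := h0
  have h1 := h.natCast_mul hn.ne'
  refine h1.ne_int z ?_
  simpa using hz.symm

open Classical in
/-- The indicators of the random set restricted to the arc. -/
def arcRestrict {Ω : Type*} (t : UnitAddCircle) (s : ℝ) (ξ : ℕ → Ω → Bool) (m : ℕ) (ω : Ω) : Bool :=
  ξ m ω && decide (m • t ∈ arc s)

lemma chosen_arcRestrict {Ω : Type*} (t : UnitAddCircle) (s : ℝ) (ξ : ℕ → Ω → Bool) (ω : Ω) :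
    chosen (arcRestrict t s ξ) ω = {m | ξ m ω = true} ∩ bohrSet t s := by
  ext m
  simp [chosen, arcRestrict, bohrSet]

section

variable {Ω : Type*} [MeasurableSpace Ω] {P : Measure Ω} {k : ℕ} {c : ℝ} {ξ : ℕ → Ω → Bool}

/-- The law of `ξ 0` is not prescribed; since 0 is outside the arc, the restriction removes that
index. -/
lemma IsPseudoPowerSeq.isRandomSet (h : IsPseudoPowerSeq k c P ξ) (hc : 0 < c) (t : UnitAddCircle)
    {s : ℝ} (hs : s ≤ 1) : IsRandomSet (powWeight k c t s) P (arcRestrict t s ξ) where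
  measurable m := (measurable_of_countable fun b : Bool => b && _).comp (h.measurable m)
  indep := by
    classical
    exact h.indep.comp (fun m b => b && decide (m • t ∈ arc s)) fun m => measurable_of_countable _
  prob m := by
    rw [powWeight]
    by_cases hm : m • t ∈ arc s
    · have h1 : 1 ≤ m := by
        rw [Nat.one_le_iff_ne_zero]
        rintro rfl
        rw [zero_smul] at hm
        exact zero_notMem_arc hs hm
      rw [Set.indicator_of_mem hm, Pi.one_apply, one_mul]
      simp only [arcRestrict, hm, decide_true, Bool.and_true]
      rw [measureReal_def, h.prob m h1, ENNReal.toReal_ofReal (by positivity)]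
    · rw [Set.indicator_of_notMem hm, zero_mul]
      simp [arcRestrict, hm]

end

/-- A product of Bernoulli measures. Deterministic statements are obtained by picking one good
outcome of it. -/
lemma exists_isPseudoPowerSeq (k : ℕ) {c : ℝ} (hc : 0 < c) :
    ∃ (P : Measure (ℕ → Bool)) (ξ : ℕ → (ℕ → Bool) → Bool), IsProbabilityMeasure P ∧
      IsPseudoPowerSeq k c P ξ := by
  set p : ℕ → ℝ := fun m => min 1 (c * (m : ℝ) ^ (-1 + 1 / (k : ℝ)))
  have hp0 : ∀ m, 0 ≤ p m := fun m => by positivity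
  have hp1 : ∀ m, p m ≤ 1 := fun m => min_le_left _ _
  set μ : ℕ → Measure Bool := fun m =>
    ENNReal.ofReal (p m) • Measure.dirac true + ENNReal.ofReal (1 - p m) • Measure.dirac false
  have hμ : ∀ m, IsProbabilityMeasure (μ m) := fun m => ⟨by
    simp only [μ, Measure.add_apply, Measure.smul_apply, measure_univ, smul_eq_mul, mul_one]
    rw [← ENNReal.ofReal_add (hp0 m) (by linarith [hp1 m])]
    simp⟩
  refine ⟨Measure.infinitePi μ, fun m ω => ω m, inferInstance, fun m => measurable_pi_apply m,
    iIndepFun_infinitePi (X := fun _ b => b) fun m => measurable_id, fun m _ => ?_⟩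
  have h1 := (measurePreserving_eval_infinitePi μ m).measure_preimage
    (measurableSet_singleton true).nullMeasurableSet
  have h2 : μ m {true} = ENNReal.ofReal (p m) := by
    simp [μ]
  rw [← h2, ← h1]
  rfl

lemma intensity_const_mul (k : ℕ) (c κ s : ℝ) (x : UnitAddCircle) :
    intensity k (c * κ) s x = c ^ k * intensity k κ s x := by
  rw [intensity, intensity, mul_pow]; ring

lemma continuous_intensity' {k : ℕ} (hk : 2 ≤ k) (κ s : ℝ) : Continuous (intensity k κ s) := by
  obtain ⟨j, rfl⟩ := Nat.exists_eq_add_of_le hk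
  unfold intensity
  rw [show 2 + j - 1 = j + 1 by omega]
  exact continuous_const.mul (continuous_arcConv_succ s j)

/-! ### The missed density as a function of `c`. -/

/-- The density of the integers that are missed by the sums of `k` elements. -/
def missDensity (k : ℕ) (s c : ℝ) : ℝ :=
  ∫ x, Real.exp (-intensity k (c * Real.Gamma (1 / k)) s x)

section

variable {k : ℕ} {s : ℝ}

lemma norm_exp_neg_intensity_le (k : ℕ) {κ : ℝ} (hκ : 0 ≤ κ) (s : ℝ) (x : UnitAddCircle) :
    ‖Real.exp (-intensity k κ s x)‖ ≤ 1 := by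
  rw [Real.norm_eq_abs, Real.abs_exp, Real.exp_le_one_iff, neg_nonpos]
  exact intensity_nonneg k hκ s x

lemma gamma_one_div_pos (hk : 2 ≤ k) : 0 < Real.Gamma (1 / k) :=
  Real.Gamma_pos_of_pos (by positivity)

lemma continuousOn_missDensity (hk : 2 ≤ k) : ContinuousOn (missDensity k s) (Set.Ici 0) := by
  have hΓ := gamma_one_div_pos hk
  refine continuousOn_of_dominated (bound := fun _ => 1) (fun c _ => ?_)
    (fun c hc => Eventually.of_forall fun x => ?_) (integrable_const 1)
    (Eventually.of_forall fun x => ?_)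
  · have := continuous_intensity' hk (c * Real.Gamma (1 / k)) s
    exact Continuous.aestronglyMeasurable (by fun_prop)
  · exact norm_exp_neg_intensity_le k (mul_nonneg hc hΓ.le) s x
  · simp_rw [intensity_const_mul]
    fun_prop

lemma missDensity_zero (hk : 2 ≤ k) : missDensity k s 0 = 1 := by
  have : k ≠ 0 := by omega
  simp [missDensity, intensity, this]

/-- The integrand is antitone in `c` pointwise, and strictly so at the midpoint of the arc `(0, k
s)`, where the intensity is positive; continuity makes the integrals differ. -/
lemma strictAntiOn_missDensity (hk : 2 ≤ k) (hs : 0 < s) :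
    StrictAntiOn (missDensity k s) (Set.Ici 0) := by
  intro c hc c' hc' hcc
  have hc0 : (0 : ℝ) ≤ c := hc
  have hΓ := gamma_one_div_pos hk
  have hcont := fun c : ℝ => continuous_intensity' hk (c * Real.Gamma (1 / k)) s
  have hks : (0 : ℝ) < k * s := by positivity
  have hx : ((k * s / 2 : ℝ) : UnitAddCircle) ∈ arc (k * s) := ⟨_, ⟨by linarith, by linarith⟩, rfl⟩
  have hx0 := (intensity_pos_iff (by omega) hΓ hs _).2 hx
  have hpow : c ^ k < c' ^ k := pow_lt_pow_left₀ hcc hc0 (by omega)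
  have hle : ∀ x, intensity k (c * Real.Gamma (1 / k)) s x
      ≤ intensity k (c' * Real.Gamma (1 / k)) s x := fun x => by
    rw [intensity_const_mul, intensity_const_mul]
    exact mul_le_mul_of_nonneg_right hpow.le (intensity_nonneg k hΓ.le s x)
  have hc1 : ∀ c : ℝ, Continuous fun x => Real.exp (-intensity k (c * Real.Gamma (1 / k)) s x) := by
    intro c
    have := hcont c
    fun_prop
  rw [← sub_pos, missDensity, missDensity, ← integral_sub (integrable_of_continuous (hc1 _))
    (integrable_of_continuous (hc1 _))]
  refine ((hc1 c).sub (hc1 c')).integral_pos_of_hasCompactSupport_nonneg_nonzero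
    (HasCompactSupport.of_compactSpace _) (fun x => ?_) (x := ((k * s / 2 : ℝ) : UnitAddCircle)) ?_
  · simp only [Pi.zero_apply, sub_nonneg, Real.exp_le_exp, neg_le_neg_iff]
    exact hle x
  · refine (sub_pos.2 (Real.exp_lt_exp.2 (neg_lt_neg ?_))).ne'
    rw [intensity_const_mul, intensity_const_mul]
    exact mul_lt_mul_of_pos_right hpow hx0

/-- By homogeneity the intensity tends to infinity on the arc `(0, k s)` and stays 0 off it, so the
integrand tends to the indicator of the complement. -/
lemma tendsto_missDensity_atTop (hk : 2 ≤ k) (hs : 0 < s) (hks : k * s ≤ 1) :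
    Tendsto (missDensity k s) atTop (𝓝 (1 - k * s)) := by
  have hΓ := gamma_one_div_pos hk
  have hI : ∫ x, (arc (k * s))ᶜ.indicator (1 : UnitAddCircle → ℝ) x = 1 - k * s := by
    rw [integral_indicator_one (isOpen_arc _).measurableSet.compl,
      measureReal_compl (isOpen_arc _).measurableSet, probReal_univ, measureReal_def,
      measure_arc hks, ENNReal.toReal_ofReal (by positivity)]
  rw [← hI]
  refine tendsto_integral_filter_of_dominated_convergence (fun _ => 1)
    (Eventually.of_forall fun c => ?_) ?_ (integrable_const 1) (Eventually.of_forall fun x => ?_)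
  · have := continuous_intensity' hk (c * Real.Gamma (1 / k)) s
    exact Continuous.aestronglyMeasurable (by fun_prop)
  · filter_upwards [eventually_ge_atTop 0] with c hc
    exact Eventually.of_forall fun x => norm_exp_neg_intensity_le k (mul_nonneg hc hΓ.le) s x
  · have hiff := intensity_pos_iff (k := k) (by omega) hΓ hs x
    simp_rw [intensity_const_mul]
    by_cases hx : x ∈ arc (k * s)
    · rw [Set.indicator_of_notMem (Set.notMem_compl_iff.2 hx)]
      exact Real.tendsto_exp_neg_atTop_nhds_zero.comp
        ((tendsto_pow_atTop (by omega)).atTop_mul_const (hiff.2 hx))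
    · have h0 : intensity k (Real.Gamma (1 / k)) s x = 0 :=
        le_antisymm (not_lt.1 fun h => hx (hiff.1 h)) (intensity_nonneg k hΓ.le s x)
      rw [Set.indicator_of_mem (Set.mem_compl hx), h0]
      simp

end

lemma image_eq_Ioo {F : ℝ → ℝ} {L : ℝ} (hc : ContinuousOn F (Set.Ioi 0))
    (ha : StrictAntiOn F (Set.Ioi 0)) (h0 : Tendsto F (𝓝[>] 0) (𝓝 L))
    (h1 : Tendsto F atTop (𝓝 0)) : F '' Set.Ioi 0 = Set.Ioo 0 L := by
  have hle : ∀ c, 0 < c → 0 ≤ F c := fun c hc => le_of_tendsto h1 (by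
    filter_upwards [eventually_gt_atTop c] with x hx
    exact (ha hc (hc.trans hx) hx).le)
  have hge : ∀ c, 0 < c → F c ≤ L := fun c hc => ge_of_tendsto h0 (by
    filter_upwards [Ioo_mem_nhdsGT hc] with x hx
    exact (ha hx.1 hc hx.2).le)
  apply Set.Subset.antisymm
  · rintro _ ⟨c, hc, rfl⟩
    have hc : 0 < c := hc
    have h2 : (0 : ℝ) < c + 1 := by linarith
    have h3 : (0 : ℝ) < c / 2 := by linarith
    exact ⟨(hle _ h2).trans_lt (ha hc h2 (by linarith)),
      (ha h3 hc (by linarith)).trans_le (hge _ h3)⟩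
  · rintro y ⟨hy0, hy1⟩
    obtain ⟨c₁, hc₁, hc₁'⟩ :=
      ((h0.eventually_const_lt hy1).and self_mem_nhdsWithin).exists
    obtain ⟨c₂, hc₂, hc₂'⟩ := ((h1.eventually_lt_const hy0).and (eventually_gt_atTop 0)).exists
    exact isPreconnected_Ioi.intermediate_value (s := Set.Ioi (0 : ℝ)) hc₂' hc₁' hc
      ⟨hc₂.le, hc₁.le⟩

/-! ### Densities for `T` and for its random subsets. -/

lemma sumset_one (A : Set ℕ) : sumset 1 A = A := by
  ext n
  constructor
  · rintro ⟨a, ha, rfl⟩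
    simpa using ha 0
  · intro hn
    exact ⟨fun _ => n, fun _ => hn, by simp⟩

lemma natDens_bohrSet {t : UnitAddCircle} (ht : ¬ IsOfFinAddOrder t) {s : ℝ} (hs0 : 0 ≤ s)
    (hs : s ≤ 1) : NatDens (bohrSet t s) s := by
  have h := tendsto_average ht (riemannApprox_arc s)
  rw [integral_indicator_one (isOpen_arc _).measurableSet, measureReal_def, measure_arc hs,
    ENNReal.toReal_ofReal hs0] at h
  exact h

lemma sumset_bohrSet_subset (t : UnitAddCircle) {s : ℝ} (hs : 0 < s) (k : ℕ) :
    sumset (k + 1) (bohrSet t s) ⊆ bohrSet t ((k + 1) * s) := by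
  induction k with
  | zero => rw [sumset_one]; simp
  | succ k ih =>
    rintro n ⟨a, ha, rfl⟩
    have h1 : ∑ i : Fin (k + 1), a i.succ ∈ bohrSet t ((k + 1) * s) :=
      ih ⟨fun i => a i.succ, fun i => ha _, rfl⟩
    have h2 : a 0 • t ∈ arc s := ha 0
    rw [bohrSet, Set.mem_ofPred_eq]
    rw [show ((k + 1 : ℕ) + 1 : ℝ) * s = s + (k + 1) * s by push_cast; ring,
      mem_arc_add_iff hs (by positivity)]
    refine ⟨a 0 • t, h2, ?_⟩
    rw [Fin.sum_univ_succ, add_smul, add_sub_cancel_left]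
    exact h1

lemma randomSet_eq_chosen (k : ℕ) (θ : ℝ) {Ω : Type*} (ξ : ℕ → Ω → Bool) (ω : Ω) :
    randomSet k θ ξ ω = chosen (arcRestrict (θ : UnitAddCircle) (1 / (k + 1)) ξ) ω := by
  rw [chosen_arcRestrict, randomSet, T_eq_bohrSet]

lemma one_div_succ_le_one (k : ℕ) : 1 / ((k : ℝ) + 1) ≤ 1 := by
  rw [div_le_one (by positivity)]
  have : (0 : ℝ) ≤ k := Nat.cast_nonneg k
  linarith

lemma ae_natDens_randomSet {k : ℕ} (hk : 2 ≤ k) {θ : ℝ} (hθ : Irrational θ) {c : ℝ} (hc : 0 < c)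
    {Ω : Type*} [MeasurableSpace Ω] {P : Measure Ω} [IsProbabilityMeasure P] {ξ : ℕ → Ω → Bool}
    (h : IsPseudoPowerSeq k c P ξ) :
    ∀ᵐ ω ∂P, (∀ j < k, NatDens (sumset j (randomSet k θ ξ ω)) 0) ∧
      NatDens (sumset (k + 1) (randomSet k θ ξ ω)) 1 ∧
      NatDens (sumset k (randomSet k θ ξ ω)) (1 - missDensity k (1 / (k + 1)) c) := by
  have hX := h.isRandomSet hc (θ : UnitAddCircle) (one_div_succ_le_one k)
  have hv := isWeight_powWeight hk hc (not_isOfFinAddOrder_of_irrational hθ)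
    (s := 1 / ((k : ℝ) + 1)) (by positivity)
  filter_upwards [ae_tendsto_cardUpTo_pow hX hv, ae_natDens_sumset hX hv,
    ae_natDens_succ_sumset hX hv (mul_one_div_cancel (by positivity))] with ω h1 h2 h3
  rw [randomSet_eq_chosen]
  exact ⟨fun j hj => natDens_sumset_zero (h1 j hj), h3, h2⟩

/-- Above, the sumset lies in the Bohr set of the arc `(0, k/(k+1))`. Below, it contains the
`k`-fold sumset of a random subset, whose density approaches `k/(k+1)` for large `c`. -/
lemma natDens_sumset_T {k : ℕ} (hk : 1 ≤ k) {θ : ℝ} (hθ : Irrational θ) :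
    NatDens (sumset k (T k θ)) (k / (k + 1)) := by
  have ht := not_isOfFinAddOrder_of_irrational hθ
  have hkr : (0 : ℝ) < k := by exact_mod_cast hk
  have hle : (k : ℝ) / (k + 1) ≤ 1 := by rw [div_le_one (by positivity)]; linarith
  have hb := natDens_bohrSet ht (s := (k : ℝ) / (k + 1)) (by positivity) hle
  rcases hk.eq_or_lt with rfl | hk2
  · rw [sumset_one, T_eq_bohrSet]
    simpa using hb
  have hk2 : 2 ≤ k := hk2
  have hsub : sumset k (T k θ) ⊆ bohrSet (θ : UnitAddCircle) (k / (k + 1)) := by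
    rw [T_eq_bohrSet]
    obtain ⟨j, rfl⟩ := Nat.exists_eq_add_of_le' hk
    refine (sumset_bohrSet_subset _ (by positivity) j).trans_eq ?_
    congr 1
    push_cast
    ring
  have hmiss := tendsto_missDensity_atTop hk2 (s := 1 / ((k : ℝ) + 1)) (by positivity)
    (by rwa [mul_one_div])
  refine Metric.tendsto_nhds.2 fun ε hε => ?_
  obtain ⟨c, hc, hc0⟩ := ((hmiss.eventually_lt_const (lt_add_of_pos_right _ (half_pos hε))).and
    (eventually_gt_atTop 0)).exists
  obtain ⟨P, ξ, hP, hξ⟩ := exists_isPseudoPowerSeq k hc0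
  obtain ⟨ω, -, -, hω⟩ := (ae_natDens_randomSet hk2 hθ hc0 hξ).exists
  have hA : sumset k (randomSet k θ ξ ω) ⊆ sumset k (T k θ) :=
    sumset_mono k Set.inter_subset_right
  rw [mul_one_div] at hc
  filter_upwards [Tendsto.eventually_lt_const (u := (k : ℝ) / (k + 1) + ε) (by linarith) hb,
    Tendsto.eventually_const_lt (u := (k : ℝ) / (k + 1) - ε) (by linarith) hω] with N h1 h2
  have h3 : ∀ {A B : Set ℕ}, A ⊆ B → (∑ n ∈ Finset.range N, A.indicator (1 : ℕ → ℝ) n) / N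
      ≤ (∑ n ∈ Finset.range N, B.indicator (1 : ℕ → ℝ) n) / N := fun hAB =>
    div_le_div_of_nonneg_right (Finset.sum_le_sum fun n _ => indicator_mono_set hAB n)
      (Nat.cast_nonneg N)
  rw [Real.dist_eq, abs_lt]
  constructor
  · linarith [h3 hA]
  · linarith [h3 hsub]

lemma NatDens.hasDensityIn_sumset_T {k : ℕ} (hk : 1 ≤ k) {θ : ℝ} (hθ : Irrational θ) {A : Set ℕ}
    {α β : ℝ} (h : NatDens A α) (hβ : α = β * (k / (k + 1))) :
    HasDensityIn (sumset k (T k θ)) A β := by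
  have hkr : (0 : ℝ) < k := by exact_mod_cast hk
  have h0 : (k : ℝ) / (k + 1) ≠ 0 := by positivity
  have := h.hasDensity.hasDensityIn (natDens_sumset_T hk hθ).hasDensity h0
  rwa [hβ, mul_div_cancel_right₀ _ h0] at this

/-- The loss of density of the `k`-fold sumset. -/
def lossDensity (k : ℕ) (c : ℝ) : ℝ := missDensity k (1 / (k + 1)) c - 1 / (k + 1)

section

variable {k : ℕ}

lemma one_sub_one_div_succ (k : ℕ) : 1 - 1 / ((k : ℝ) + 1) = k / (k + 1) := by
  have : (k : ℝ) + 1 ≠ 0 := by positivity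
  field_simp; ring

lemma continuousOn_lossDensity (hk : 2 ≤ k) : ContinuousOn (lossDensity k) (Set.Ioi 0) :=
  ((continuousOn_missDensity hk).mono Set.Ioi_subset_Ici_self).sub continuousOn_const

lemma strictAntiOn_lossDensity (hk : 2 ≤ k) : StrictAntiOn (lossDensity k) (Set.Ioi 0) :=
  fun _ hx _ hy hxy => sub_lt_sub_right (strictAntiOn_missDensity hk (by positivity)
    (Set.Ioi_subset_Ici_self hx) (Set.Ioi_subset_Ici_self hy) hxy) _

lemma tendsto_lossDensity_zero (hk : 2 ≤ k) :
    Tendsto (lossDensity k) (𝓝[>] 0) (𝓝 ((k : ℝ) / (k + 1))) := by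
  have h := (continuousOn_missDensity (s := 1 / ((k : ℝ) + 1)) hk 0 Set.self_mem_Ici).mono_left
    (nhdsWithin_mono 0 Set.Ioi_subset_Ici_self)
  rw [missDensity_zero hk] at h
  have := Tendsto.sub_const h (1 / ((k : ℝ) + 1))
  rwa [one_sub_one_div_succ] at this

lemma tendsto_lossDensity_atTop (hk : 2 ≤ k) : Tendsto (lossDensity k) atTop (𝓝 0) := by
  have hk1 : (k : ℝ) * (1 / (k + 1)) = 1 - 1 / (k + 1) := by
    rw [one_sub_one_div_succ, mul_one_div]
  have h := (tendsto_missDensity_atTop hk (s := 1 / ((k : ℝ) + 1)) (by positivity)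
    (by rw [hk1]; have : (0 : ℝ) ≤ 1 / (k + 1) := by positivity
        linarith)).sub_const (1 / ((k : ℝ) + 1))
  rw [hk1, sub_sub_cancel, sub_self] at h
  exact h

lemma image_lossDensity (hk : 2 ≤ k) :
    lossDensity k '' Set.Ioi 0 = Set.Ioo 0 ((k : ℝ) / (k + 1)) :=
  image_eq_Ioo (continuousOn_lossDensity hk) (strictAntiOn_lossDensity hk)
    (tendsto_lossDensity_zero hk) (tendsto_lossDensity_atTop hk)

lemma exists_lossDensity_eq (hk : 2 ≤ k) {β : ℝ} (h0 : 0 < β) (h1 : β < 1) :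
    ∃ c, 0 < c ∧ lossDensity k c = (1 - β) * (k / (k + 1)) := by
  have hkr : (0 : ℝ) < k / (k + 1) := by positivity
  have : (1 - β) * ((k : ℝ) / (k + 1)) ∈ lossDensity k '' Set.Ioi 0 := by
    rw [image_lossDensity hk]
    constructor <;> nlinarith
  exact this

end

lemma missDensity_eq (k : ℕ) (c : ℝ) :
    1 - missDensity k (1 / (k + 1)) c = k / (k + 1) - lossDensity k c := by
  rw [lossDensity, ← one_sub_one_div_succ]; ring

lemma ae_hasDensityIn_randomSet {k : ℕ} (hk : 2 ≤ k) {θ : ℝ} (hθ : Irrational θ) {c β : ℝ}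
    (hc : 0 < c) (hβ : lossDensity k c = (1 - β) * (k / (k + 1)))
    {Ω : Type*} [MeasurableSpace Ω] {P : Measure Ω} [IsProbabilityMeasure P] {ξ : ℕ → Ω → Bool}
    (h : IsPseudoPowerSeq k c P ξ) :
    ∀ᵐ ω ∂P, HasDensityIn (sumset k (T k θ)) (sumset k (randomSet k θ ξ ω)) β := by
  filter_upwards [ae_natDens_randomSet hk hθ hc h] with ω hω
  refine hω.2.2.hasDensityIn_sumset_T (by omega) hθ ?_
  rw [missDensity_eq, hβ]; ring

/-! ### Deterministic sets. -/

/-- The sums of `k + 1` elements of `A` one of which is at most `M`. -/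
def lowSums (k M : ℕ) (A : Set ℕ) : Set ℕ :=
  {n | ∃ a : Fin (k + 1) → ℕ, (∀ i, a i ∈ A) ∧ (∃ i, a i ≤ M) ∧ ∑ i, a i = n}

lemma natDens_lowSums_zero {A : Set ℕ} {j : ℕ} (M : ℕ)
    (h : Tendsto (fun N : ℕ => (cardUpTo A N : ℝ) ^ j / N) atTop (𝓝 0)) :
    NatDens (lowSums j M A) 0 := by
  classical
  have h' := h.const_mul ((M + 1 : ℕ) : ℝ)
  rw [mul_zero] at h'
  simp_rw [← mul_div_assoc] at h'
  refine natDens_zero_of_card h' fun N => ?_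
  obtain ⟨F, hF, hmem⟩ := exists_finset_upTo A N
  refine ⟨((Finset.range (M + 1)) ×ˢ (Fintype.piFinset fun _ : Fin j => F)).image
    fun x => x.1 + ∑ i, x.2 i, ?_, ?_⟩
  · have := Finset.card_image_le (s := (Finset.range (M + 1)) ×ˢ
      (Fintype.piFinset fun _ : Fin j => F)) (f := fun x => x.1 + ∑ i, x.2 i)
    rw [Finset.card_product, Fintype.card_piFinset_const, hF, Finset.card_range] at this
    exact_mod_cast this
  · rintro n ⟨a, ha, ⟨i, hi⟩, rfl⟩ hn
    rw [Finset.mem_image]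
    refine ⟨(a i, fun r => a (i.succAbove r)), ?_, (Fin.sum_univ_succAbove _ i).symm⟩
    rw [Finset.mem_product]
    refine ⟨Finset.mem_range.2 (Nat.lt_succ_of_le hi), ?_⟩
    rw [Fintype.mem_piFinset]
    intro r
    rw [hmem]
    exact ⟨ha _, (Finset.single_le_sum (f := a) (fun _ _ => Nat.zero_le _)
      (Finset.mem_univ _)).trans hn⟩

/-- Only sums with a summand at most `M` can be lost: `M + 1` choices for it and `A(N)^j` for the
others, which is `o(N)`. -/
lemma natDens_sumset_inter_Ioi {A : Set ℕ} {j : ℕ} {δ : ℝ} (M : ℕ)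
    (h : Tendsto (fun N : ℕ => (cardUpTo A N : ℝ) ^ j / N) atTop (𝓝 0))
    (hA : NatDens (sumset (j + 1) A) δ) : NatDens (sumset (j + 1) (A ∩ Set.Ioi M)) δ := by
  refine hA.congr_zero (natDens_lowSums_zero M h) fun n hn => ⟨?_, fun H =>
    sumset_mono _ Set.inter_subset_left H⟩
  rintro ⟨a, ha, hs⟩
  refine ⟨a, fun i => ⟨ha i, ?_⟩, hs⟩
  by_contra hi
  exact hn ⟨a, ha, ⟨i, not_lt.1 hi⟩, hs⟩

lemma NatDens.one_of_subset {A : Set ℕ} {B : ℕ → Set ℕ} {δ : ℕ → ℝ}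
    (hB : ∀ i, NatDens (B i) (δ i)) (hδ : Tendsto δ atTop (𝓝 1)) (h : ∀ i, B i ⊆ A) :
    NatDens A 1 := by
  refine NatDens.one_of_compl (NatDens.zero_of_forall_le fun ε hε => ?_)
  obtain ⟨i, hi⟩ := (hδ.eventually_const_lt (sub_lt_self 1 hε)).exists
  filter_upwards [Tendsto.eventually_lt_const (u := ε) (by linarith) (hB i).compl] with N hN
  exact (div_le_div_of_nonneg_right (Finset.sum_le_sum fun n _ =>
    indicator_mono_set (Set.compl_subset_compl.2 (h i)) n) (Nat.cast_nonneg N)).trans hN.le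

/-- Countably many sparse sets have a sparse union after deletion of finitely many elements
from each. -/
lemma exists_sparse_union {A : ℕ → Set ℕ} {r r' : ℝ} (hr : r < r')
    (h : ∀ i, ∃ C : ℝ, ∀ N : ℕ, (cardUpTo (A i) N : ℝ) ≤ C * ((N : ℝ) + 1) ^ r) :
    ∃ M : ℕ → ℕ, ∀ N : ℕ,
      (cardUpTo (⋃ i, A i ∩ Set.Ioi (M i)) N : ℝ) ≤ 2 * ((N : ℝ) + 1) ^ r' := by
  classical
  choose C hC using h
  have h1 : ∀ i, ∀ᶠ N : ℕ in atTop,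
      (cardUpTo (A i) N : ℝ) ≤ (1 / 2) ^ i * ((N : ℝ) + 1) ^ r' := by
    intro i
    have h2 : Tendsto (fun N : ℕ => ((N : ℝ) + 1) ^ (r' - r)) atTop atTop :=
      (tendsto_rpow_atTop (sub_pos.2 hr)).comp
        (tendsto_atTop_add_const_right _ _ tendsto_natCast_atTop_atTop)
    filter_upwards [h2.eventually_ge_atTop (C i / (1 / 2) ^ i)] with N hN
    have hp : (0 : ℝ) < (N : ℝ) + 1 := by positivity
    rw [div_le_iff₀' (by positivity)] at hN
    refine (hC i N).trans ?_
    rw [show r' = (r' - r) + r by ring, Real.rpow_add hp, ← mul_assoc]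
    exact mul_le_mul_of_nonneg_right hN (by positivity)
  choose M₀ hM₀ using fun i => eventually_atTop.1 (h1 i)
  -- Cutting at `M₀ i` makes the `i`-th set contribute at most a share `2^(-i)` of the bound;
  -- cutting at `i` leaves only indices below `N`.
  refine ⟨fun i => max (M₀ i) i, fun N => ?_⟩
  obtain ⟨F, hF, hFm⟩ := exists_finset_upTo (⋃ i, A i ∩ Set.Ioi (max (M₀ i) i)) N
  choose G hG hGm using fun i => exists_finset_upTo (A i) N
  set I := (Finset.range N).filter fun i => M₀ i ≤ N
  have hsub : F ⊆ I.biUnion G := by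
    intro m hm
    obtain ⟨hm1, hm2⟩ := (hFm m).1 hm
    obtain ⟨i, hi1, hi2⟩ := Set.mem_iUnion.1 hm1
    have hi2 : max (M₀ i) i < m := hi2
    have h3 := (le_max_left (M₀ i) i).trans_lt hi2
    have h4 := (le_max_right (M₀ i) i).trans_lt hi2
    rw [Finset.mem_biUnion]
    exact ⟨i, Finset.mem_filter.2 ⟨Finset.mem_range.2 (by omega), by omega⟩,
      (hGm i m).2 ⟨hi1, hm2⟩⟩
  have hp : (0 : ℝ) ≤ ((N : ℝ) + 1) ^ r' := by positivity
  calc (cardUpTo (⋃ i, A i ∩ Set.Ioi (max (M₀ i) i)) N : ℝ) = F.card := by rw [hF]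
    _ ≤ ∑ i ∈ I, ((G i).card : ℝ) := by
        exact_mod_cast (Finset.card_le_card hsub).trans Finset.card_biUnion_le
    _ ≤ ∑ i ∈ I, (1 / 2 : ℝ) ^ i * ((N : ℝ) + 1) ^ r' := Finset.sum_le_sum fun i hi => by
        rw [hG]; exact hM₀ i N (Finset.mem_filter.1 hi).2
    _ = (∑ i ∈ I, (1 / 2 : ℝ) ^ i) * ((N : ℝ) + 1) ^ r' := (Finset.sum_mul _ _ _).symm
    _ ≤ 2 * ((N : ℝ) + 1) ^ r' := by
        refine mul_le_mul_of_nonneg_right ?_ hp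
        exact (summable_geometric_two.sum_le_tsum I fun _ _ => by positivity).trans_eq
          tsum_geometric_two

/-- Pseudo `(k+1)`-th powers on the arc of length `1/(k+1)` have an intensity that is positive
almost everywhere, so their `(k+1)`-fold sumsets have density tending to 1 with `c`. An exponent
between `1/(k+1)` and `1/k` keeps the union of their tails sparse enough for `jA`, `j ≤ k`, to be
null, and makes deleting initial segments harmless. -/
theorem exists_sparse_basis {k : ℕ} (hk : 1 ≤ k) {θ : ℝ} (hθ : Irrational θ) :
    ∃ A ⊆ T k θ, (∀ j ≤ k, NatDens (sumset j A) 0) ∧ NatDens (sumset (k + 1) A) 1 := by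
  have ht := not_isOfFinAddOrder_of_irrational hθ
  have hk1 : 2 ≤ k + 1 := by omega
  have hkr : (1 : ℝ) ≤ k := by exact_mod_cast hk
  set s : ℝ := 1 / ((k : ℝ) + 1) with hs
  have hs0 : 0 < s := by positivity
  have hks : ((k + 1 : ℕ) : ℝ) * s = 1 := by
    push_cast; exact mul_one_div_cancel (by positivity)
  obtain ⟨r, hr1, hr2⟩ : ∃ r : ℝ, 1 / ((k + 1 : ℕ) : ℝ) < r ∧ r < 1 / k :=
    exists_between (one_div_lt_one_div_of_lt (by positivity) (by push_cast; linarith))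
  obtain ⟨r', hr', hr''⟩ := exists_between hr2
  have hex : ∀ i : ℕ, ∃ A ⊆ T k θ,
      (∃ C : ℝ, ∀ N : ℕ, (cardUpTo A N : ℝ) ≤ C * ((N : ℝ) + 1) ^ r) ∧
      NatDens (sumset (k + 1) A) (1 - missDensity (k + 1) s (i + 1)) := by
    intro i
    have hc : (0 : ℝ) < i + 1 := by positivity
    obtain ⟨P, ξ, hP, hξ⟩ := exists_isPseudoPowerSeq (k + 1) hc
    have hX := hξ.isRandomSet hc (θ : UnitAddCircle) (one_div_succ_le_one k)
    have hv := isWeight_powWeight hk1 hc ht hs0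
    obtain ⟨ω, h1, h2⟩ :=
      ((ae_exists_cardUpTo_le hX hv hr1).and (ae_natDens_sumset hX hv)).exists
    refine ⟨_, ?_, h1, h2⟩
    rw [chosen_arcRestrict, ← T_eq_bohrSet]
    exact Set.inter_subset_right
  choose A hAT hAC hAd using hex
  obtain ⟨M, hM⟩ := exists_sparse_union hr' hAC
  have hrk : ∀ {x : ℝ}, x < 1 / k → ∀ j ≤ k, (j : ℝ) * x < 1 := by
    intro x hx j hj
    have hj' : (j : ℝ) ≤ k := by exact_mod_cast hj
    rw [lt_div_iff₀ (by linarith)] at hx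
    rcases le_or_gt 0 x with h0 | h0
    · nlinarith
    · have : (0 : ℝ) ≤ j := Nat.cast_nonneg j
      nlinarith
  refine ⟨⋃ i, A i ∩ Set.Ioi (M i), Set.iUnion_subset fun i =>
    Set.inter_subset_left.trans (hAT i), fun j hj => ?_, ?_⟩
  · exact natDens_sumset_zero (tendsto_cardUpTo_pow hM (hrk hr'' j hj))
  · have hlim : Tendsto (fun i : ℕ => 1 - missDensity (k + 1) s (i + 1)) atTop (𝓝 1) := by
      have h1 := ((tendsto_missDensity_atTop hk1 hs0 hks.le).comp
        (tendsto_atTop_add_const_right atTop (1 : ℝ)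
          (tendsto_natCast_atTop_atTop (R := ℝ)))).const_sub 1
      rw [hks, sub_self, sub_zero] at h1
      exact h1
    refine NatDens.one_of_subset (fun i => ?_) hlim fun i =>
      sumset_mono _ (Set.subset_iUnion (fun i => A i ∩ Set.Ioi (M i)) i)
    obtain ⟨C, hC⟩ := hAC i
    exact natDens_sumset_inter_Ioi (M i) (tendsto_cardUpTo_pow hC (hrk hr2 k le_rfl)) (hAd i)

lemma bohrSet_mono {t : UnitAddCircle} {s s' : ℝ} (h : s ≤ s') : bohrSet t s ⊆ bohrSet t s' :=
  fun _ ⟨x, hx, e⟩ => ⟨x, ⟨hx.1, hx.2.trans_le h⟩, e⟩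

/-- For `β = 0` the sparse basis itself serves. For `k = 1` and `β > 0` the Bohr set of the arc `(0,
β/2)` supplies the density and the basis the twofold sums; for `k ≥ 2` an outcome of the random set
is taken with `c` chosen by `exists_lossDensity_eq`. -/
theorem exists_subset_T {k : ℕ} (hk : 1 ≤ k) {θ : ℝ} (hθ : Irrational θ) {β : ℝ} (hβ0 : 0 ≤ β)
    (hβ1 : β < 1) :
    ∃ A ⊆ T k θ, (∀ j < k, 1 ≤ j → NatDens (sumset j A) 0) ∧
      NatDens (sumset k A) (β * (k / (k + 1))) ∧ NatDens (sumset (k + 1) A) 1 := by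
  obtain ⟨A, hAT, hA0, hA1⟩ := exists_sparse_basis hk hθ
  rcases hβ0.eq_or_lt with rfl | hβ
  · exact ⟨A, hAT, fun j hj _ => hA0 j hj.le, by rw [zero_mul]; exact hA0 k le_rfl, hA1⟩
  rcases hk.eq_or_lt with rfl | hk2
  · have hb := natDens_bohrSet (not_isOfFinAddOrder_of_irrational hθ) (s := β / 2) (by linarith)
      (by linarith)
    refine ⟨A ∪ bohrSet θ (β / 2), Set.union_subset hAT ?_, fun j hj hj' => by omega, ?_, ?_⟩
    · rw [T_eq_bohrSet]
      exact bohrSet_mono (by norm_num; linarith)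
    · have h0 := hA0 1 le_rfl
      rw [sumset_one] at h0 ⊢
      have : β * (((1 : ℕ) : ℝ) / ((1 : ℕ) + 1)) = β / 2 := by norm_num; ring
      rw [this]
      exact hb.congr_zero h0 fun n hn => ⟨Or.inr, fun h => h.resolve_left hn⟩
    · exact NatDens.one_of_subset (fun _ => hA1) tendsto_const_nhds fun _ =>
        sumset_mono _ Set.subset_union_left
  · obtain ⟨c, hc, hcβ⟩ := exists_lossDensity_eq hk2 hβ hβ1
    obtain ⟨P, ξ, hP, hξ⟩ := exists_isPseudoPowerSeq k hc
    obtain ⟨ω, h1, h2, h3⟩ := (ae_natDens_randomSet hk2 hθ hc hξ).exists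
    refine ⟨randomSet k θ ξ ω, Set.inter_subset_right, fun j hj _ => h1 j hj, ?_, h2⟩
    rw [missDensity_eq, hcβ] at h3
    convert h3 using 1
    ring

end PseudoPowers

end

theorem proposition7 :
    -- the random set, for `k ≥ 2`, with a function `F = F_k` that depends on `k` only
    (∀ k : ℕ, 2 ≤ k → ∃ F : ℝ → ℝ,
      ContinuousOn F (Set.Ioi 0) ∧
      StrictAntiOn F (Set.Ioi 0) ∧
      Tendsto F (𝓝[>] 0) (𝓝 ((k : ℝ) / (k + 1))) ∧
      Tendsto F atTop (𝓝 0) ∧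
      F '' Set.Ioi 0 = Set.Ioo 0 ((k : ℝ) / (k + 1)) ∧
      ∀ θ : ℝ, 1 < θ → Irrational θ → ∀ c : ℝ, 0 < c →
      ∀ (Ω : Type u) [MeasurableSpace Ω] (P : Measure Ω) [IsProbabilityMeasure P]
        (ξ : ℕ → Ω → Bool), PseudoPowers.IsPseudoPowerSeq k c P ξ →
      ∀ᵐ ω ∂P,
        (∀ j : ℕ, 1 ≤ j → j < k →
          PseudoPowers.HasDensity
            (PseudoPowers.sumset j (PseudoPowers.randomSet k θ ξ ω)) 0) ∧
        PseudoPowers.HasDensity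
          (PseudoPowers.sumset (k + 1) (PseudoPowers.randomSet k θ ξ ω)) 1 ∧
        PseudoPowers.HasDensity
          (PseudoPowers.sumset k (PseudoPowers.randomSet k θ ξ ω))
          ((k : ℝ) / (k + 1) - F c)) ∧
    -- a suitable `c` gives any prescribed density in `(0, 1)` of `kA` inside `kT`
    (∀ k : ℕ, 2 ≤ k → ∀ β : ℝ, 0 < β → β < 1 → ∃ c : ℝ, 0 < c ∧
      ∀ θ : ℝ, 1 < θ → Irrational θ →
      ∀ (Ω : Type u) [MeasurableSpace Ω] (P : Measure Ω) [IsProbabilityMeasure P]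
        (ξ : ℕ → Ω → Bool), PseudoPowers.IsPseudoPowerSeq k c P ξ →
      ∀ᵐ ω ∂P,
        PseudoPowers.HasDensityIn
          (PseudoPowers.sumset k (PseudoPowers.T k θ))
          (PseudoPowers.sumset k (PseudoPowers.randomSet k θ ξ ω)) β) ∧
    -- the resulting existence statement, for all `k ≥ 1` and all `β ∈ [0, 1)`
    (∀ k : ℕ, 1 ≤ k → ∀ θ : ℝ, 1 < θ → Irrational θ → ∀ β : ℝ, 0 ≤ β → β < 1 →
      ∃ A : Set ℕ, A ⊆ PseudoPowers.T k θ ∧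
        (∀ j : ℕ, 1 ≤ j → j < k →
          PseudoPowers.HasDensity (PseudoPowers.sumset j A) 0) ∧
        PseudoPowers.HasDensityIn
          (PseudoPowers.sumset k (PseudoPowers.T k θ)) (PseudoPowers.sumset k A) β ∧
        PseudoPowers.HasDensity (PseudoPowers.sumset (k + 1) A) 1) := by
  refine ⟨fun k hk => ⟨PseudoPowers.lossDensity k, PseudoPowers.continuousOn_lossDensity hk,
    PseudoPowers.strictAntiOn_lossDensity hk, PseudoPowers.tendsto_lossDensity_zero hk,
    PseudoPowers.tendsto_lossDensity_atTop hk, PseudoPowers.image_lossDensity hk, ?_⟩,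
    fun k hk β hβ0 hβ1 => ?_, fun k hk θ _ hθ β hβ0 hβ1 => ?_⟩
  · intro θ _ hθ c hc Ω _ P _ ξ hξ
    filter_upwards [PseudoPowers.ae_natDens_randomSet hk hθ hc hξ] with ω ⟨h1, h2, h3⟩
    rw [PseudoPowers.missDensity_eq] at h3
    exact ⟨fun j _ hj => (h1 j hj).hasDensity, h2.hasDensity, h3.hasDensity⟩
  · obtain ⟨c, hc, hcβ⟩ := PseudoPowers.exists_lossDensity_eq hk hβ0 hβ1
    exact ⟨c, hc, fun θ _ hθ Ω _ P _ ξ hξ =>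
      PseudoPowers.ae_hasDensityIn_randomSet hk hθ hc hcβ hξ⟩
  · obtain ⟨A, hAT, h1, h2, h3⟩ := PseudoPowers.exists_subset_T hk hθ hβ0 hβ1
    exact ⟨A, hAT, fun j hj hjk => (h1 j hjk hj).hasDensity,
      h2.hasDensityIn_sumset_T hk hθ rfl, h3.hasDensity⟩
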